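/- **Setting.** Let $\rho$ be a probability measure on $\mathbb R^d$, and let $(x_i,y_i)_{i=1}^N$, $N\ge 1$, be a fixed data set in $\mathbb R^d\times\mathbb R$. For each feature $j\le d$ fix thresholds $t_{j1},\dots,t_{jn}$; a *split* is a pair $(j,k)$. Fix a depth $m\ge 1$ and $\sigma,\delta>0$, and put $\lambda=\delta^2/\sigma^2$. An oblivious tree structure $\nu$ is a set of splits. Two points lie in the same leaf of $\nu$ iff they satisfy the same inequalities $z_j>t_{jk}$, $(j,k)\in\nu$; $\phi_\nu^{(\ell)}$ is the indicator of leaf $\ell$, and $N_\nu^{(\ell)}=\sum_i\phi^{(\ell)}_\nu(x_i)$. Below $0/0=0$. * SampleTree$(r;\beta)$: start with $\nu=\emptyset$; $m$ times (or until no split is left) add the unused split $s$ that maximizes $D(\nu\cup\{s\},r)-\beta\log(-\log u(s))$, with fresh independent uniform $u(s)$ on $[0,1]$, where $D(\nu,r)=\frac1N\sum_\ell \big(\sum_i\phi_\nu^{(\ell)}(x_i)r_i\big)^2/N_\nu^{(\ell)}$. * TrainGBDT on labels $Y$: $f_0=0$, $r_\tau=Y-f_\tau(\mathbf x_N)$,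 $\nu_\tau=\mathrm{SampleTree}(r_\tau;\beta)$, $f_{\tau+1}=(1-\frac{\lambda\epsilon}{N})f_\tau+\epsilon\sum_\ell\theta_\tau^{(\ell)}\phi_{\nu_\tau}^{(\ell)}$, where $\theta^{(\ell)}_\tau$ is the mean of $r_\tau$ over the training points in leaf $\ell$. * SamplePrior: $h_{T_0}=T_0^{-1/2}\sum_{\tau<T_0}\sum_\ell\theta_\tau^{(\ell)}\phi_{\nu_\tau}^{(\ell)}$ with independent $\nu_\tau=\mathrm{SampleTree}(0;1)$ and, given $\nu_\tau$, independent $\theta^{(\ell)}_\tau\sim\mathcal N\big(0,N/\max(N_{\nu_\tau}^{(\ell)},1)\big)$. * SamplePosterior (KGB): return $\sigma h_{T_0}+f_{T_1}$, where $f_{T_1}$ is the result of $T_1$ iterations of TrainGBDT on the labels $\mathbf y_N-\sigma h_{T_0}(\mathbf x_N)+\zeta$, $\zeta\sim\mathcal N(0,\delta^2I_N)$. The random numbers used by SamplePrior, $\zeta$ and those used by TrainGBDT are independent. Let $K(z,z')=\sum_\nu\pi(\nu)\sum_\ell\frac{N}{\max(N_\nu^{(\ell)},1)}\phi_\nu^{(\ell)}(z)\phi_\nu^{(\ell)}(z')$,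 where $\pi$ is uniform on the sets of $\min(m,nd)$ splits, and let $$\widetilde f(z)=K(z,\mathbf x_N)\big(K(\mathbf x_N,\mathbf x_N)+\lambda I_N\big)^{-1}\mathbf y_N,\qquad \widetilde C(z,z')=\sigma^2\Big(K(z,z')-K(z,\mathbf x_N)\big(K(\mathbf x_N,\mathbf x_N)+\lambda I_N\big)^{-1}K(\mathbf x_N,z')\Big).$$ By the *boosting limit* we mean that $T_1\to\infty$, $\epsilon\to0^+$, $\beta\to\infty$ and $\epsilon T_1\to\infty$ along arbitrary sequences. **Theorem (posterior sampling).** 1. For every $r\in\mathbb R^N$, the law of $\mathrm{SampleTree}(r;\beta)$ tends to $\pi$ as $\beta\to\infty$. 2. As $T_0\to\infty$, the process $h_{T_0}$ converges, in the sense of finite-dimensional distributions, to a (jointly measurable) process $h_\infty$. 3. Let $h_\infty$ be any jointly measurable process with the limiting law in 2, independent of $\zeta$ and of the random numbers of TrainGBDT, and let $f_{T_1}$ be trained on the labels $\mathbf y_N-\sigma h_\infty(\mathbf x_N)+\zeta$. Then there is a random function $f_\infty$ such that, in the boosting limit, $f_{T_1}\to f_\infty$ in mean square, both in $L^2(\rho)$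 and at every point of $\mathbb R^d$; the same $f_\infty$ serves all sequences. Moreover, if for some fixed $\epsilon,\beta>0$ the functions $f_{T_1}$ have a limit as $T_1\to\infty$, in mean square in $L^2(\rho)$ and at the training points, then this limit equals $f_\infty$ almost surely at $\rho$-almost every point. 4. When $T_0\to\infty$ jointly with the boosting limit, along arbitrary sequences, the output $\sigma h_{T_0}+f_{T_1}$ of SamplePosterior converges to $\sigma h_\infty+f_\infty$ in the sense of finite-dimensional distributions. 5. $\sigma h_\infty+f_\infty+\mathcal N(0,\delta^2)$ follows the Gaussian process posterior: * if $\eta$ is a centered Gaussian process on $\mathbb R^d$ with covariance $\delta^2\mathbf 1_{z=z'}$, independent of $h_\infty$, $\zeta$ and TrainGBDT, then $\sigma h_\infty+f_\infty+\eta$ is a Gaussian process with mean $\widetilde f(z)$ and covariance $\widetilde C(z,z')+\delta^2\mathbf 1_{z=z'}$; in particular its variance at $z$ is $\delta^2+\sigma^2\big(K(z,z)-K(z,\mathbf x_N)(K(\mathbf x_N,\mathbf x_N)+\lambda I_N)^{-1}K(\mathbf x_N,z)\big)$; * if $W$ is white noise $\mathcal{GP}(0,\delta^2\mathrm{Id})$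 on $L^2(\rho)$, independent of $h_\infty$, $\zeta$ and TrainGBDT, then $\sigma h_\infty+f_\infty+W\sim\mathcal{GP}(\widetilde f,\widetilde C+\delta^2\mathrm{Id})$ in the weak sense: the pairings $\int(\sigma h_\infty+f_\infty)g\,d\rho+W(g)$, $g\in L^2(\rho)$, are jointly normal with mean $\int\widetilde f g\,d\rho$ and covariance $\iint g(z)\widetilde C(z,z')g'(z')\,\rho(dz)\rho(dz')+\delta^2\langle g,g'\rangle_{L^2(\rho)}$. -/

import Mathlib

open MeasureTheory ProbabilityTheory Filter Topology
open scoped NNReal ENNReal Matrix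

namespace KGB

noncomputable section

/-! ### Oblivious trees on `ℝ^d` -/

/-- Candidate splits: a feature index together with a threshold index, ordered lexicographically
(the order is used only to break ties in an argmax). -/
abbrev Split (d n : ℕ) : Type := Fin d ×ₗ Fin n

/-- The data that determine the space of trees and the kernels: the `n` thresholds of each
feature, the training inputs `x_1, …, x_N`, and the maximal depth `m`. -/
structure TreeSpec (d n N : ℕ) where
  threshold : Fin d → Fin n → ℝ
  input : Fin N → EuclideanSpace ℝ (Fin d)
  depth : ℕ

variable {d n N : ℕ}

open Classical in
/-- An oblivious tree structure is a set `ν` of splits. Its leaves are indexed by the subsets of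
`ν`: a point lies in the leaf of those splits whose threshold it exceeds. -/
def leafOf (S : TreeSpec d n N) (ν : Finset (Split d n)) (z : EuclideanSpace ℝ (Fin d)) :
    Finset (Split d n) :=
  ν.filter fun s => S.threshold (ofLex s).1 (ofLex s).2 < z (ofLex s).1

/-- The leaf indicator `φ_ν^{(ℓ)}(z)`. -/
def leafInd (S : TreeSpec d n N) (ν ℓ : Finset (Split d n)) (z : EuclideanSpace ℝ (Fin d)) : ℝ :=
  if leafOf S ν z = ℓ then 1 else 0

/-- The number `N_ν^{(ℓ)}` of training inputs in a leaf. -/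
def leafCount (S : TreeSpec d n N) (ν ℓ : Finset (Split d n)) : ℝ :=
  ∑ i, leafInd S ν ℓ (S.input i)

/-- The weight `N / max (N_ν^{(ℓ)}, 1)` of a leaf. -/
def leafWeight (S : TreeSpec d n N) (ν ℓ : Finset (Split d n)) : ℝ :=
  N / max (leafCount S ν ℓ) 1

/-- The score `D(ν, r)`; a leaf without training inputs contributes `0`. -/
def score (S : TreeSpec d n N) (ν : Finset (Split d n)) (r : Fin N → ℝ) : ℝ :=
  1 / N * ∑ ℓ ∈ ν.powerset, (∑ i, leafInd S ν ℓ (S.input i) * r i) ^ 2 / leafCount S ν ℓ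

open Classical in
/-- The maximizers of `g` over `A`. -/
def maximizers (A : Finset (Split d n)) (g : Split d n → ℝ) : Finset (Split d n) :=
  A.filter fun s => ∀ s' ∈ A, g s' ≤ g s

open Classical in
/-- The tree structure after `i` greedy steps of SampleTree: among the splits not used so far, the
one maximizing the score plus Gumbel noise `-β log (-log u_i(s))` is added (the smallest maximizer
in case of a tie; nothing is added when no split is left). -/
def growTree (S : TreeSpec d n N) (β : ℝ) (r : Fin N → ℝ) (u : ℕ → Split d n → ℝ) :
    ℕ → Finset (Split d n)
  | 0 => ∅
  | i + 1 =>
    let ν := growTree S β r u i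
    let M := maximizers (Finset.univ \ ν)
      fun s => score S (insert s ν) r - β * Real.log (-Real.log (u i s))
    if h : M.Nonempty then insert (M.min' h) ν else ν

/-- `SampleTree(r; m, n, β)` as a function of the uniform variables `u` it consumes. -/
def sampleTree (S : TreeSpec d n N) (β : ℝ) (r : Fin N → ℝ) (u : ℕ → Split d n → ℝ) :
    Finset (Split d n) :=
  growTree S β r u S.depth

/-! ### Gradient boosting and the two sampling algorithms -/

/-- The average residual in a leaf (`0` for a leaf without training inputs). -/
def leafMean (S : TreeSpec d n N) (ν ℓ : Finset (Split d n)) (r : Fin N → ℝ) : ℝ :=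
  (∑ i, leafInd S ν ℓ (S.input i) * r i) / leafCount S ν ℓ

/-- `TrainGBDT` on the labels `Y`, as a function of the uniform variables `u τ` consumed by
SampleTree at iteration `τ`; the last argument is the number of iterations. -/
def trainGBDT (S : TreeSpec d n N) (ε β lam : ℝ) (Y : Fin N → ℝ) (u : ℕ → ℕ → Split d n → ℝ) :
    ℕ → EuclideanSpace ℝ (Fin d) → ℝ
  | 0 => fun _ => 0
  | τ + 1 =>
    let f := trainGBDT S ε β lam Y u τ
    let r : Fin N → ℝ := fun i => Y i - f (S.input i)
    let ν := sampleTree S β r (u τ)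
    fun z => (1 - lam * ε / N) * f z + ε * ∑ ℓ ∈ ν.powerset, leafInd S ν ℓ z * leafMean S ν ℓ r

/-- Random numbers consumed by SamplePrior: the uniforms of SampleTree at iteration `τ`, and one
standard normal for each iteration and leaf. -/
inductive PriorSeed (d n : ℕ) : Type
  | unif (τ i : ℕ) (s : Split d n)
  | leaf (τ : ℕ) (ℓ : Finset (Split d n))

/-- Random numbers consumed by the second half of SamplePosterior: the label noise, and the
uniforms of SampleTree at iteration `τ` of TrainGBDT. -/
inductive TrainSeed (d n N : ℕ) : Type
  | label (i : Fin N)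
  | unif (τ i : ℕ) (s : Split d n)

/-- The law of each random number of SamplePrior. -/
def PriorSeed.law : PriorSeed d n → Measure ℝ
  | .unif _ _ _ => volume.restrict (Set.Icc 0 1)
  | .leaf _ _ => gaussianReal 0 1

/-- The law of each random number of the second half of SamplePosterior. -/
def TrainSeed.law (δ : ℝ) : TrainSeed d n N → Measure ℝ
  | .label _ => gaussianReal 0 (Real.toNNReal (δ ^ 2))
  | .unif _ _ _ => volume.restrict (Set.Icc 0 1)

/-- `SamplePrior(T, m, n)`: the sum over `T` random trees, scaled by `1/√T`, where the value in a
leaf is centered normal with variance `leafWeight`. -/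
def samplePrior (S : TreeSpec d n N) (T : ℕ) (a : PriorSeed d n → ℝ)
    (z : EuclideanSpace ℝ (Fin d)) : ℝ :=
  ∑ τ ∈ Finset.range T,
    let ν := sampleTree S 1 0 fun i s => a (.unif τ i s)
    1 / √(T : ℝ) * ∑ ℓ ∈ ν.powerset, leafInd S ν ℓ z * (√(leafWeight S ν ℓ) * a (.leaf τ ℓ))

/-- The model `f_{T₁}` of SamplePosterior: TrainGBDT with regularization `δ²/σ²`, run on the labels
`y_i - σ h(x_i)` plus label noise, where `h` is a given sample of the prior. -/
def residualFit (S : TreeSpec d n N) (y : Fin N → ℝ) (σ δ ε β : ℝ) (T₁ : ℕ)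
    (h : EuclideanSpace ℝ (Fin d) → ℝ) (b : TrainSeed d n N → ℝ) :
    EuclideanSpace ℝ (Fin d) → ℝ :=
  trainGBDT S ε β (δ ^ 2 / σ ^ 2) (fun i => y i - σ * h (S.input i) + b (.label i))
    (fun τ i s => b (.unif τ i s)) T₁

/-- `SamplePosterior` (KGB). -/
def samplePosterior (S : TreeSpec d n N) (y : Fin N → ℝ) (σ δ ε β : ℝ) (T₀ T₁ : ℕ)
    (a : PriorSeed d n → ℝ) (b : TrainSeed d n N → ℝ) (z : EuclideanSpace ℝ (Fin d)) : ℝ :=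
  σ * samplePrior S T₀ a z + residualFit S y σ δ ε β T₁ (samplePrior S T₀ a) b z

/-! ### The prior kernel and the posterior mean and covariance -/

/-- The weak learner's kernel `k_ν`. -/
def weakKernel (S : TreeSpec d n N) (ν : Finset (Split d n))
    (z z' : EuclideanSpace ℝ (Fin d)) : ℝ :=
  ∑ ℓ ∈ ν.powerset, leafWeight S ν ℓ * leafInd S ν ℓ z * leafInd S ν ℓ z'

/-- The stationary distribution `π` of trees: uniform on the sets of `min (m, n d)` splits. -/
def stationary (S : TreeSpec d n N) (ν : Finset (Split d n)) : ℝ :=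
  if ν.card = min S.depth (n * d) then 1 / ((n * d).choose (min S.depth (n * d)) : ℝ) else 0

/-- The stationary (prior) kernel `K`. -/
def kernel (S : TreeSpec d n N) (z z' : EuclideanSpace ℝ (Fin d)) : ℝ :=
  ∑ ν : Finset (Split d n), weakKernel S ν z z' * stationary S ν

/-- The matrix `K(x_N, x_N) + λ I_N`. -/
def regGram (S : TreeSpec d n N) (lam : ℝ) : Matrix (Fin N) (Fin N) ℝ :=
  Matrix.of (fun i j => kernel S (S.input i) (S.input j)) + lam • (1 : Matrix (Fin N) (Fin N) ℝ)

/-- `K(z, x_N) (K(x_N, x_N) + λ I_N)⁻¹ y_N`. -/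
def posteriorMean (S : TreeSpec d n N) (lam : ℝ) (y : Fin N → ℝ)
    (z : EuclideanSpace ℝ (Fin d)) : ℝ :=
  (fun i => kernel S z (S.input i)) ⬝ᵥ ((regGram S lam)⁻¹ *ᵥ y)

/-- `σ² (K(z, z') - K(z, x_N) (K(x_N, x_N) + λ I_N)⁻¹ K(x_N, z'))`. -/
def posteriorCov (S : TreeSpec d n N) (σ lam : ℝ) (z z' : EuclideanSpace ℝ (Fin d)) : ℝ :=
  σ ^ 2 * (kernel S z z' -
    (fun i => kernel S z (S.input i)) ⬝ᵥ ((regGram S lam)⁻¹ *ᵥ fun i => kernel S (S.input i) z'))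

/-! ### Gaussian processes and modes of convergence -/

/-- `Y` is a Gaussian process, indexed by points, with mean `μ` and covariance `C`. -/
def IsGP {Ω : Type*} [MeasurableSpace Ω] (P : Measure Ω) {T : Type*} (Y : T → Ω → ℝ)
    (μ : T → ℝ) (C : T → T → ℝ) : Prop :=
  IsGaussianProcess Y P ∧ (∀ z, ∫ ω, Y z ω ∂P = μ z) ∧ ∀ z z', covariance (Y z) (Y z') P = C z z'

/-- `F` is `GP(μ, C + s² Id)` in the weak sense: the random variables `F g`, for `g ∈ L²(ρ)`
(where `F g` stands for the pairing with `g`), are jointly normal with mean `∫ μ g dρ` and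
covariance `∫∫ g(z) C(z,z') g'(z') ρ(dz) ρ(dz') + s² ⟪g, g'⟫`. -/
def IsWeakGP {E : Type*} [MeasurableSpace E] (ρ : Measure E) {Ω : Type*} [MeasurableSpace Ω]
    (P : Measure Ω) (F : Lp ℝ 2 ρ → Ω → ℝ) (μ : E → ℝ) (C : E → E → ℝ) (s : ℝ) : Prop :=
  MemLp μ 2 ρ ∧
  (∀ g g' : Lp ℝ 2 ρ, Integrable (fun p : E × E => g p.1 * C p.1 p.2 * g' p.2) (ρ.prod ρ)) ∧
  IsGP P F (fun g => ∫ z, μ z * g z ∂ρ)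
    (fun g g' => ∫ p, g p.1 * C p.1 p.2 * g' p.2 ∂(ρ.prod ρ) + s ^ 2 * inner ℝ g g')

/-- Convergence of a sequence of processes to a limit process as stochastic processes: all
finite-dimensional distributions converge weakly. -/
def TendstoFDD {Ω Ω' E : Type*} [MeasurableSpace Ω] [MeasurableSpace Ω'] (P : Measure Ω)
    [IsProbabilityMeasure P] (P' : Measure Ω') [IsProbabilityMeasure P']
    (Y : ℕ → E → Ω → ℝ) (Y' : E → Ω' → ℝ) : Prop :=
  ∀ J : Finset E, TendstoInDistribution (fun k ω (z : J) => Y k z ω) atTop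
    (fun ω (z : J) => Y' z ω) (fun _ => P) P'

/-- Convergence of random functions in mean square with respect to the norm of `L²(ρ)`. -/
def TendstoL2 {E : Type*} [MeasurableSpace E] (ρ : Measure E) {Ω : Type*} [MeasurableSpace Ω]
    (P : Measure Ω) (Y : ℕ → E → Ω → ℝ) (Y' : E → Ω → ℝ) : Prop :=
  Tendsto (fun k => ∫⁻ ω, ∫⁻ z, ‖Y k z ω - Y' z ω‖ₑ ^ 2 ∂ρ ∂P) atTop (𝓝 0)

/-- Convergence in mean square at the point `z`. -/
def TendstoL2At {E : Type*} {Ω : Type*} [MeasurableSpace Ω] (P : Measure Ω)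
    (Y : ℕ → E → Ω → ℝ) (Y' : E → Ω → ℝ) (z : E) : Prop :=
  Tendsto (fun k => ∫⁻ ω, ‖Y k z ω - Y' z ω‖ₑ ^ 2 ∂P) atTop (𝓝 0)

/-- The limit in which boosting is run to convergence: learning rate `ε → 0`, random strength
`β → ∞`, and number of iterations `T₁ → ∞` with `ε T₁ → ∞`. -/
structure BoostingLimit (ε β : ℕ → ℝ) (T₁ : ℕ → ℕ) : Prop where
  rate : Tendsto ε atTop (𝓝[>] 0)
  strength : Tendsto β atTop atTop
  iterations : Tendsto T₁ atTop atTop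
  time : Tendsto (fun k => ε k * (T₁ k : ℝ)) atTop atTop

end

end KGB

open KGB

/-!
Kernel gradient boosting samples from the posterior because each half of the algorithm has a limit
that can be identified: gradient boosting is a stochastic approximation of kernel ridge regression,
a sum of random trees is approximately Gaussian, and correcting a Gaussian prior sample by
regression on its noisy residual labels produces a sample of the posterior.

*Trees.* SampleTree maximizes a score plus `β` times Gumbel noise. Unless two of the noises differ
by less than `score / β`, the score is irrelevant (`growTree_eq_of_gap`); the probability of the
exceptional event tends to `0` as `β → ∞` because the noise has no atoms (`tendsto_gapBound`).
Without the score all splits are exchangeable, so the tree is exactly uniform on the sets of its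
deterministic size (`measureReal_sampleTree_zero`), which gives `tendsto_measureReal_sampleTree`.

*Boosting.* Let `f_∞` be the kernel regression function of the labels. Averaged over the stationary
law of trees, one iteration leaves `f_∞` fixed (`sum_stationary_mul_perturbation`), and
`eq_posteriorMean_of_stationary` says that this determines it. For every single tree, an iteration
acts on the error `f_T - f_∞` as a linear map that contracts a suitable Euclidean norm of its values
at the training points and at one further point (`norm_driftOp_sq_le`), plus `ε` times a
perturbation that is centered under the stationary law. Hence the error stays bounded whatever the
trees are, and, the tree of each round being nearly independent of the past, its mean square is at
most a constant times `(1 - λ ε / N) ^ T + q + ε`, where `q` is the probability that the score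
matters (`integral_norm_sq_le_of_stochastic_approximation`, `integral_boostErr_sq_le`). The constant
depends on a bound for the labels; square integrable labels are truncated
(`eventually_lintegral_boostErr_le`). For fixed `ε` and `β` no rate is available, but every tree of
full size recurs with a probability bounded below, so a limit in mean square must be unchanged by
fitting any of these trees (`ae_predict_eq_of_tendsto`) and is again `f_∞`.

*Prior.* By the Cramér–Wold theorem, the convergence of finite-dimensional distributions of the
prior samples reduces to the central limit theorem for independent, identically distributed
combinations of tree values (`treeCombination_moments`, `tendstoFDD_samplePrior`). The limit is
`priorLimit`, a finite sum of features with independent normal coefficients.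

*Joint limit.* The bound on the error of boosting is uniform over the joint law of bounded labels
and noise. As the labels converge in distribution, they are tight, so `f_{T₁}` may be replaced by
the regression function of the labels up to an error tending to `0` in measure
(`tendstoInMeasure_boostErr`). The output then is a continuous function of finitely many values of
the prior sample and of the label noise (`tendstoFDD_samplePosterior`).

*Posterior.* Everything is constant on the finitely many leaves of the tree that uses all splits.
The limit is therefore an affine function of a finite Gaussian vector, consisting of the values of
the prior sample on these leaves and of the label noise. Its covariance follows from the normal
equations of the regression weights and `δ² = σ² λ` (`sum_posteriorCoef_mul_dataCov`), and adding
independent Gaussian noise preserves normality (`isGP_const_add_sum_add`). The statements for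
noise indexed by points and by `L²(ρ)` differ only in whether the coefficients of the affine
function are evaluated at points or integrated (`isGP_posterior`, `isWeakGP_posterior`).
-/

namespace KGB

/-! ### Greedy growth of a tree -/

section Tree

variable {d n N : ℕ}

/-- The Gumbel noise `-log (-log u)` attached to a uniform variable. -/
noncomputable def gumbel (u : ℝ) : ℝ := -Real.log (-Real.log u)

/-- The objective maximized by SampleTree at a node `ν`. -/
noncomputable def objective (S : TreeSpec d n N) (β : ℝ) (r : Fin N → ℝ) (ν : Finset (Split d n))
    (v : Split d n → ℝ) (s : Split d n) : ℝ :=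
  score S (insert s ν) r - β * Real.log (-Real.log (v s))

open Classical in
/-- One greedy step of SampleTree from the node `ν`, with uniform variables `v`. -/
noncomputable def growStep (S : TreeSpec d n N) (β : ℝ) (r : Fin N → ℝ) (ν : Finset (Split d n))
    (v : Split d n → ℝ) : Finset (Split d n) :=
  let M := maximizers (Finset.univ \ ν) (objective S β r ν v)
  if h : M.Nonempty then insert (M.min' h) ν else ν

lemma growTree_zero (S : TreeSpec d n N) (β : ℝ) (r : Fin N → ℝ) (u : ℕ → Split d n → ℝ) :
    growTree S β r u 0 = ∅ := rfl

open Classical in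
lemma growTree_succ (S : TreeSpec d n N) (β : ℝ) (r : Fin N → ℝ) (u : ℕ → Split d n → ℝ) (i : ℕ) :
    growTree S β r u (i + 1) = growStep S β r (growTree S β r u i) (u i) := by
  rw [growTree, growStep]
  rfl

lemma objective_eq (S : TreeSpec d n N) (β : ℝ) (r : Fin N → ℝ) (ν : Finset (Split d n))
    (v : Split d n → ℝ) (s : Split d n) :
    objective S β r ν v s = score S (insert s ν) r + β * gumbel (v s) := by
  simp [objective, gumbel, sub_eq_add_neg]

lemma score_zero (S : TreeSpec d n N) (ν : Finset (Split d n)) : score S ν 0 = 0 := by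
  simp [score]

lemma objective_one_zero (S : TreeSpec d n N) (ν : Finset (Split d n))
    (v : Split d n → ℝ) (s : Split d n) : objective S 1 0 ν v s = gumbel (v s) := by
  simp [objective_eq, score_zero]

lemma mem_maximizers {A : Finset (Split d n)} {g : Split d n → ℝ} {s : Split d n} :
    s ∈ maximizers A g ↔ s ∈ A ∧ ∀ s' ∈ A, g s' ≤ g s := by
  simp [maximizers]

lemma maximizers_nonempty {A : Finset (Split d n)} (hA : A.Nonempty) (g : Split d n → ℝ) :
    (maximizers A g).Nonempty := by
  obtain ⟨s, hs, h⟩ := A.exists_max_image g hA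
  exact ⟨s, mem_maximizers.2 ⟨hs, h⟩⟩

lemma growStep_univ (S : TreeSpec d n N) (β : ℝ) (r : Fin N → ℝ) (v : Split d n → ℝ) :
    growStep S β r Finset.univ v = Finset.univ := by
  classical
  rw [growStep]
  split_ifs with h
  · exact Finset.insert_eq_self.2 (Finset.mem_univ _)
  · rfl

open Classical in
/-- As long as a split is left, a step adds an unused split that maximizes the objective. -/
lemma growStep_eq_insert (S : TreeSpec d n N) (β : ℝ) (r : Fin N → ℝ) {ν : Finset (Split d n)}
    (v : Split d n → ℝ) (hν : ν ≠ Finset.univ) :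
    ∃ s ∉ ν, (∀ s' ∉ ν, objective S β r ν v s' ≤ objective S β r ν v s) ∧
      growStep S β r ν v = insert s ν := by
  have hne : (Finset.univ \ ν).Nonempty := by
    rw [Finset.sdiff_nonempty]
    intro h
    exact hν (Finset.univ_subset_iff.1 h)
  have hM := maximizers_nonempty hne (objective S β r ν v)
  have hmem := Finset.min'_mem _ hM
  obtain ⟨h1, h2⟩ := mem_maximizers.1 hmem
  refine ⟨_, (Finset.mem_sdiff.1 h1).2, fun s' hs' => h2 s' (by simpa using hs'), ?_⟩
  rw [growStep]
  simp only [hM, dite_true]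

open Classical in
/-- If the objective has a unique maximizer over the unused splits, a step adds it. -/
lemma growStep_eq_of_lt (S : TreeSpec d n N) (β : ℝ) (r : Fin N → ℝ) {ν : Finset (Split d n)}
    (v : Split d n → ℝ) {s : Split d n} (hs : s ∉ ν)
    (h : ∀ s' ∉ ν, s' ≠ s → objective S β r ν v s' < objective S β r ν v s) :
    growStep S β r ν v = insert s ν := by
  obtain ⟨s₀, hs₀, hmax, heq⟩ := growStep_eq_insert S β r (ν := ν) v
    (by rintro rfl; exact hs (Finset.mem_univ s))
  rw [heq]
  by_cases hss : s₀ = s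
  · rw [hss]
  · exact absurd (hmax s hs) (not_le.2 (h s₀ hs₀ hss))

lemma card_split : Fintype.card (Split d n) = n * d := by
  rw [Fintype.card_congr (toLex (α := Fin d × Fin n)).symm]
  simp [mul_comm]

/-- The size of a tree is deterministic. -/
lemma card_growTree (S : TreeSpec d n N) (β : ℝ) (r : Fin N → ℝ) (u : ℕ → Split d n → ℝ) (k : ℕ) :
    (growTree S β r u k).card = min k (n * d) := by
  classical
  induction k with
  | zero => simp [growTree_zero]
  | succ k ih =>
    rw [growTree_succ]
    by_cases hν : growTree S β r u k = Finset.univ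
    · rw [hν, growStep_univ]
      rw [hν] at ih
      rw [Finset.card_univ, card_split] at ih ⊢
      omega
    · obtain ⟨s, hs, -, heq⟩ := growStep_eq_insert S β r (u k) hν
      rw [heq, Finset.card_insert_of_notMem hs, ih]
      have : (growTree S β r u k).card < Fintype.card (Split d n) :=
        Finset.card_lt_univ_of_notMem hs
      rw [ih, card_split] at this
      omega

lemma card_sampleTree (S : TreeSpec d n N) (β : ℝ) (r : Fin N → ℝ) (u : ℕ → Split d n → ℝ) :
    (sampleTree S β r u).card = min S.depth (n * d) := card_growTree S β r u S.depth

/-- When the noise of any two splits differs by more than `B / β`, a score with values in `[0, B]`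
does not influence the tree. -/
lemma growTree_eq_of_gap (S : TreeSpec d n N) {β B : ℝ} (hβ : 0 < β) {r : Fin N → ℝ}
    (hB : ∀ ν, score S ν r ∈ Set.Icc 0 B) {u : ℕ → Split d n → ℝ} {k : ℕ}
    (hgap : ∀ i < k, ∀ s s', s ≠ s' → B / β < |gumbel (u i s) - gumbel (u i s')|) :
    growTree S β r u k = growTree S 1 0 u k := by
  classical
  induction k with
  | zero => rfl
  | succ k ih =>
    rw [growTree_succ, growTree_succ, ih fun i hi => hgap i (by omega)]
    set ν := growTree S 1 0 u k
    by_cases hν : ν = Finset.univ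
    · rw [hν, growStep_univ, growStep_univ]
    · obtain ⟨s, hs, hmax, heq⟩ := growStep_eq_insert S 1 0 (u k) hν
      rw [heq]
      refine growStep_eq_of_lt S β r (u k) hs fun s' hs' hne => ?_
      have h1 := hmax s' hs'
      rw [objective_one_zero, objective_one_zero] at h1
      have h2 := hgap k (by omega) s s' hne.symm
      rw [abs_of_nonneg (by linarith), div_lt_iff₀ hβ] at h2
      rw [objective_eq, objective_eq]
      have h3 := (hB (insert s ν)).1
      have h4 := (hB (insert s' ν)).2
      linarith

/-- If in every round the noise favours the splits of `ν` over all others, strongly enough to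
outweigh the score, and `ν` has the right size, then the tree is `ν`. -/
lemma growTree_eq_of_dominant (S : TreeSpec d n N) {β B : ℝ} {r : Fin N → ℝ}
    (hB : ∀ ν, score S ν r ∈ Set.Icc 0 B) {u : ℕ → Split d n → ℝ} {k : ℕ} {ν : Finset (Split d n)}
    (hν : ν.card = min k (n * d))
    (hdom : ∀ i < k, ∀ s ∈ ν, ∀ s' ∉ ν, B + β * gumbel (u i s') < β * gumbel (u i s)) :
    growTree S β r u k = ν := by
  classical
  -- splits outside of `ν` are added only once `ν` is exhausted
  have key : ∀ i ≤ k, growTree S β r u i ⊆ ν ∨ ν ⊆ growTree S β r u i := by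
    intro i
    induction i with
    | zero => intro _; left; simp [growTree_zero]
    | succ i ih =>
      intro hi
      rw [growTree_succ]
      set ν' := growTree S β r u i
      by_cases hν' : ν' = Finset.univ
      · right; rw [hν', growStep_univ]; exact Finset.subset_univ _
      · obtain ⟨s, hs, hmax, heq⟩ := growStep_eq_insert S β r (u i) hν'
        rw [heq]
        by_cases hsub : ν ⊆ ν'
        · exact Or.inr (hsub.trans (Finset.subset_insert _ _))
        · left
          have h1 := (ih (by omega)).resolve_right hsub
          refine Finset.insert_subset ?_ h1
          by_contra hsν
          obtain ⟨t, ht, ht'⟩ := Finset.not_subset.1 hsub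
          have h2 := hmax t ht'
          have h3 := hdom i (by omega) t ht s hsν
          rw [objective_eq, objective_eq] at h2
          have h4 := (hB (insert t ν')).1
          have h5 := (hB (insert s ν')).2
          linarith
  have hc := card_growTree S β r u k
  rcases key k le_rfl with h | h
  · exact Finset.eq_of_subset_of_card_le h (by omega)
  · exact (Finset.eq_of_subset_of_card_le h (by omega)).symm

/-- Without ties, relabelling the splits relabels the tree grown by pure noise. -/
lemma growTree_comp_perm (S : TreeSpec d n N) (κ : Equiv.Perm (Split d n))
    {u : ℕ → Split d n → ℝ} {k : ℕ}
    (hgap : ∀ i < k, ∀ s s', s ≠ s' → gumbel (u i s) ≠ gumbel (u i s')) :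
    growTree S 1 0 u k = (growTree S 1 0 (fun i s => u i (κ s)) k).map κ.toEmbedding := by
  classical
  induction k with
  | zero => rfl
  | succ k ih =>
    rw [growTree_succ, growTree_succ, ih fun i hi => hgap i (by omega)]
    set ν := growTree S 1 0 (fun i s => u i (κ s)) k
    by_cases hν : ν = Finset.univ
    · rw [hν, growStep_univ, Finset.map_univ_equiv, growStep_univ]
    · obtain ⟨s, hs, hmax, heq⟩ := growStep_eq_insert S 1 0 (fun s => u k (κ s)) hν
      rw [heq, Finset.map_insert]
      refine growStep_eq_of_lt S 1 0 (u k) (by simpa using hs) fun s' hs' hne => ?_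
      have h1 := hmax (κ.symm s') (by
        intro h; exact hs' (Finset.mem_map.2 ⟨_, h, by simp⟩))
      rw [objective_one_zero, objective_one_zero] at h1 ⊢
      rw [Equiv.apply_symm_apply] at h1
      exact lt_of_le_of_ne h1 (hgap k (by omega) _ _ hne)

end Tree

/-! ### Leaf averages and kernels -/

section Predict

variable {d n N : ℕ}

local notation "𝔼" d => EuclideanSpace ℝ (Fin d)

/-- The prediction at `z` of the tree `ν` fitted to the values `v`: the average of `v` over the
training points in the leaf of `z`. -/
noncomputable def predict (S : TreeSpec d n N) (ν : Finset (Split d n)) (v : Fin N → ℝ)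
    (z : EuclideanSpace ℝ (Fin d)) : ℝ :=
  ∑ ℓ ∈ ν.powerset, leafInd S ν ℓ z * leafMean S ν ℓ v

lemma leafOf_mem_powerset (S : TreeSpec d n N) (ν : Finset (Split d n)) (z : 𝔼 d) :
    leafOf S ν z ∈ ν.powerset := by
  classical
  exact Finset.mem_powerset.2 (Finset.filter_subset _ _)

lemma leafInd_self (S : TreeSpec d n N) (ν : Finset (Split d n)) (z : 𝔼 d) :
    leafInd S ν (leafOf S ν z) z = 1 := by
  simp [leafInd]

lemma leafInd_nonneg (S : TreeSpec d n N) (ν ℓ : Finset (Split d n)) (z : 𝔼 d) :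
    0 ≤ leafInd S ν ℓ z := by
  unfold leafInd; split_ifs <;> simp

lemma leafInd_of_notMem (S : TreeSpec d n N) {ν ℓ : Finset (Split d n)} (h : ℓ ∉ ν.powerset)
    (z : 𝔼 d) : leafInd S ν ℓ z = 0 :=
  if_neg <| by rintro rfl; exact h (leafOf_mem_powerset S ν z)

/-- A sum over leaves weighted by the leaf indicators of `z` picks out the leaf of `z`. -/
lemma sum_leafInd_mul (S : TreeSpec d n N) (ν : Finset (Split d n)) (z : 𝔼 d)
    (F : Finset (Split d n) → ℝ) :
    ∑ ℓ ∈ ν.powerset, leafInd S ν ℓ z * F ℓ = F (leafOf S ν z) := by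
  rw [Finset.sum_eq_single_of_mem _ (leafOf_mem_powerset S ν z)]
  · rw [leafInd_self, one_mul]
  · intro ℓ _ h
    rw [leafInd, if_neg h.symm, zero_mul]

lemma predict_eq_leafMean (S : TreeSpec d n N) (ν : Finset (Split d n)) (v : Fin N → ℝ) (z : 𝔼 d) :
    predict S ν v z = leafMean S ν (leafOf S ν z) v :=
  sum_leafInd_mul S ν z fun ℓ => leafMean S ν ℓ v

lemma leafInd_eq_zero_of_leafCount (S : TreeSpec d n N) {ν ℓ : Finset (Split d n)}
    (h : leafCount S ν ℓ = 0) (i : Fin N) : leafInd S ν ℓ (S.input i) = 0 :=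
  (Finset.sum_eq_zero_iff_of_nonneg fun _ _ => leafInd_nonneg _ _ _ _).1 h i (Finset.mem_univ i)

/-- A leaf that contains a training point contains at least one. -/
lemma leafCount_eq_zero_or_one_le (S : TreeSpec d n N) (ν ℓ : Finset (Split d n)) :
    leafCount S ν ℓ = 0 ∨ 1 ≤ leafCount S ν ℓ := by
  by_cases h : ∃ i, leafOf S ν (S.input i) = ℓ
  · right
    obtain ⟨i, hi⟩ := h
    have : leafInd S ν ℓ (S.input i) = 1 := if_pos hi
    rw [← this]
    exact Finset.single_le_sum (f := fun i => leafInd S ν ℓ (S.input i))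
      (fun _ _ => leafInd_nonneg _ _ _ _) (Finset.mem_univ i)
  · left
    push Not at h
    exact Finset.sum_eq_zero fun i _ => if_neg (h i)

lemma leafMean_mul_leafCount (S : TreeSpec d n N) (ν ℓ : Finset (Split d n)) (v : Fin N → ℝ) :
    leafMean S ν ℓ v * leafCount S ν ℓ = ∑ i, leafInd S ν ℓ (S.input i) * v i := by
  by_cases h : leafCount S ν ℓ = 0
  · rw [h, mul_zero]
    simp [leafInd_eq_zero_of_leafCount S h]
  · rw [leafMean, div_mul_cancel₀ _ h]

lemma leafWeight_nonneg (S : TreeSpec d n N) (ν ℓ : Finset (Split d n)) : 0 ≤ leafWeight S ν ℓ :=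
  div_nonneg (Nat.cast_nonneg _) (le_max_of_le_right zero_le_one)

/-- The prediction is linear in the fitted values, with the weak kernel as coefficients. -/
lemma predict_eq_sum_weakKernel (hN : 1 ≤ N) (S : TreeSpec d n N) (ν : Finset (Split d n))
    (v : Fin N → ℝ) (z : 𝔼 d) :
    predict S ν v z = ∑ i, weakKernel S ν z (S.input i) / N * v i := by
  have hN0 : (N : ℝ) ≠ 0 := by positivity
  have hterm : ∀ ℓ, leafMean S ν ℓ v =
      ∑ i, leafWeight S ν ℓ / N * leafInd S ν ℓ (S.input i) * v i := by
    intro ℓ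
    rcases leafCount_eq_zero_or_one_le S ν ℓ with h | h
    · simp [leafMean, h, leafInd_eq_zero_of_leafCount S h]
    · rw [leafMean, leafWeight, max_eq_left h, Finset.sum_div]
      refine Finset.sum_congr rfl fun i _ => ?_
      have : leafCount S ν ℓ ≠ 0 := by positivity
      field_simp
  simp only [predict, hterm, weakKernel, Finset.mul_sum, Finset.sum_div, Finset.sum_mul]
  rw [Finset.sum_comm]
  refine Finset.sum_congr rfl fun i _ => Finset.sum_congr rfl fun ℓ _ => ?_
  ring

lemma predict_sub (hN : 1 ≤ N) (S : TreeSpec d n N) (ν : Finset (Split d n))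
    (v w : Fin N → ℝ) (z : 𝔼 d) :
    predict S ν (v - w) z = predict S ν v z - predict S ν w z := by
  simp only [predict_eq_sum_weakKernel hN, Pi.sub_apply, mul_sub, Finset.sum_sub_distrib]

lemma sum_mul_predict (S : TreeSpec d n N) (ν : Finset (Split d n)) (v : Fin N → ℝ) :
    ∑ i, v i * predict S ν v (S.input i) = ∑ ℓ ∈ ν.powerset, leafMean S ν ℓ v ^ 2 *
      leafCount S ν ℓ := by
  simp only [predict, Finset.mul_sum]
  rw [Finset.sum_comm]
  refine Finset.sum_congr rfl fun ℓ _ => ?_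
  rw [pow_two, mul_assoc, leafMean_mul_leafCount, Finset.mul_sum]
  refine Finset.sum_congr rfl fun i _ => by ring

lemma sum_predict_sq_eq_sum_leaf (S : TreeSpec d n N) (ν : Finset (Split d n)) (v : Fin N → ℝ) :
    ∑ i, predict S ν v (S.input i) ^ 2 = ∑ ℓ ∈ ν.powerset, leafMean S ν ℓ v ^ 2 *
      leafCount S ν ℓ := by
  simp only [leafCount, Finset.mul_sum]
  rw [Finset.sum_comm]
  refine Finset.sum_congr rfl fun i _ => ?_
  rw [predict_eq_leafMean, ← sum_leafInd_mul S ν (S.input i) fun ℓ => leafMean S ν ℓ v ^ 2]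
  refine Finset.sum_congr rfl fun ℓ _ => by ring

/-- Leaf averaging is an orthogonal projection of the values at the training points. -/
lemma sum_mul_predict_eq_sum_sq (S : TreeSpec d n N) (ν : Finset (Split d n)) (v : Fin N → ℝ) :
    ∑ i, v i * predict S ν v (S.input i) = ∑ i, predict S ν v (S.input i) ^ 2 := by
  rw [sum_mul_predict, sum_predict_sq_eq_sum_leaf]

lemma sum_predict_sq_le (S : TreeSpec d n N) (ν : Finset (Split d n)) (v : Fin N → ℝ) :
    ∑ i, predict S ν v (S.input i) ^ 2 ≤ ∑ i, v i ^ 2 := by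
  have h : 0 ≤ ∑ i, (v i - predict S ν v (S.input i)) ^ 2 :=
    Finset.sum_nonneg fun _ _ => sq_nonneg _
  have h2 : ∑ i, (v i - predict S ν v (S.input i)) ^ 2 = ∑ i, v i ^ 2
      - 2 * ∑ i, v i * predict S ν v (S.input i) + ∑ i, predict S ν v (S.input i) ^ 2 := by
    rw [Finset.mul_sum, ← Finset.sum_sub_distrib, ← Finset.sum_add_distrib]
    refine Finset.sum_congr rfl fun i _ => by ring
  rw [h2, sum_mul_predict_eq_sum_sq] at h
  linarith

/-- Away from the training points, a prediction is `0` or agrees with one at a training point. -/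
lemma predict_sq_le (S : TreeSpec d n N) (ν : Finset (Split d n)) (v : Fin N → ℝ) (z : 𝔼 d) :
    predict S ν v z ^ 2 ≤ ∑ i, predict S ν v (S.input i) ^ 2 := by
  by_cases h : ∃ i, leafOf S ν (S.input i) = leafOf S ν z
  · obtain ⟨i, hi⟩ := h
    rw [predict_eq_leafMean S ν v z, ← hi, ← predict_eq_leafMean]
    exact Finset.single_le_sum (f := fun i => predict S ν v (S.input i) ^ 2)
      (fun _ _ => sq_nonneg _) (Finset.mem_univ i)
  · push Not at h
    have h0 : leafCount S ν (leafOf S ν z) = 0 := Finset.sum_eq_zero fun i _ => if_neg (h i)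
    rw [predict_eq_leafMean, leafMean, h0, div_zero]
    simpa using Finset.sum_nonneg fun i _ => sq_nonneg (predict S ν v (S.input i))

lemma score_mem_Icc (S : TreeSpec d n N) (ν : Finset (Split d n)) (r : Fin N → ℝ) :
    score S ν r ∈ Set.Icc 0 (∑ i, r i ^ 2) := by
  have h : score S ν r = 1 / N * ∑ i, predict S ν r (S.input i) ^ 2 := by
    rw [sum_predict_sq_eq_sum_leaf, score]
    congr 1
    refine Finset.sum_congr rfl fun ℓ _ => ?_
    by_cases h : leafCount S ν ℓ = 0
    · simp [h]
    · rw [leafMean]; field_simp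
  have h0 : 0 ≤ ∑ i, predict S ν r (S.input i) ^ 2 := Finset.sum_nonneg fun _ _ => sq_nonneg _
  rw [h]
  refine ⟨by positivity, le_trans ?_ (sum_predict_sq_le S ν r)⟩
  rcases Nat.eq_zero_or_pos N with hN | hN
  · subst hN; simp
  · have : (1 : ℝ) / N ≤ 1 := by
      rw [div_le_one (by positivity)]; exact_mod_cast hN
    exact mul_le_of_le_one_left h0 this

lemma trainGBDT_succ (S : TreeSpec d n N) (ε β lam : ℝ) (Y : Fin N → ℝ)
    (u : ℕ → ℕ → Split d n → ℝ) (τ : ℕ) (z : 𝔼 d) :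
    trainGBDT S ε β lam Y u (τ + 1) z = (1 - lam * ε / N) * trainGBDT S ε β lam Y u τ z +
      ε * predict S (sampleTree S β (fun i => Y i - trainGBDT S ε β lam Y u τ (S.input i)) (u τ))
        (fun i => Y i - trainGBDT S ε β lam Y u τ (S.input i)) z := rfl

/-! ### The stationary kernel and its regression function -/

lemma stationary_nonneg (S : TreeSpec d n N) (ν : Finset (Split d n)) : 0 ≤ stationary S ν := by
  unfold stationary; split_ifs <;> positivity

lemma sum_stationary (S : TreeSpec d n N) : ∑ ν : Finset (Split d n), stationary S ν = 1 := by
  classical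
  simp only [stationary]
  rw [← Finset.sum_filter, Finset.sum_const, nsmul_eq_mul]
  have h : (Finset.univ.filter fun ν : Finset (Split d n) => ν.card = min S.depth (n * d)) =
      Finset.powersetCard (min S.depth (n * d)) Finset.univ := by
    ext ν; simp [Finset.mem_powersetCard]
  rw [h, Finset.card_powersetCard, Finset.card_univ, card_split]
  have : ((n * d).choose (min S.depth (n * d)) : ℝ) ≠ 0 := by
    exact_mod_cast (Nat.choose_pos (min_le_right _ _)).ne'
  field_simp

/-- The features of the stationary kernel: scaled leaf indicators of all trees. -/
noncomputable def feature (S : TreeSpec d n N) (p : Finset (Split d n) × Finset (Split d n))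
    (z : EuclideanSpace ℝ (Fin d)) : ℝ :=
  √(stationary S p.1 * leafWeight S p.1 p.2) * leafInd S p.1 p.2 z

lemma weakKernel_eq_sum_univ (S : TreeSpec d n N) (ν : Finset (Split d n)) (z z' : 𝔼 d) :
    weakKernel S ν z z' = ∑ ℓ, leafWeight S ν ℓ * leafInd S ν ℓ z * leafInd S ν ℓ z' :=
  Finset.sum_subset (Finset.subset_univ _) fun ℓ _ h => by rw [leafInd_of_notMem S h]; simp

lemma weakKernel_comm (S : TreeSpec d n N) (ν : Finset (Split d n)) (z z' : 𝔼 d) :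
    weakKernel S ν z z' = weakKernel S ν z' z :=
  Finset.sum_congr rfl fun ℓ _ => by ring

lemma kernel_comm (S : TreeSpec d n N) (z z' : 𝔼 d) : kernel S z z' = kernel S z' z :=
  Finset.sum_congr rfl fun ν _ => by rw [weakKernel_comm]

lemma kernel_eq_sum_feature (S : TreeSpec d n N) (z z' : 𝔼 d) :
    kernel S z z' = ∑ p, feature S p z * feature S p z' := by
  rw [Fintype.sum_prod_type]
  simp only [kernel, weakKernel_eq_sum_univ, Finset.sum_mul]
  refine Finset.sum_congr rfl fun ν _ => Finset.sum_congr rfl fun ℓ _ => ?_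
  have h := Real.mul_self_sqrt (mul_nonneg (stationary_nonneg S ν) (leafWeight_nonneg S ν ℓ))
  simp only [feature]
  linear_combination (- leafInd S ν ℓ z * leafInd S ν ℓ z') * h

/-- The average prediction of a stationary tree is given by the stationary kernel. -/
lemma sum_stationary_mul_predict (hN : 1 ≤ N) (S : TreeSpec d n N) (v : Fin N → ℝ) (z : 𝔼 d) :
    ∑ ν, stationary S ν * predict S ν v z = (∑ i, kernel S z (S.input i) * v i) / N := by
  simp only [predict_eq_sum_weakKernel hN, kernel, Finset.sum_mul, Finset.mul_sum, Finset.sum_div]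
  rw [Finset.sum_comm]
  refine Finset.sum_congr rfl fun i _ => Finset.sum_congr rfl fun ν _ => by ring

lemma regGram_apply (S : TreeSpec d n N) (lam : ℝ) (i j : Fin N) :
    regGram S lam i j = kernel S (S.input i) (S.input j) + if i = j then lam else 0 := by
  simp [regGram, Matrix.one_apply]

lemma regGram_mulVec (S : TreeSpec d n N) (lam : ℝ) (v : Fin N → ℝ) (i : Fin N) :
    (regGram S lam *ᵥ v) i = ∑ j, kernel S (S.input i) (S.input j) * v j + lam * v i := by
  simp [Matrix.mulVec, dotProduct, regGram_apply, add_mul, Finset.sum_add_distrib]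

lemma sum_mul_kernel_mul_nonneg (S : TreeSpec d n N) (v : Fin N → ℝ) :
    0 ≤ ∑ i, v i * ∑ j, kernel S (S.input i) (S.input j) * v j := by
  have h : ∑ i, v i * ∑ j, kernel S (S.input i) (S.input j) * v j =
      ∑ p, (∑ i, feature S p (S.input i) * v i) ^ 2 := by
    simp only [kernel_eq_sum_feature, pow_two, Finset.sum_mul, Finset.mul_sum]
    symm
    rw [Finset.sum_comm]
    refine Finset.sum_congr rfl fun i _ => ?_
    rw [Finset.sum_comm]
    refine Finset.sum_congr rfl fun j _ => Finset.sum_congr rfl fun p _ => by ring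
  rw [h]
  exact Finset.sum_nonneg fun _ _ => sq_nonneg _

lemma isUnit_regGram (S : TreeSpec d n N) {lam : ℝ} (hlam : 0 < lam) :
    IsUnit (regGram S lam) := by
  rw [← Matrix.mulVec_injective_iff_isUnit]
  refine (injective_iff_map_eq_zero (Matrix.mulVecLin (regGram S lam))).2 fun v hv => ?_
  have h0 : ∑ i, v i * (regGram S lam *ᵥ v) i = 0 := by
    rw [show regGram S lam *ᵥ v = 0 from hv]; simp
  have h1 : ∑ i, v i * (regGram S lam *ᵥ v) i =
      ∑ i, v i * ∑ j, kernel S (S.input i) (S.input j) * v j + lam * ∑ i, v i ^ 2 := by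
    simp only [regGram_mulVec, mul_add, Finset.sum_add_distrib]
    rw [Finset.mul_sum]
    congr 1
    refine Finset.sum_congr rfl fun i _ => by ring
  have h2 := sum_mul_kernel_mul_nonneg S v
  have h3 : 0 ≤ ∑ i, v i ^ 2 := Finset.sum_nonneg fun _ _ => sq_nonneg _
  have h4 : ∑ i, v i ^ 2 = 0 := by nlinarith
  funext i
  have := (Finset.sum_eq_zero_iff_of_nonneg fun _ _ => sq_nonneg _).1 h4 i (Finset.mem_univ i)
  simpa using this

/-- The dual coefficients `(K + λ)⁻¹ v` of the regression function of `v`. -/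
noncomputable def dualCoef (S : TreeSpec d n N) (lam : ℝ) (v : Fin N → ℝ) : Fin N → ℝ :=
  (regGram S lam)⁻¹ *ᵥ v

lemma posteriorMean_eq_sum (S : TreeSpec d n N) (lam : ℝ) (v : Fin N → ℝ) (z : 𝔼 d) :
    posteriorMean S lam v z = ∑ i, kernel S z (S.input i) * dualCoef S lam v i := rfl

lemma regGram_mulVec_dualCoef (S : TreeSpec d n N) {lam : ℝ} (hlam : 0 < lam) (v : Fin N → ℝ) :
    regGram S lam *ᵥ dualCoef S lam v = v := by
  rw [dualCoef, Matrix.mulVec_mulVec, Matrix.mul_nonsing_inv _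
    ((Matrix.isUnit_iff_isUnit_det _).1 (isUnit_regGram S hlam)), Matrix.one_mulVec]

lemma dualCoef_regGram_mulVec (S : TreeSpec d n N) {lam : ℝ} (hlam : 0 < lam) (v : Fin N → ℝ) :
    dualCoef S lam (regGram S lam *ᵥ v) = v := by
  rw [dualCoef, Matrix.mulVec_mulVec, Matrix.nonsing_inv_mul _
    ((Matrix.isUnit_iff_isUnit_det _).1 (isUnit_regGram S hlam)), Matrix.one_mulVec]

/-- The residual of the regression function is `λ (K + λ)⁻¹ v`. -/
lemma sub_posteriorMean_input (S : TreeSpec d n N) {lam : ℝ} (hlam : 0 < lam) (v : Fin N → ℝ)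
    (i : Fin N) : v i - posteriorMean S lam v (S.input i) = lam * dualCoef S lam v i := by
  have h := congrFun (regGram_mulVec_dualCoef S hlam v) i
  rw [regGram_mulVec, ← posteriorMean_eq_sum] at h
  linarith

/-- The regression function is a stationary point of the averaged boosting dynamics. -/
lemma sum_stationary_predict_residual (hN : 1 ≤ N) (S : TreeSpec d n N) {lam : ℝ} (hlam : 0 < lam)
    (v : Fin N → ℝ) (z : 𝔼 d) :
    ∑ ν, stationary S ν * predict S ν (fun i => v i - posteriorMean S lam v (S.input i)) z =
      lam / N * posteriorMean S lam v z := by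
  rw [sum_stationary_mul_predict hN]
  simp only [sub_posteriorMean_input S hlam]
  simp only [posteriorMean_eq_sum, Finset.mul_sum, Finset.sum_div]
  refine Finset.sum_congr rfl fun i _ => by ring

/-- The regression function is the only stationary point at the training points. -/
lemma residual_eq_of_stationary (hN : 1 ≤ N) (S : TreeSpec d n N) {lam : ℝ} (hlam : 0 < lam)
    {v w : Fin N → ℝ}
    (h : ∀ i, ∑ ν, stationary S ν * predict S ν (v - w) (S.input i) = lam / N * w i) (i : Fin N) :
    v i - w i = lam * dualCoef S lam v i := by
  have hN0 : (N : ℝ) ≠ 0 := by positivity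
  have h1 : regGram S lam *ᵥ (v - w) = lam • v := by
    funext i
    have := h i
    rw [sum_stationary_mul_predict hN] at this
    rw [regGram_mulVec, Pi.smul_apply, smul_eq_mul, Pi.sub_apply]
    field_simp at this
    linarith
  have h2 := dualCoef_regGram_mulVec S hlam (v - w)
  rw [h1, dualCoef, Matrix.mulVec_smul] at h2
  exact (congrFun h2 i).symm

/-- A stationary point of the averaged dynamics whose values at the training points are `w` is the
regression function. -/
lemma eq_posteriorMean_of_stationary (hN : 1 ≤ N) (S : TreeSpec d n N) {lam : ℝ} (hlam : 0 < lam)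
    {v w : Fin N → ℝ}
    (h : ∀ i, ∑ ν, stationary S ν * predict S ν (v - w) (S.input i) = lam / N * w i) {z : 𝔼 d}
    {t : ℝ} (ht : ∑ ν, stationary S ν * predict S ν (v - w) z = lam / N * t) :
    t = posteriorMean S lam v z := by
  have hN0 : (N : ℝ) ≠ 0 := by positivity
  rw [sum_stationary_mul_predict hN] at ht
  simp only [Pi.sub_apply, residual_eq_of_stationary hN S hlam h] at ht
  have h2 : ∑ i, kernel S z (S.input i) * (lam * dualCoef S lam v i) =
      lam * posteriorMean S lam v z := by
    rw [posteriorMean_eq_sum, Finset.mul_sum]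
    refine Finset.sum_congr rfl fun i _ => by ring
  rw [h2] at ht
  field_simp at ht
  linarith

/-- The weight of the label `j` in the regression function at `z`. -/
noncomputable def krigingWeight (S : TreeSpec d n N) (lam : ℝ) (z : EuclideanSpace ℝ (Fin d))
    (j : Fin N) : ℝ :=
  ∑ i, kernel S z (S.input i) * (regGram S lam)⁻¹ i j

lemma posteriorMean_eq_krigingWeight (S : TreeSpec d n N) (lam : ℝ) (v : Fin N → ℝ) (z : 𝔼 d) :
    posteriorMean S lam v z = ∑ j, krigingWeight S lam z j * v j := by
  simp only [posteriorMean, krigingWeight, dotProduct, Matrix.mulVec, Finset.mul_sum,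
    Finset.sum_mul]
  rw [Finset.sum_comm]
  refine Finset.sum_congr rfl fun i _ => Finset.sum_congr rfl fun j _ => by ring

lemma posteriorCov_eq (S : TreeSpec d n N) (σ lam : ℝ) (z z' : 𝔼 d) :
    posteriorCov S σ lam z z' = σ ^ 2 * (kernel S z z' -
      ∑ j, krigingWeight S lam z j * kernel S (S.input j) z') := by
  rw [← posteriorMean_eq_krigingWeight]; rfl

/-- The kriging weights solve the normal equations. -/
lemma sum_krigingWeight_mul_regGram (S : TreeSpec d n N) {lam : ℝ} (hlam : 0 < lam) (z : 𝔼 d)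
    (j : Fin N) : ∑ i, krigingWeight S lam z i * regGram S lam i j = kernel S z (S.input j) := by
  have h : (fun i => kernel S z (S.input i)) ᵥ* ((regGram S lam)⁻¹ * regGram S lam) =
      fun i => kernel S z (S.input i) := by
    rw [Matrix.nonsing_inv_mul _ ((Matrix.isUnit_iff_isUnit_det _).1 (isUnit_regGram S hlam)),
      Matrix.vecMul_one]
  rw [← Matrix.vecMul_vecMul] at h
  exact congrFun h j

/-! ### Points with the same leaf of the full tree are indistinguishable -/

lemma leafOf_eq_inter (S : TreeSpec d n N) (ν : Finset (Split d n)) (z : 𝔼 d) :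
    leafOf S ν z = ν.filter (· ∈ leafOf S Finset.univ z) := by
  classical
  ext s; simp [leafOf]

lemma leafInd_congr (S : TreeSpec d n N) {z z' : 𝔼 d}
    (h : leafOf S Finset.univ z = leafOf S Finset.univ z') (ν ℓ : Finset (Split d n)) :
    leafInd S ν ℓ z = leafInd S ν ℓ z' := by
  simp only [leafInd, leafOf_eq_inter S ν, h]

lemma predict_congr (S : TreeSpec d n N) {z z' : 𝔼 d}
    (h : leafOf S Finset.univ z = leafOf S Finset.univ z') (ν : Finset (Split d n))
    (v : Fin N → ℝ) : predict S ν v z = predict S ν v z' := by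
  simp only [predict, leafInd_congr S h]

lemma kernel_congr_left (S : TreeSpec d n N) {z z' : 𝔼 d}
    (h : leafOf S Finset.univ z = leafOf S Finset.univ z') (t : 𝔼 d) :
    kernel S z t = kernel S z' t := by
  simp only [kernel, weakKernel, leafInd_congr S h]

lemma trainGBDT_congr (S : TreeSpec d n N) (ε β lam : ℝ) (Y : Fin N → ℝ)
    (u : ℕ → ℕ → Split d n → ℝ) (T : ℕ) {z z' : 𝔼 d}
    (h : leafOf S Finset.univ z = leafOf S Finset.univ z') :
    trainGBDT S ε β lam Y u T z = trainGBDT S ε β lam Y u T z' := by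
  induction T with
  | zero => rfl
  | succ T ih => rw [trainGBDT_succ, trainGBDT_succ, ih, predict_congr S h]

lemma krigingWeight_congr (S : TreeSpec d n N) (lam : ℝ) {z z' : 𝔼 d}
    (h : leafOf S Finset.univ z = leafOf S Finset.univ z') (j : Fin N) :
    krigingWeight S lam z j = krigingWeight S lam z' j := by
  simp only [krigingWeight, kernel_congr_left S h]

end Predict

/-! ### Measurability -/

section Measurability

variable {d n N : ℕ} {Ω : Type*} {mΩ : MeasurableSpace Ω}

lemma select_eq_sum_indicator {κ : Type*} [Fintype κ] (t : Ω → κ) (F : κ → Ω → ℝ) (ω : Ω) :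
    F (t ω) ω = ∑ k, {ω | t ω = k}.indicator (F k) ω := by
  classical
  rw [Finset.sum_eq_single (t ω)]
  · simp
  · intro j _ hj
    exact Set.indicator_of_notMem (by simpa using hj.symm) _
  · simp

/-- A measurable selection from finitely many measurable functions is measurable. -/
lemma measurable_select {ι : Type*} [Fintype ι] {t : Ω → ι}
    (ht : ∀ j, MeasurableSet {ω | t ω = j}) {F : ι → Ω → ℝ} (hF : ∀ j, Measurable (F j)) :
    Measurable fun ω => F (t ω) ω := by
  simp only [select_eq_sum_indicator t F]
  exact Finset.measurable_sum _ fun j _ => (hF j).indicator (ht j)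

lemma measurable_leafMean (S : TreeSpec d n N) (ν ℓ : Finset (Split d n)) {r : Ω → Fin N → ℝ}
    (hr : ∀ i, Measurable fun ω => r ω i) : Measurable fun ω => leafMean S ν ℓ (r ω) := by
  unfold leafMean; fun_prop

lemma measurable_predict (S : TreeSpec d n N) (ν : Finset (Split d n)) {r : Ω → Fin N → ℝ}
    (hr : ∀ i, Measurable fun ω => r ω i) (z : EuclideanSpace ℝ (Fin d)) :
    Measurable fun ω => predict S ν (r ω) z :=
  Finset.measurable_sum _ fun ℓ _ => (measurable_leafMean S ν ℓ hr).const_mul _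

lemma measurable_gumbel : Measurable gumbel := by
  unfold gumbel; fun_prop

lemma measurable_objective (S : TreeSpec d n N) (β : ℝ) (ν : Finset (Split d n)) (s : Split d n)
    {r : Ω → Fin N → ℝ} (hr : ∀ i, Measurable fun ω => r ω i) {v : Ω → Split d n → ℝ}
    (hv : ∀ s, Measurable fun ω => v ω s) :
    Measurable fun ω => objective S β (r ω) ν (v ω) s := by
  unfold objective score; fun_prop

lemma measurableSet_maximizers {A : Finset (Split d n)} {g : Ω → Split d n → ℝ}
    (hg : ∀ s, Measurable fun ω => g ω s) (M : Finset (Split d n)) :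
    MeasurableSet {ω | maximizers A (g ω) = M} := by
  classical
  have : {ω | maximizers A (g ω) = M} = ⋂ s, {ω | s ∈ maximizers A (g ω) ↔ s ∈ M} := by
    ext ω; simp [Finset.ext_iff]
  rw [this]
  refine MeasurableSet.iInter fun s => ?_
  have h1 : MeasurableSet {ω | s ∈ maximizers A (g ω)} := by
    have : {ω | s ∈ maximizers A (g ω)} = {_ω | s ∈ A} ∩ ⋂ s' ∈ A, {ω | g ω s' ≤ g ω s} := by
      ext ω; simp [mem_maximizers]
    rw [this]
    exact (MeasurableSet.const (s ∈ A)).inter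
      (Finset.measurableSet_biInter _ fun s' _ => measurableSet_le (hg s') (hg s))
  by_cases hs : s ∈ M
  · simpa only [hs, iff_true] using h1
  · have : {ω | s ∈ maximizers A (g ω) ↔ s ∈ M} = {ω | s ∈ maximizers A (g ω)}ᶜ := by
      ext ω; simp [hs]
    rw [this]
    exact h1.compl

lemma measurableSet_growStep (S : TreeSpec d n N) (β : ℝ) (ν : Finset (Split d n))
    {r : Ω → Fin N → ℝ} (hr : ∀ i, Measurable fun ω => r ω i) {v : Ω → Split d n → ℝ}
    (hv : ∀ s, Measurable fun ω => v ω s) (ν' : Finset (Split d n)) :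
    MeasurableSet {ω | growStep S β (r ω) ν (v ω) = ν'} := by
  classical
  have : {ω | growStep S β (r ω) ν (v ω) = ν'} = ⋃ M : Finset (Split d n),
      {ω | maximizers (Finset.univ \ ν) (objective S β (r ω) ν (v ω)) = M} ∩
        {_ω | (if h : M.Nonempty then insert (M.min' h) ν else ν) = ν'} := by
    ext ω
    simp only [Set.mem_ofPred_eq, Set.mem_iUnion, Set.mem_inter_iff, exists_eq_left', growStep]
  rw [this]
  exact MeasurableSet.iUnion fun M => (measurableSet_maximizers
    (fun s => measurable_objective S β ν s hr hv) M).inter (MeasurableSet.const _)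

lemma measurableSet_growTree (S : TreeSpec d n N) (β : ℝ) {r : Ω → Fin N → ℝ}
    (hr : ∀ i, Measurable fun ω => r ω i) {u : Ω → ℕ → Split d n → ℝ}
    (hu : ∀ i s, Measurable fun ω => u ω i s) (k : ℕ) (ν : Finset (Split d n)) :
    MeasurableSet {ω | growTree S β (r ω) (u ω) k = ν} := by
  classical
  induction k generalizing ν with
  | zero => simp only [growTree_zero]; exact MeasurableSet.const _
  | succ k ih =>
    have : {ω | growTree S β (r ω) (u ω) (k + 1) = ν} = ⋃ ν₀ : Finset (Split d n),
        {ω | growTree S β (r ω) (u ω) k = ν₀} ∩ {ω | growStep S β (r ω) ν₀ (u ω k) = ν} := by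
      ext ω; simp [growTree_succ]
    rw [this]
    exact MeasurableSet.iUnion fun ν₀ => (ih ν₀).inter
      (measurableSet_growStep S β ν₀ hr (hu k) ν)

lemma measurableSet_sampleTree (S : TreeSpec d n N) (β : ℝ) {r : Ω → Fin N → ℝ}
    (hr : ∀ i, Measurable fun ω => r ω i) {u : Ω → ℕ → Split d n → ℝ}
    (hu : ∀ i s, Measurable fun ω => u ω i s) (ν : Finset (Split d n)) :
    MeasurableSet {ω | sampleTree S β (r ω) (u ω) = ν} :=
  measurableSet_growTree S β hr hu S.depth ν

/-- The state after `T` iterations depends measurably on the labels and on the noise of the first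
`T` iterations. -/
lemma measurable_trainGBDT (S : TreeSpec d n N) (ε β lam : ℝ) {Y : Ω → Fin N → ℝ}
    (hY : ∀ i, Measurable fun ω => Y ω i) {u : Ω → ℕ → ℕ → Split d n → ℝ} {T : ℕ}
    (hu : ∀ τ < T, ∀ i s, Measurable fun ω => u ω τ i s) (z : EuclideanSpace ℝ (Fin d)) :
    Measurable fun ω => trainGBDT S ε β lam (Y ω) (u ω) T z := by
  induction T generalizing z with
  | zero => exact measurable_const
  | succ T ih =>
    have ih' := fun z => ih (fun τ hτ => hu τ (by omega)) z
    simp only [trainGBDT_succ]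
    have hr : ∀ i, Measurable fun ω => Y ω i - trainGBDT S ε β lam (Y ω) (u ω) T (S.input i) :=
      fun i => (hY i).sub (ih' _)
    refine ((ih' z).const_mul _).add (Measurable.const_mul ?_ _)
    exact measurable_select (measurableSet_sampleTree S β hr (hu T (by omega)))
      fun ν => measurable_predict S ν hr z

lemma measurable_samplePrior (S : TreeSpec d n N) (T : ℕ) {a : Ω → PriorSeed d n → ℝ}
    (ha : ∀ i, Measurable fun ω => a ω i) (z : EuclideanSpace ℝ (Fin d)) :
    Measurable fun ω => samplePrior S T (a ω) z := by
  unfold samplePrior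
  refine Finset.measurable_sum _ fun τ _ => ?_
  have := measurable_select (Ω := Ω)
    (measurableSet_sampleTree S 1 (r := fun _ => 0) (fun _ => measurable_const)
      (u := fun ω i s => a ω (.unif τ i s)) fun i s => ha _)
    (F := fun ν ω => 1 / √(T : ℝ) * ∑ ℓ ∈ ν.powerset,
      leafInd S ν ℓ z * (√(leafWeight S ν ℓ) * a ω (.leaf τ ℓ))) (fun ν => by fun_prop)
  exact this

lemma measurableSet_leafOf (S : TreeSpec d n N) (ν ℓ : Finset (Split d n)) :
    MeasurableSet {z | leafOf S ν z = ℓ} := by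
  classical
  have : {z | leafOf S ν z = ℓ} = ⋂ s, {z | s ∈ leafOf S ν z ↔ s ∈ ℓ} := by
    ext z; simp [Finset.ext_iff]
  rw [this]
  refine MeasurableSet.iInter fun s => ?_
  have h1 : MeasurableSet {z | s ∈ leafOf S ν z} := by
    have : {z | s ∈ leafOf S ν z} = {_z | s ∈ ν} ∩
        {z | S.threshold (ofLex s).1 (ofLex s).2 < z (ofLex s).1} := by
      ext z; simp [leafOf]
    rw [this]
    have hz : Measurable fun z : EuclideanSpace ℝ (Fin d) => z (ofLex s).1 := by fun_prop
    exact (MeasurableSet.const (s ∈ ν)).inter (measurableSet_lt measurable_const hz)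
  by_cases hs : s ∈ ℓ
  · simpa only [hs, iff_true] using h1
  · have : {z | s ∈ leafOf S ν z ↔ s ∈ ℓ} = {z | s ∈ leafOf S ν z}ᶜ := by
      ext z; simp [hs]
    rw [this]
    exact h1.compl

end Measurability

/-! ### The law of a tree grown by pure noise -/

section Noise

variable {d n N : ℕ} {Ω : Type*} {mΩ : MeasurableSpace Ω}

/-- The uniform distribution on `[0, 1]`. -/
noncomputable abbrev uniformLaw : Measure ℝ := volume.restrict (Set.Icc 0 1)

instance : IsProbabilityMeasure uniformLaw := ⟨by simp⟩

/-- An array of independent uniform random variables on `[0, 1]`: row `i` is the noise consumed by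
SampleTree in round `i`. -/
structure IsUniformNoise (P : Measure Ω) (u : ℕ → Split d n → Ω → ℝ) : Prop where
  measurable : ∀ i s, Measurable (u i s)
  law : ∀ i s, HasLaw (u i s) uniformLaw P
  indep : iIndepFun (fun p : ℕ × Split d n => u p.1 p.2) P

/-- The probability that two independent Gumbel variables differ by at most `x`. -/
noncomputable def gumbelGap (x : ℝ) : ℝ :=
  (uniformLaw.prod uniformLaw).real {p | |gumbel p.1 - gumbel p.2| ≤ x}

lemma gumbelGap_nonneg (x : ℝ) : 0 ≤ gumbelGap x := measureReal_nonneg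

lemma measurableSet_gap (x : ℝ) :
    MeasurableSet {p : ℝ × ℝ | |gumbel p.1 - gumbel p.2| ≤ x} := by
  have := measurable_gumbel
  exact measurableSet_le (by fun_prop) measurable_const

lemma gumbel_injOn : Set.InjOn gumbel (Set.Ioo 0 1) := by
  intro x hx y hy h
  have hx' : 0 < -Real.log x := neg_pos.2 (Real.log_neg hx.1 hx.2)
  have hy' : 0 < -Real.log y := neg_pos.2 (Real.log_neg hy.1 hy.2)
  have h1 := Real.log_injOn_pos hx' hy' (neg_injective h)
  exact Real.log_injOn_pos hx.1 hy.1 (neg_injective h1)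

lemma ae_uniformLaw_mem_Ioo : ∀ᵐ x ∂uniformLaw, x ∈ Set.Ioo (0 : ℝ) 1 := by
  rw [uniformLaw, ← Measure.restrict_congr_set Ioo_ae_eq_Icc]
  exact ae_restrict_mem measurableSet_Ioo

/-- Two independent Gumbel variables are almost surely different. -/
lemma gumbelGap_zero : gumbelGap 0 = 0 := by
  have h : (uniformLaw.prod uniformLaw) {p | |gumbel p.1 - gumbel p.2| ≤ 0} = 0 := by
    rw [Measure.measure_prod_null (measurableSet_gap 0)]
    filter_upwards [ae_uniformLaw_mem_Ioo] with x hx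
    have h1 : uniformLaw {x} = 0 := measure_singleton x
    have h2 : uniformLaw (Set.Ioo 0 1)ᶜ = 0 := ae_uniformLaw_mem_Ioo
    refine measure_mono_null (t := {x} ∪ (Set.Ioo 0 1)ᶜ) ?_ (measure_union_null h1 h2)
    intro y hy
    by_cases hy' : y ∈ Set.Ioo (0 : ℝ) 1
    · left
      have : gumbel x = gumbel y := by
        have : |gumbel x - gumbel y| ≤ 0 := hy
        exact sub_eq_zero.1 (abs_nonpos_iff.1 this)
      exact (gumbel_injOn hx hy' this).symm
    · exact Or.inr hy'
  rw [gumbelGap, measureReal_def, h, ENNReal.toReal_zero]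

lemma tendsto_gumbelGap : Tendsto gumbelGap (𝓝[>] 0) (𝓝 0) := by
  have h := tendsto_measure_biInter_gt (μ := uniformLaw.prod uniformLaw)
    (s := fun x : ℝ => {p : ℝ × ℝ | |gumbel p.1 - gumbel p.2| ≤ x}) (a := 0)
    (fun x _ => (measurableSet_gap x).nullMeasurableSet)
    (fun x y _ hxy p (hp : _ ≤ x) => le_trans hp hxy) ⟨1, one_pos, measure_ne_top _ _⟩
  have h0 : ⋂ r > (0 : ℝ), {p : ℝ × ℝ | |gumbel p.1 - gumbel p.2| ≤ r} =
      {p : ℝ × ℝ | |gumbel p.1 - gumbel p.2| ≤ 0} := by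
    ext p
    simp only [Set.mem_iInter, Set.mem_ofPred_eq]
    exact ⟨fun h => le_of_forall_gt_imp_ge_of_dense h, fun h r hr => h.trans hr.le⟩
  rw [h0] at h
  have h2 := (ENNReal.tendsto_toReal (measure_ne_top _ _)).comp h
  have h3 := gumbelGap_zero
  rw [gumbelGap, measureReal_def] at h3
  rw [h3] at h2
  exact h2

/-- The event that in one of the first `k` rounds the noise of two splits differs by at most
`x`. -/
def gapEvent (u : ℕ → Split d n → Ω → ℝ) (k : ℕ) (x : ℝ) : Set Ω :=
  ⋃ p ∈ Finset.range k ×ˢ (Finset.univ : Finset (Split d n × Split d n)).filter fun q => q.1 ≠ q.2,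
    {ω | |gumbel (u p.1 p.2.1 ω) - gumbel (u p.1 p.2.2 ω)| ≤ x}

lemma notMem_gapEvent {u : ℕ → Split d n → Ω → ℝ} {k : ℕ} {x : ℝ} {ω : Ω} :
    ω ∉ gapEvent u k x ↔
      ∀ i < k, ∀ s s', s ≠ s' → x < |gumbel (u i s ω) - gumbel (u i s' ω)| := by
  simp only [gapEvent, Set.mem_iUnion, Finset.mem_product, Finset.mem_range, Finset.mem_filter,
    Finset.mem_univ, true_and, Set.mem_ofPred_eq, not_exists, not_le, Prod.forall, and_imp]
  exact ⟨fun h i hi s s' hs => h i s s' hi hs, fun h i s s' hi hs => h i hi s s' hs⟩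

lemma measurableSet_gapEvent {u : ℕ → Split d n → Ω → ℝ} (hu : ∀ i s, Measurable (u i s))
    (k : ℕ) (x : ℝ) : MeasurableSet (gapEvent u k x) := by
  refine Finset.measurableSet_biUnion _ fun p _ => ?_
  have := measurable_gumbel
  exact measurableSet_le (by fun_prop) measurable_const

/-- The union bound for `gapEvent`. -/
noncomputable def gapBound (d n k : ℕ) (x : ℝ) : ℝ :=
  k * (Fintype.card (Split d n × Split d n)) * gumbelGap x

lemma gapBound_nonneg (d n k : ℕ) (x : ℝ) : 0 ≤ gapBound d n k x := by
  have := gumbelGap_nonneg x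
  unfold gapBound; positivity

lemma gapBound_zero (d n k : ℕ) : gapBound d n k 0 = 0 := by
  simp [gapBound, gumbelGap_zero]

lemma tendsto_gapBound (d n k : ℕ) : Tendsto (gapBound d n k) (𝓝[>] 0) (𝓝 0) := by
  have h := tendsto_gumbelGap.const_mul (k * (Fintype.card (Split d n × Split d n)) : ℝ)
  rwa [mul_zero] at h

variable {P : Measure Ω} {u : ℕ → Split d n → Ω → ℝ}

lemma measureReal_gapEvent_le (hu : IsUniformNoise P u) (k : ℕ) (x : ℝ) :
    P.real (gapEvent u k x) ≤ gapBound d n k x := by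
  have := hu.indep.isProbabilityMeasure
  refine (measureReal_biUnion_finset_le _ _).trans ?_
  refine (Finset.sum_le_card_nsmul _ _ (gumbelGap x) fun p hp => ?_).trans ?_
  · obtain ⟨i, s, s'⟩ := p
    have hs : s ≠ s' := by simpa using (Finset.mem_product.1 hp).2
    have hind : IndepFun (u i s) (u i s') P :=
      hu.indep.indepFun (i := (i, s)) (j := (i, s')) (by simpa using hs)
    have hmap := (indepFun_iff_map_prod_eq_prod_map_map (hu.measurable i s).aemeasurable
      (hu.measurable i s').aemeasurable).1 hind
    rw [(hu.law i s).map_eq, (hu.law i s').map_eq] at hmap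
    rw [gumbelGap, ← hmap, map_measureReal_apply ((hu.measurable i s).prodMk (hu.measurable i s'))
      (measurableSet_gap x)]
    rfl
  · rw [nsmul_eq_mul, gapBound]
    refine mul_le_mul_of_nonneg_right ?_ (gumbelGap_nonneg x)
    rw [Finset.card_product, Finset.card_range]
    push_cast
    refine mul_le_mul_of_nonneg_left ?_ (Nat.cast_nonneg k)
    rw [← Finset.card_univ]
    exact_mod_cast Finset.card_filter_le _ _

lemma ae_gumbel_ne (hu : IsUniformNoise P u) (k : ℕ) : ∀ᵐ ω ∂P,
    ∀ i < k, ∀ s s', s ≠ s' → gumbel (u i s ω) ≠ gumbel (u i s' ω) := by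
  have := hu.indep.isProbabilityMeasure
  have h0 : P (gapEvent u k 0) = 0 := by
    have h := (measureReal_gapEvent_le hu k 0).trans (gapBound_zero d n k).le
    exact (measureReal_eq_zero_iff).1 (le_antisymm h measureReal_nonneg)
  filter_upwards [measure_eq_zero_iff_ae_notMem.1 h0] with ω hω i hi s s' hs h
  have := notMem_gapEvent.1 hω i hi s s' hs
  simp [h] at this

lemma IsUniformNoise.comp_perm (hu : IsUniformNoise P u) (κ : Equiv.Perm (Split d n)) :
    IsUniformNoise P fun i s => u i (κ s) where
  measurable i s := hu.measurable i (κ s)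
  law i s := hu.law i (κ s)
  indep := hu.indep.precomp (g := fun p : ℕ × Split d n => (p.1, κ p.2)) fun p q h => by
    simpa [Prod.ext_iff] using h

lemma IsUniformNoise.hasLaw (hu : IsUniformNoise P u) :
    HasLaw (fun ω (p : ℕ × Split d n) => u p.1 p.2 ω)
      (Measure.infinitePi fun _ : ℕ × Split d n => uniformLaw) P :=
  hu.indep.hasLaw_infinitePi (fun p => hu.law p.1 p.2)
    (measurable_pi_lambda _ fun p : ℕ × Split d n => hu.measurable p.1 p.2).aemeasurable

/-- The law of the tree depends on the noise only through its law. -/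
lemma measureReal_growTree_congr (S : TreeSpec d n N) {Ω' : Type*} {mΩ' : MeasurableSpace Ω'}
    {P' : Measure Ω'} {u' : ℕ → Split d n → Ω' → ℝ} (hu : IsUniformNoise P u)
    (hu' : IsUniformNoise P' u') (k : ℕ) (ν : Finset (Split d n)) :
    P.real {ω | growTree S 1 0 (fun i s => u i s ω) k = ν} =
      P'.real {ω | growTree S 1 0 (fun i s => u' i s ω) k = ν} := by
  have hm : MeasurableSet {w : ℕ × Split d n → ℝ | growTree S 1 0 (fun i s => w (i, s)) k = ν} :=
    measurableSet_growTree S 1 (r := fun _ => 0) (fun _ => measurable_const)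
      (u := fun (w : ℕ × Split d n → ℝ) i s => w (i, s)) (fun i s => measurable_pi_apply _) k ν
  exact (hu.hasLaw.measureReal_eq hm).trans (hu'.hasLaw.measureReal_eq hm).symm

/-- By symmetry, all trees of the same size are equally likely. -/
lemma measureReal_growTree_map_perm (S : TreeSpec d n N) (hu : IsUniformNoise P u) (k : ℕ)
    (κ : Equiv.Perm (Split d n)) (ν : Finset (Split d n)) :
    P.real {ω | growTree S 1 0 (fun i s => u i s ω) k = ν.map κ.toEmbedding} =
      P.real {ω | growTree S 1 0 (fun i s => u i s ω) k = ν} := by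
  rw [← measureReal_growTree_congr S (hu.comp_perm κ) hu k ν]
  refine measureReal_congr (eventuallyEq_set.2 ?_)
  filter_upwards [ae_gumbel_ne hu k] with ω hω
  rw [growTree_comp_perm S κ hω, Finset.map_inj]

lemma exists_perm_map_eq {α : Type*} [Fintype α] [DecidableEq α] {s t : Finset α}
    (h : s.card = t.card) : ∃ κ : Equiv.Perm α, s.map κ.toEmbedding = t := by
  let e : {x // x ∈ s} ≃ {x // x ∈ t} := Fintype.equivOfCardEq (by simpa using h)
  refine ⟨e.extendSubtype, Finset.eq_of_subset_of_card_le ?_ (by simp [h])⟩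
  intro x hx
  obtain ⟨y, hy, rfl⟩ := Finset.mem_map.1 hx
  exact e.extendSubtype_mem y hy

/-- Without a score, SampleTree has exactly the stationary distribution. -/
lemma measureReal_sampleTree_zero (S : TreeSpec d n N) (hu : IsUniformNoise P u)
    (ν : Finset (Split d n)) :
    P.real {ω | sampleTree S 1 0 (fun i s => u i s ω) = ν} = stationary S ν := by
  classical
  have := hu.indep.isProbabilityMeasure
  set q : Finset (Split d n) → ℝ := fun ν =>
    P.real {ω | sampleTree S 1 0 (fun i s => u i s ω) = ν} with hq
  have hmeas : ∀ ν, MeasurableSet {ω | sampleTree S 1 0 (fun i s => u i s ω) = ν} := fun ν =>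
    measurableSet_sampleTree S 1 (r := fun _ => 0) (fun _ => measurable_const)
      (u := fun ω i s => u i s ω) hu.measurable ν
  have h0 : ∀ ν : Finset (Split d n), ν.card ≠ min S.depth (n * d) → q ν = 0 := by
    intro ν hν
    have : {ω | sampleTree S 1 0 (fun i s => u i s ω) = ν} = ∅ := by
      ext ω
      simp only [Set.mem_ofPred_eq, Set.mem_empty_iff_false, iff_false]
      rintro rfl
      exact hν (card_sampleTree _ _ _ _)
    rw [hq]; simp only [this, measureReal_empty]
  have hsum : ∑ ν, q ν = 1 := by
    have := sum_measureReal_preimage_singleton (μ := P) (Finset.univ)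
      (f := fun ω => sampleTree S 1 0 (fun i s => u i s ω)) (fun ν _ => hmeas ν)
    rw [Finset.coe_univ, Set.preimage_univ, probReal_univ] at this
    exact this
  have hcard : ((Finset.univ : Finset (Finset (Split d n))).filter
      fun ν => ν.card = min S.depth (n * d)).card = (n * d).choose (min S.depth (n * d)) := by
    rw [← card_split, ← Finset.card_univ, ← Finset.card_powersetCard]
    congr 1
    ext ν; simp [Finset.mem_powersetCard]
  change q ν = _
  by_cases hν : ν.card = min S.depth (n * d)
  · have hc : ∀ ν' : Finset (Split d n), ν'.card = min S.depth (n * d) → q ν' = q ν := by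
      intro ν' hν'
      obtain ⟨κ, rfl⟩ := exists_perm_map_eq (hν.trans hν'.symm)
      exact measureReal_growTree_map_perm S hu S.depth κ ν
    rw [← Finset.sum_filter_add_sum_filter_not _ fun ν : Finset (Split d n) =>
      ν.card = min S.depth (n * d), Finset.sum_congr rfl fun ν' h =>
        hc ν' (Finset.mem_filter.1 h).2,
      Finset.sum_const, hcard, Finset.sum_eq_zero fun ν' h => h0 ν' (Finset.mem_filter.1 h).2,
      add_zero, nsmul_eq_mul] at hsum
    rw [stationary, if_pos hν]
    have : ((n * d).choose (min S.depth (n * d)) : ℝ) ≠ 0 := by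
      exact_mod_cast (Nat.choose_pos (min_le_right _ _)).ne'
    field_simp
    linarith
  · rw [h0 ν hν, stationary, if_neg hν]

/-- Outside the gap event, the score of a bounded residual does not influence the tree. -/
lemma sampleTree_eq_of_notMem_gapEvent (S : TreeSpec d n N) {β R : ℝ} (hβ : 0 < β) {r : Fin N → ℝ}
    (hr : ∑ i, r i ^ 2 ≤ R) {ω : Ω} (hω : ω ∉ gapEvent u S.depth (R / β)) :
    sampleTree S β r (fun i s => u i s ω) = sampleTree S 1 0 (fun i s => u i s ω) :=
  growTree_eq_of_gap S hβ (fun ν => ⟨(score_mem_Icc S ν r).1, (score_mem_Icc S ν r).2.trans hr⟩)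
    (notMem_gapEvent.1 hω)

/-- As the random strength grows, the law of SampleTree tends to the stationary distribution. -/
lemma tendsto_measureReal_sampleTree (S : TreeSpec d n N) (hu : IsUniformNoise P u) (r : Fin N → ℝ)
    (ν : Finset (Split d n)) :
    Tendsto (fun β => P.real {ω | sampleTree S β r (fun i s => u i s ω) = ν}) atTop
      (𝓝 (stationary S ν)) := by
  have := hu.indep.isProbabilityMeasure
  set R : ℝ := ∑ i, r i ^ 2 + 1
  have hR : 0 < R := by
    have : 0 ≤ ∑ i, r i ^ 2 := Finset.sum_nonneg fun _ _ => sq_nonneg _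
    positivity
  rw [tendsto_iff_dist_tendsto_zero]
  have hlim : Tendsto (fun β : ℝ => R / β) atTop (𝓝[>] 0) := by
    refine tendsto_nhdsWithin_iff.2 ⟨tendsto_const_nhds.div_atTop tendsto_id, ?_⟩
    filter_upwards [eventually_gt_atTop 0] with β hβ
    exact div_pos hR hβ
  refine squeeze_zero' (Eventually.of_forall fun _ => dist_nonneg) ?_
    ((tendsto_gapBound d n S.depth).comp hlim)
  filter_upwards [eventually_gt_atTop 0] with β hβ
  rw [← measureReal_sampleTree_zero S hu ν, Real.dist_eq]
  have key := fun ω (hω : ω ∉ gapEvent u S.depth (R / β)) =>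
    sampleTree_eq_of_notMem_gapEvent S hβ (r := r) (by simp [R]) hω
  refine le_trans ?_ (measureReal_gapEvent_le hu S.depth (R / β))
  rw [abs_sub_le_iff]
  constructor
  · rw [sub_le_iff_le_add]
    refine (measureReal_mono fun ω hω => ?_).trans (measureReal_union_le _ _)
    by_cases h : ω ∈ gapEvent u S.depth (R / β)
    · exact Or.inl h
    · exact Or.inr ((key ω h).symm.trans hω)
  · rw [sub_le_iff_le_add]
    refine (measureReal_mono fun ω hω => ?_).trans (measureReal_union_le _ _)
    by_cases h : ω ∈ gapEvent u S.depth (R / β)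
    · exact Or.inl h
    · exact Or.inr ((key ω h).trans hω)

lemma uniformLaw_Ioo_pos {a b : ℝ} (ha : 0 ≤ a) (hb : b ≤ 1) (hab : a < b) :
    0 < uniformLaw (Set.Ioo a b) := by
  have h : Set.Ioo a b ⊆ Set.Icc 0 1 := fun x hx => ⟨ha.trans hx.1.le, hx.2.le.trans hb⟩
  rw [uniformLaw, Measure.restrict_apply measurableSet_Ioo, Set.inter_eq_left.2 h, Real.volume_Ioo]
  simpa using hab

/-- Ranges of positive probability for the noise of each split such that the splits of `ν` win
against all other splits by any prescribed margin. -/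
lemma exists_dominant_ranges {β : ℝ} (hβ : 0 < β) (B : ℝ) (ν : Finset (Split d n)) :
    ∃ I : Split d n → Set ℝ, (∀ s, MeasurableSet (I s)) ∧ (∀ s, 0 < uniformLaw (I s)) ∧
      ∀ s ∈ ν, ∀ s' ∉ ν, ∀ x ∈ I s, ∀ y ∈ I s', B + β * gumbel y < β * gumbel x := by
  classical
  set g₀ : ℝ := -Real.log (Real.log 2)
  -- a uniform variable above `a` has Gumbel noise above `B / β + g₀`
  set a : ℝ := Real.exp (-Real.exp (-(B / β + g₀))) with ha
  have ha1 : a < 1 := by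
    rw [ha, Real.exp_lt_one_iff]; exact neg_neg_of_pos (Real.exp_pos _)
  have ha0 : 0 < a := Real.exp_pos _
  refine ⟨fun s => if s ∈ ν then Set.Ioo a 1 else Set.Ioo 0 (1 / 2), fun s => ?_, fun s => ?_, ?_⟩
  · dsimp only
    split_ifs <;> exact measurableSet_Ioo
  · dsimp only
    split_ifs
    · exact uniformLaw_Ioo_pos ha0.le le_rfl ha1
    · exact uniformLaw_Ioo_pos le_rfl (by norm_num) (by norm_num)
  · intro s hs s' hs' x hx y hy
    replace hx : x ∈ Set.Ioo a 1 := by simpa only [if_pos hs] using hx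
    replace hy : y ∈ Set.Ioo 0 (1 / 2) := by simpa only [if_neg hs'] using hy
    have hy1 : gumbel y ≤ g₀ := by
      have hlog2 : 0 < Real.log 2 := Real.log_pos (by norm_num)
      have h1 : Real.log 2 ≤ -Real.log y := by
        have := Real.log_le_log hy.1 hy.2.le
        rw [one_div, Real.log_inv] at this
        linarith
      have := Real.log_le_log hlog2 h1
      simp only [gumbel, g₀]
      linarith
    have hx1 : B / β + g₀ < gumbel x := by
      have hx0 : 0 < x := ha0.trans hx.1
      have hpos : 0 < -Real.log x := neg_pos.2 (Real.log_neg hx0 hx.2)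
      have h1 : -Real.log x < Real.exp (-(B / β + g₀)) := by
        have := Real.log_lt_log ha0 hx.1
        rw [ha, Real.log_exp] at this
        linarith
      have := Real.log_lt_log hpos h1
      rw [Real.log_exp] at this
      simp only [gumbel]
      linarith
    have h2 : B / β + gumbel y < gumbel x := by linarith
    have h3 := mul_lt_mul_of_pos_left h2 hβ
    rw [mul_add, mul_div_cancel₀ _ hβ.ne'] at h3
    exact h3

end Noise

/-! ### Stochastic approximation with a contracting drift -/

section StochasticApproximation

/-- Bernoulli's inequality turns a contraction of squared norms into one of norms. -/
lemma norm_le_of_sq_contraction {H : Type*} [NormedAddCommGroup H] {c ε : ℝ}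
    (hc : 0 < c) (hε : 0 < ε) (hcε : c * ε ≤ 1) {x y : H} (h : ‖y‖ ^ 2 ≤ (1 - c * ε) * ‖x‖ ^ 2) :
      ‖y‖ ≤ (1 - c * ε / 2) * ‖x‖ := by
  have : 0 < c * ε := mul_pos hc hε
  refine abs_le_of_sq_le_sq' ?_ (mul_nonneg (by linarith) (norm_nonneg _)) |>.2
  nlinarith [sq_nonneg (c * ε * ‖x‖)]

variable {H : Type*} [NormedAddCommGroup H] [InnerProductSpace ℝ H]

/-- A contraction with bounded perturbations stays bounded. -/
lemma norm_le_of_contraction {c ε X R : ℝ} (hc : 0 < c) (hε : 0 < ε) (hcε : c * ε ≤ 1)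
    (hX : X ≤ c / 2 * R) {e y ξ : ℕ → H} (h0 : ‖e 0‖ ≤ R)
    (hstep : ∀ τ, e (τ + 1) = y τ + ε • ξ τ) (hy : ∀ τ, ‖y τ‖ ^ 2 ≤ (1 - c * ε) * ‖e τ‖ ^ 2)
    (hξ : ∀ τ, ‖ξ τ‖ ≤ X) (τ : ℕ) : ‖e τ‖ ≤ R := by
  induction τ with
  | zero => exact h0
  | succ τ ih =>
    have h1 := norm_le_of_sq_contraction hc hε hcε (hy τ)
    have h2 : 0 ≤ 1 - c * ε / 2 := by linarith
    calc ‖e (τ + 1)‖ ≤ ‖y τ‖ + ‖ε • ξ τ‖ := by rw [hstep]; exact norm_add_le _ _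
      _ = ‖y τ‖ + ε * ‖ξ τ‖ := by rw [norm_smul, Real.norm_of_nonneg hε.le]
      _ ≤ (1 - c * ε / 2) * R + ε * (c / 2 * R) := by
          gcongr
          · exact h1.trans (mul_le_mul_of_nonneg_left ih h2)
          · exact (hξ τ).trans hX
      _ = R := by ring

variable [MeasurableSpace H] [BorelSpace H] [SecondCountableTopology H]
  {Ω : Type*} {mΩ : MeasurableSpace Ω} {P : Measure Ω} [IsProbabilityMeasure P]

/-- The integral of a function over an independent event factorizes. -/
lemma setIntegral_eq_mul_of_indep {m₁ m₂ : MeasurableSpace Ω} (h₁ : m₁ ≤ mΩ) (h₂ : m₂ ≤ mΩ)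
    (hind : Indep m₁ m₂ P) {f : Ω → ℝ} (hf : Measurable[m₁] f) (hfi : Integrable f P) {s : Set Ω}
    (hs : MeasurableSet[m₂] s) : ∫ ω in s, f ω ∂P = P.real s * ∫ ω, f ω ∂P := by
  rw [← setIntegral_condExp h₂ hfi hs,
    integral_congr_ae (ae_restrict_of_ae (condExp_indep_eq h₁ h₂ hf.stronglyMeasurable hind)),
    setIntegral_const, smul_eq_mul]

/-- Integration of a variable selected by an independent random index. -/
lemma integral_select {m₁ m₂ : MeasurableSpace Ω} (h₁ : m₁ ≤ mΩ)
    (h₂ : m₂ ≤ mΩ) (hind : Indep m₁ m₂ P) {κ : Type*} [Fintype κ] {t : Ω → κ}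
    (ht : ∀ k, MeasurableSet[m₂] {ω | t ω = k}) {F : κ → Ω → ℝ} (hF : ∀ k, Measurable[m₁] (F k))
    (hFi : ∀ k, Integrable (F k) P) :
    ∫ ω, F (t ω) ω ∂P = ∑ k, P.real {ω | t ω = k} * ∫ ω, F k ω ∂P := by
  simp only [select_eq_sum_indicator t F]
  rw [integral_finsetSum _ fun k _ => (hFi k).indicator (h₂ _ (ht k))]
  refine Finset.sum_congr rfl fun k _ => ?_
  rw [integral_indicator (h₂ _ (ht k)), setIntegral_eq_mul_of_indep h₁ h₂ hind (hF k) (hFi k)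
    (ht k)]

/-- A perturbation chosen by an independent index, and centered on average over that index, is
orthogonal to the past. -/
lemma integral_inner_select_eq_zero {ι : Type*} [Fintype ι] {m₁ m₂ : MeasurableSpace Ω}
    (h₁ : m₁ ≤ mΩ) (h₂ : m₂ ≤ mΩ) (hind : Indep m₁ m₂ P) {t : Ω → ι}
    (ht : ∀ j, MeasurableSet[m₂] {ω | t ω = j}) {w : ι → ℝ} (hw : ∀ j, P.real {ω | t ω = j} = w j)
    {e : Ω → H} (he : Measurable[m₁] e) {R X : ℝ} (hR : ∀ ω, ‖e ω‖ ≤ R) {ξ : ι → Ω → H}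
    (hξ : ∀ j, Measurable[m₁] (ξ j)) (hX : ∀ j ω, ‖ξ j ω‖ ≤ X)
    (hmean : ∀ ω, ∑ j, w j • ξ j ω = 0) :
    ∫ ω, inner ℝ (e ω) (ξ (t ω) ω) ∂P = 0 := by
  classical
  have hm : ∀ j, Measurable[m₁] fun ω => inner ℝ (e ω) (ξ j ω) := fun j => he.inner (hξ j)
  have hint : ∀ j, Integrable (fun ω => inner ℝ (e ω) (ξ j ω)) P := fun j => by
    refine Integrable.of_bound ((hm j).mono h₁ le_rfl).aestronglyMeasurable (R * X) ?_
    refine Eventually.of_forall fun ω => (norm_inner_le_norm _ _).trans ?_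
    have := norm_nonneg (e ω)
    exact mul_le_mul (hR ω) (hX j ω) (norm_nonneg _) (this.trans (hR ω))
  rw [integral_select h₁ h₂ hind ht (F := fun j ω => inner ℝ (e ω) (ξ j ω)) hm hint]
  simp only [hw, ← integral_const_mul]
  rw [← integral_finsetSum _ fun j _ => (hint j).const_mul _]
  have : ∀ ω, ∑ j, w j * inner ℝ (e ω) (ξ j ω) = 0 := fun ω => by
    have := congrArg (inner ℝ (e ω)) (hmean ω)
    simpa [inner_sum, inner_smul_right] using this
  simp [this]

lemma le_of_affine_recursion {a : ℕ → ℝ} {θ L : ℝ} (hθ : 0 ≤ θ) (hL : 0 ≤ L)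
    (h : ∀ τ, a (τ + 1) ≤ θ * a τ + (1 - θ) * L) (T : ℕ) : a T ≤ θ ^ T * a 0 + L := by
  suffices a T - L ≤ θ ^ T * (a 0 - L) by
    have : 0 ≤ θ ^ T * L := by positivity
    linarith
  induction T with
  | zero => simp
  | succ T ih =>
    have := mul_le_mul_of_nonneg_left ih hθ
    rw [pow_succ']
    linarith [h T]

/-- Mean-square error of a stochastic approximation scheme. The step size `ε` multiplies both a
contracting drift and a perturbation `ξ` selected by the index `t τ`, which agrees up to
probability `q` with an index `t' τ` whose perturbation is orthogonal to the current error. -/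
theorem integral_norm_sq_le_of_stochastic_approximation {ι : Type*} [Fintype ι]
    {c ε b X R q : ℝ} (hc : 0 < c) (hε : 0 < ε) (hcε : c * ε ≤ 1) (hb : 0 ≤ b)
    {A : ι → H → H} (hA : ∀ j x, ‖A j x‖ ^ 2 ≤ (1 - c * ε) * ‖x‖ ^ 2)
    (hAb : ∀ j x, ‖A j x - x‖ ≤ ε * b * ‖x‖)
    {e : ℕ → Ω → H} (he : ∀ τ, Measurable (e τ)) (hR : ∀ τ ω, ‖e τ ω‖ ≤ R)
    {ξ : ι → Ω → H} (hξ : ∀ j, Measurable (ξ j)) (hX : ∀ j ω, ‖ξ j ω‖ ≤ X)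
    {t t' : ℕ → Ω → ι} (ht' : ∀ τ j, MeasurableSet {ω | t' τ ω = j})
    {bad : ℕ → Set Ω} (hbad : ∀ τ, MeasurableSet (bad τ))
    (htt : ∀ τ, ∀ ω ∉ bad τ, t τ ω = t' τ ω) (hq : ∀ τ, P.real (bad τ) ≤ q)
    (hstep : ∀ τ ω, e (τ + 1) ω = A (t τ ω) (e τ ω) + ε • ξ (t τ ω) ω)
    (horth : ∀ τ, ∫ ω, inner ℝ (e τ ω) (ξ (t' τ ω) ω) ∂P = 0) (T : ℕ) :
    ∫ ω, ‖e T ω‖ ^ 2 ∂P ≤ (1 - c * ε) ^ T * R ^ 2 +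
      (4 * X * R * q + ε * (2 * b * R * X + X ^ 2)) / c := by
  classical
  have hne : Nonempty Ω := nonempty_of_isProbabilityMeasure P
  obtain ⟨ω₀⟩ := hne
  have hR0 : 0 ≤ R := (norm_nonneg _).trans (hR 0 ω₀)
  have hX0 : 0 ≤ X := (norm_nonneg _).trans (hX (t 0 ω₀) ω₀)
  have hq0 : 0 ≤ q := measureReal_nonneg.trans (hq 0)
  set L := (4 * X * R * q + ε * (2 * b * R * X + X ^ 2)) / c with hL
  have hL0 : 0 ≤ L := by positivity
  have hsq : ∀ τ, Integrable (fun ω => ‖e τ ω‖ ^ 2) P := fun τ =>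
    Integrable.of_bound ((he τ).norm.pow_const 2).aestronglyMeasurable (R ^ 2)
      (Eventually.of_forall fun ω => by
        rw [Real.norm_of_nonneg (by positivity)]
        exact pow_le_pow_left₀ (norm_nonneg _) (hR τ ω) 2)
  have hinner : ∀ τ, Integrable (fun ω => inner ℝ (e τ ω) (ξ (t' τ ω) ω)) P := fun τ => by
    refine Integrable.of_bound (measurable_select (ht' τ)
      fun j => (he τ).inner (hξ j)).aestronglyMeasurable (R * X) ?_
    exact Eventually.of_forall fun ω => (norm_inner_le_norm _ _).trans
      (mul_le_mul (hR τ ω) (hX _ ω) (norm_nonneg _) hR0)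
  have hind : ∀ τ, Integrable ((bad τ).indicator fun _ => (1 : ℝ)) P := fun τ =>
    (integrable_const 1).indicator (hbad τ)
  -- expand the square of one step; replacing the index `t` by `t'` costs at most `4 ε X R` on `bad`
  have hpt : ∀ τ ω, ‖e (τ + 1) ω‖ ^ 2 ≤ (1 - c * ε) * ‖e τ ω‖ ^ 2 +
      2 * ε * inner ℝ (e τ ω) (ξ (t' τ ω) ω) +
      4 * ε * X * R * (bad τ).indicator (fun _ => (1 : ℝ)) ω +
      ε ^ 2 * (2 * b * R * X + X ^ 2) := by
    intro τ ω
    rw [hstep]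
    set x := e τ ω
    set j := t τ ω
    have h1 : inner ℝ (A j x) (ξ j ω) ≤ inner ℝ x (ξ j ω) + ε * b * R * X := by
      have : inner ℝ (A j x) (ξ j ω) = inner ℝ x (ξ j ω) + inner ℝ (A j x - x) (ξ j ω) := by
        rw [← inner_add_left, add_sub_cancel]
      rw [this]
      gcongr
      refine (real_inner_le_norm _ _).trans ?_
      refine mul_le_mul ((hAb j x).trans ?_) (hX j ω) (norm_nonneg _) (by positivity)
      exact mul_le_mul_of_nonneg_left (hR τ ω) (by positivity)
    have h2 : inner ℝ x (ξ j ω) ≤ inner ℝ x (ξ (t' τ ω) ω) +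
        2 * X * R * (bad τ).indicator (fun _ => (1 : ℝ)) ω := by
      by_cases hω : ω ∈ bad τ
      · have := abs_le.1 ((abs_real_inner_le_norm x (ξ j ω)).trans
          (mul_le_mul (hR τ ω) (hX j ω) (norm_nonneg _) hR0))
        have h' := abs_le.1 ((abs_real_inner_le_norm x (ξ (t' τ ω) ω)).trans
          (mul_le_mul (hR τ ω) (hX (t' τ ω) ω) (norm_nonneg _) hR0))
        rw [Set.indicator_of_mem hω]
        linarith [this.2, h'.1]
      · rw [Set.indicator_of_notMem hω, show j = t' τ ω from htt τ ω hω]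
        simp
    have h3 : ‖ξ j ω‖ ^ 2 ≤ X ^ 2 := pow_le_pow_left₀ (norm_nonneg _) (hX j ω) 2
    rw [norm_add_sq_real, inner_smul_right, norm_smul, mul_pow, Real.norm_of_nonneg hε.le]
    have h4 := mul_le_mul_of_nonneg_left (h1.trans (add_le_add_left h2 _))
      (by positivity : 0 ≤ 2 * ε)
    have h5 := mul_le_mul_of_nonneg_left h3 (by positivity : 0 ≤ ε ^ 2)
    linarith [hA j x]
  have hrec : ∀ τ, ∫ ω, ‖e (τ + 1) ω‖ ^ 2 ∂P ≤
      (1 - c * ε) * ∫ ω, ‖e τ ω‖ ^ 2 ∂P + (1 - (1 - c * ε)) * L := by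
    intro τ
    have hi1 := ((hsq τ).const_mul (1 - c * ε)).add ((hinner τ).const_mul (2 * ε))
    have hi2 := hi1.add ((hind τ).const_mul (4 * ε * X * R))
    have hi3 := hi2.add (integrable_const (ε ^ 2 * (2 * b * R * X + X ^ 2)))
    refine (integral_mono (hsq (τ + 1)) hi3 (hpt τ)).trans ?_
    rw [integral_add' hi2 (integrable_const _),
      integral_add' hi1 ((hind τ).const_mul (4 * ε * X * R)),
      integral_add' ((hsq τ).const_mul (1 - c * ε)) ((hinner τ).const_mul (2 * ε)),
      integral_const_mul, integral_const_mul, integral_const_mul, horth τ, integral_const,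
      integral_indicator_const _ (hbad τ)]
    simp only [probReal_univ, smul_eq_mul, mul_one, mul_zero, add_zero, one_mul]
    have h6 : (1 - (1 - c * ε)) * L = ε * (4 * X * R * q + ε * (2 * b * R * X + X ^ 2)) := by
      rw [hL]; field_simp; ring
    rw [h6]
    have h7 := mul_le_mul_of_nonneg_left (hq τ) (by positivity : 0 ≤ 4 * ε * X * R)
    linarith
  have hθ : 0 ≤ 1 - c * ε := by linarith
  have h0 : ∫ ω, ‖e 0 ω‖ ^ 2 ∂P ≤ R ^ 2 := by
    refine (integral_mono (hsq 0) (integrable_const (R ^ 2))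
      fun ω => pow_le_pow_left₀ (norm_nonneg _) (hR 0 ω) 2).trans ?_
    simp
  exact (le_of_affine_recursion (a := fun τ => ∫ ω, ‖e τ ω‖ ^ 2 ∂P) hθ hL0 hrec T).trans
    (add_le_add_left (mul_le_mul_of_nonneg_left h0 (pow_nonneg hθ T)) L)

end StochasticApproximation

/-! ### Boosting as a stochastic approximation of the regression function -/

section Boosting

variable {d n N : ℕ}

/-- The values of a function at the training points together with its value at `z`, scaled by
`√c`, as a vector of a Euclidean space. With this scaling boosting contracts the norm although
the prediction at `z` feeds on the residuals at the training points only. -/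
noncomputable def embed (S : TreeSpec d n N) (c : ℝ) (z : EuclideanSpace ℝ (Fin d))
    (f : EuclideanSpace ℝ (Fin d) → ℝ) : EuclideanSpace ℝ (Option (Fin N)) :=
  WithLp.toLp 2 fun o => o.elim (√c * f z) fun i => f (S.input i)

/-- The action of fitting the tree `ν` on embedded functions. -/
noncomputable def fitOp (S : TreeSpec d n N) (c : ℝ) (z : EuclideanSpace ℝ (Fin d))
    (ν : Finset (Split d n)) (x : EuclideanSpace ℝ (Option (Fin N))) :
    EuclideanSpace ℝ (Option (Fin N)) :=
  embed S c z (predict S ν fun i => x (some i))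

/-- The drift of boosting with learning rate `ε` and shrinkage `c ε`. -/
noncomputable def driftOp (S : TreeSpec d n N) (c ε : ℝ) (z : EuclideanSpace ℝ (Fin d))
    (ν : Finset (Split d n)) (x : EuclideanSpace ℝ (Option (Fin N))) :
    EuclideanSpace ℝ (Option (Fin N)) :=
  (1 - c * ε) • x - ε • fitOp S c z ν x

lemma norm_embed_sq (S : TreeSpec d n N) {c : ℝ} (hc : 0 ≤ c) (z : EuclideanSpace ℝ (Fin d))
    (f : EuclideanSpace ℝ (Fin d) → ℝ) :
    ‖embed S c z f‖ ^ 2 = c * f z ^ 2 + ∑ i, f (S.input i) ^ 2 := by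
  rw [EuclideanSpace.real_norm_sq_eq, Fintype.sum_option]
  simp [embed, mul_pow, Real.sq_sqrt hc]

lemma norm_embed_predict_sq_le (S : TreeSpec d n N) {c : ℝ} (hc : 0 ≤ c)
    (z : EuclideanSpace ℝ (Fin d)) (ν : Finset (Split d n)) (v : Fin N → ℝ) :
    ‖embed S c z (predict S ν v)‖ ^ 2 ≤ (1 + c) * ∑ i, v i ^ 2 := by
  rw [norm_embed_sq S hc]
  have h1 := predict_sq_le S ν v z
  have h2 := sum_predict_sq_le S ν v
  nlinarith

lemma sum_some_sq_le (x : EuclideanSpace ℝ (Option (Fin N))) : ∑ i, x (some i) ^ 2 ≤ ‖x‖ ^ 2 := by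
  rw [EuclideanSpace.real_norm_sq_eq, Fintype.sum_option]
  linarith [sq_nonneg (x none)]

/-- The drift contracts the scaled norm for every tree, so that no averaging over trees is needed
for stability. -/
lemma norm_driftOp_sq_le (S : TreeSpec d n N) {c ε : ℝ} (hc : 0 < c) (hε : 0 < ε)
    (hcε : ε * (1 + 2 * c) ≤ 1) (z : EuclideanSpace ℝ (Fin d)) (ν : Finset (Split d n))
    (x : EuclideanSpace ℝ (Option (Fin N))) :
    ‖driftOp S c ε z ν x‖ ^ 2 ≤ (1 - c * ε) * ‖x‖ ^ 2 := by
  set v : Fin N → ℝ := fun i => x (some i) with hv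
  set f := x none with hf
  set a := predict S ν v z with ha
  set Q := ∑ i, predict S ν v (S.input i) ^ 2 with hQ
  set V := ∑ i, v i ^ 2 with hV
  have hcc : √c ^ 2 = c := Real.sq_sqrt hc.le
  have hx : ‖x‖ ^ 2 = f ^ 2 + V := by
    rw [EuclideanSpace.real_norm_sq_eq, Fintype.sum_option]
  have hy : ‖driftOp S c ε z ν x‖ ^ 2 = ((1 - c * ε) * f - ε * (√c * a)) ^ 2 +
      ((1 - c * ε) ^ 2 * V - 2 * (1 - c * ε) * ε * Q + ε ^ 2 * Q) := by
    rw [EuclideanSpace.real_norm_sq_eq, Fintype.sum_option]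
    have : ∑ i, (driftOp S c ε z ν x (some i)) ^ 2 =
        (1 - c * ε) ^ 2 * V - 2 * (1 - c * ε) * ε * (∑ i, v i * predict S ν v (S.input i))
          + ε ^ 2 * Q := by
      rw [hV, hQ, Finset.mul_sum, Finset.mul_sum, Finset.mul_sum, ← Finset.sum_sub_distrib,
        ← Finset.sum_add_distrib]
      refine Finset.sum_congr rfl fun i _ => ?_
      simp only [driftOp, fitOp, embed, PiLp.sub_apply, PiLp.smul_apply, smul_eq_mul,
        Option.elim_some]
      ring
    rw [this, sum_mul_predict_eq_sum_sq]
    simp [driftOp, fitOp, embed, ha, hf, hQ, hv]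
  have haQ : a ^ 2 ≤ Q := predict_sq_le S ν v z
  have hQ0 : 0 ≤ Q := (sq_nonneg a).trans haQ
  have hcε' : c * ε ≤ 1 := by nlinarith
  -- the cross term of the two coordinates is absorbed by the shrinkage and the projection
  have hcross : -(c * f ^ 2 + Q) ≤ 2 * (√c * a * f) := by
    nlinarith [sq_nonneg (√c * f + a)]
  have h1 := mul_le_mul_of_nonneg_left hcross
    (mul_nonneg (by linarith : 0 ≤ 1 - c * ε) hε.le)
  have h2 : ε ^ 2 * (c * a ^ 2 + Q) ≤ ε ^ 2 * ((1 + c) * Q) :=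
    mul_le_mul_of_nonneg_left (by nlinarith) (by positivity)
  have h3 : 0 ≤ ε * Q * (1 - c * ε - ε * (1 + c)) :=
    mul_nonneg (mul_nonneg hε.le hQ0) (by linarith)
  have h4 : 0 ≤ (1 - c * ε) * (c * ε) * V :=
    mul_nonneg (mul_nonneg (by linarith) (by positivity)) (Finset.sum_nonneg fun _ _ => sq_nonneg _)
  rw [hy, hx]
  have h5 : (ε * (√c * a)) ^ 2 = ε ^ 2 * (c * a ^ 2) := by rw [mul_pow, mul_pow, hcc]
  nlinarith [h1, h2, h3, h4, h5]

lemma norm_driftOp_sub_le (S : TreeSpec d n N) {c ε : ℝ} (hc : 0 < c) (hε : 0 < ε)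
    (z : EuclideanSpace ℝ (Fin d)) (ν : Finset (Split d n))
    (x : EuclideanSpace ℝ (Option (Fin N))) :
    ‖driftOp S c ε z ν x - x‖ ≤ ε * (1 + 2 * c) * ‖x‖ := by
  have h1 : driftOp S c ε z ν x - x = -(ε • (c • x + fitOp S c z ν x)) := by
    rw [driftOp, smul_add, smul_smul, sub_smul, one_smul, mul_comm ε c]; abel
  have h2 : ‖fitOp S c z ν x‖ ≤ (1 + c) * ‖x‖ := by
    refine abs_le_of_sq_le_sq' ?_ (by positivity) |>.2
    calc ‖fitOp S c z ν x‖ ^ 2 ≤ (1 + c) * ∑ i, x (some i) ^ 2 :=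
          norm_embed_predict_sq_le S hc.le z ν _
      _ ≤ (1 + c) * ‖x‖ ^ 2 := mul_le_mul_of_nonneg_left (sum_some_sq_le x) (by positivity)
      _ ≤ ((1 + c) * ‖x‖) ^ 2 := by
          rw [mul_pow]
          exact mul_le_mul_of_nonneg_right (by nlinarith) (by positivity)
  rw [h1, norm_neg, norm_smul, Real.norm_of_nonneg hε.le, mul_assoc]
  refine mul_le_mul_of_nonneg_left ((norm_add_le _ _).trans ?_) hε.le
  rw [norm_smul, Real.norm_of_nonneg hc.le]
  linarith

/-- The residual `v - f_∞` of the regression function `f_∞` of `v`. -/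
noncomputable def limitResidual (S : TreeSpec d n N) (lam : ℝ) (v : Fin N → ℝ) : Fin N → ℝ :=
  fun i => v i - posteriorMean S lam v (S.input i)

/-- The deviation of the increment of boosting at `f_∞` from its stationary average `0`, when the
tree is `ν`. -/
noncomputable def perturbation (S : TreeSpec d n N) (lam : ℝ) (v : Fin N → ℝ)
    (ν : Finset (Split d n)) (z : EuclideanSpace ℝ (Fin d)) : ℝ :=
  predict S ν (limitResidual S lam v) z - lam / N * posteriorMean S lam v z

/-- The regression function is the fixed point of averaged boosting. -/
lemma sum_stationary_mul_perturbation (hN : 1 ≤ N) (S : TreeSpec d n N) {lam : ℝ} (hlam : 0 < lam)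
    (v : Fin N → ℝ) (z : EuclideanSpace ℝ (Fin d)) :
    ∑ ν, stationary S ν * perturbation S lam v ν z = 0 := by
  simp only [perturbation, mul_sub, Finset.sum_sub_distrib, ← Finset.sum_mul, sum_stationary]
  have := sum_stationary_predict_residual hN S hlam v z
  unfold limitResidual
  rw [this]; ring

/-- The regression function and its residual are no larger than the data. -/
lemma sum_sq_posteriorMean_add_sum_sq_residual_le (S : TreeSpec d n N) {lam : ℝ} (hlam : 0 < lam)
    (v : Fin N → ℝ) :
    ∑ i, posteriorMean S lam v (S.input i) ^ 2 + ∑ i, limitResidual S lam v i ^ 2 ≤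
      ∑ i, v i ^ 2 := by
  -- with dual coefficients `α`, the values are `K α` and the residual is `λ α`
  have h0 : 0 ≤ ∑ i, dualCoef S lam v i * posteriorMean S lam v (S.input i) := by
    simp only [posteriorMean_eq_sum]
    exact sum_mul_kernel_mul_nonneg S (dualCoef S lam v)
  have h1 : ∑ i, v i ^ 2 = ∑ i, posteriorMean S lam v (S.input i) ^ 2 +
      ∑ i, limitResidual S lam v i ^ 2 +
      2 * lam * ∑ i, dualCoef S lam v i * posteriorMean S lam v (S.input i) := by
    rw [Finset.mul_sum, ← Finset.sum_add_distrib, ← Finset.sum_add_distrib]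
    refine Finset.sum_congr rfl fun i _ => ?_
    have := sub_posteriorMean_input S hlam v i
    rw [limitResidual]
    linear_combination (2 * posteriorMean S lam v (S.input i)) * this
  have h2 : 0 ≤ 2 * lam * ∑ i, dualCoef S lam v i * posteriorMean S lam v (S.input i) := by
    positivity
  linarith

lemma sum_sq_limitResidual_le (S : TreeSpec d n N) {lam : ℝ} (hlam : 0 < lam) (v : Fin N → ℝ) :
    ∑ i, limitResidual S lam v i ^ 2 ≤ ∑ i, v i ^ 2 := by
  have := sum_sq_posteriorMean_add_sum_sq_residual_le S hlam v
  have h : 0 ≤ ∑ i, posteriorMean S lam v (S.input i) ^ 2 :=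
    Finset.sum_nonneg fun _ _ => sq_nonneg _
  linarith

lemma posteriorMean_sq_le (hN : 1 ≤ N) (S : TreeSpec d n N) {lam : ℝ} (hlam : 0 < lam)
    (v : Fin N → ℝ) (z : EuclideanSpace ℝ (Fin d)) :
    (lam / N * posteriorMean S lam v z) ^ 2 ≤ ∑ i, v i ^ 2 := by
  rw [← sum_stationary_predict_residual hN S hlam v z]
  set B := √(∑ i, v i ^ 2) with hB
  have h0 : 0 ≤ ∑ i, v i ^ 2 := Finset.sum_nonneg fun _ _ => sq_nonneg _
  have hbound : ∀ ν, |predict S ν (limitResidual S lam v) z| ≤ B := fun ν =>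
    Real.abs_le_sqrt (((predict_sq_le S ν _ z).trans (sum_predict_sq_le S ν _)).trans
      (sum_sq_limitResidual_le S hlam v))
  rw [← Real.sq_sqrt h0, ← hB, sq_le_sq, abs_of_nonneg (Real.sqrt_nonneg _)]
  refine (Finset.abs_sum_le_sum_abs _ _).trans ?_
  calc ∑ ν, |stationary S ν * predict S ν (limitResidual S lam v) z|
      ≤ ∑ ν, stationary S ν * B := Finset.sum_le_sum fun ν _ => by
        rw [abs_mul, abs_of_nonneg (stationary_nonneg S ν)]
        exact mul_le_mul_of_nonneg_left (hbound ν) (stationary_nonneg S ν)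
    _ = B := by rw [← Finset.sum_mul, sum_stationary, one_mul]

end Boosting

/-! ### Mean-square error of boosting -/

section BoostingError

variable {d n N : ℕ}

/-- The deviation of boosting after `T` iterations from the regression function. -/
noncomputable def boostErr (S : TreeSpec d n N) (ε β lam : ℝ) (Y : Fin N → ℝ)
    (u : ℕ → ℕ → Split d n → ℝ) (T : ℕ) (z : EuclideanSpace ℝ (Fin d)) : ℝ :=
  trainGBDT S ε β lam Y u T z - posteriorMean S lam Y z

/-- The residual that is passed to SampleTree at iteration `T`. -/
noncomputable def residual (S : TreeSpec d n N) (ε β lam : ℝ) (Y : Fin N → ℝ)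
    (u : ℕ → ℕ → Split d n → ℝ) (T : ℕ) : Fin N → ℝ :=
  fun i => Y i - trainGBDT S ε β lam Y u T (S.input i)

lemma residual_eq (S : TreeSpec d n N) (ε β lam : ℝ) (Y : Fin N → ℝ)
    (u : ℕ → ℕ → Split d n → ℝ) (T : ℕ) :
    residual S ε β lam Y u T =
      limitResidual S lam Y - fun i => boostErr S ε β lam Y u T (S.input i) := by
  funext i; simp [residual, limitResidual, boostErr]

/-- One iteration of boosting moves the error by the drift and a perturbation. -/
lemma embed_boostErr_succ (hN : 1 ≤ N) (S : TreeSpec d n N) (ε β lam : ℝ) (Y : Fin N → ℝ)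
    (u : ℕ → ℕ → Split d n → ℝ) (T : ℕ) (z : EuclideanSpace ℝ (Fin d)) :
    embed S (lam / N) z (boostErr S ε β lam Y u (T + 1)) =
      driftOp S (lam / N) ε z (sampleTree S β (residual S ε β lam Y u T) (u T))
        (embed S (lam / N) z (boostErr S ε β lam Y u T)) +
      ε • embed S (lam / N) z
        (perturbation S lam Y (sampleTree S β (residual S ε β lam Y u T) (u T))) := by
  set ν := sampleTree S β (residual S ε β lam Y u T) (u T) with hν
  have key : ∀ w, boostErr S ε β lam Y u (T + 1) w =
      (1 - lam / N * ε) * boostErr S ε β lam Y u T w -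
        ε * predict S ν (fun i => boostErr S ε β lam Y u T (S.input i)) w +
        ε * perturbation S lam Y ν w := by
    intro w
    have h1 : boostErr S ε β lam Y u (T + 1) w = (1 - lam * ε / N) * trainGBDT S ε β lam Y u T w +
        ε * predict S ν (residual S ε β lam Y u T) w - posteriorMean S lam Y w := by
      rw [boostErr, trainGBDT_succ]; rfl
    rw [h1, residual_eq, predict_sub hN, perturbation, boostErr]
    ring
  ext o
  rcases o with _ | i
  · simp only [embed, driftOp, fitOp, PiLp.add_apply, PiLp.sub_apply, PiLp.smul_apply,
      smul_eq_mul, Option.elim_none, Option.elim_some, key z]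
    ring
  · simp only [embed, driftOp, fitOp, PiLp.add_apply, PiLp.sub_apply, PiLp.smul_apply,
      smul_eq_mul, Option.elim_some, key (S.input i)]

/-- The radius, relative to the size of the labels, of a ball in which the error of boosting
stays. -/
noncomputable def boostRadius (c : ℝ) : ℝ := 4 * (1 + c) / c

lemma boostRadius_pos {c : ℝ} (hc : 0 < c) : 0 < boostRadius c := by
  unfold boostRadius; positivity

lemma norm_embed_posteriorMean_sq_le (hN : 1 ≤ N) (S : TreeSpec d n N) {lam : ℝ} (hlam : 0 < lam)
    (v : Fin N → ℝ) (z : EuclideanSpace ℝ (Fin d)) :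
    lam / N * ‖embed S (lam / N) z (posteriorMean S lam v)‖ ^ 2 ≤
      (1 + lam / N) * ∑ i, v i ^ 2 := by
  have hc : 0 < lam / N := by positivity
  set c := lam / N with hcdef
  rw [norm_embed_sq S hc.le]
  have h1 := posteriorMean_sq_le hN S hlam v z
  rw [← hcdef] at h1
  have h2 := sum_sq_posteriorMean_add_sum_sq_residual_le S hlam v
  have h3 : 0 ≤ ∑ i, limitResidual S lam v i ^ 2 := Finset.sum_nonneg fun _ _ => sq_nonneg _
  nlinarith

lemma norm_embed_perturbation_le (hN : 1 ≤ N) (S : TreeSpec d n N) {lam : ℝ} (hlam : 0 < lam)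
    {v : Fin N → ℝ} {M : ℝ} (hM : 0 ≤ M) (hv : ∑ i, v i ^ 2 ≤ M ^ 2)
    (z : EuclideanSpace ℝ (Fin d)) (ν : Finset (Split d n)) :
    ‖embed S (lam / N) z (perturbation S lam v ν)‖ ≤ 2 * (1 + lam / N) * M := by
  have hc : 0 < lam / N := by positivity
  set c := lam / N with hcdef
  have h1 : ‖embed S c z (predict S ν (limitResidual S lam v))‖ ≤ (1 + c) * M := by
    refine abs_le_of_sq_le_sq' ?_ (by positivity) |>.2
    calc _ ≤ (1 + c) * ∑ i, limitResidual S lam v i ^ 2 := norm_embed_predict_sq_le S hc.le z ν _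
      _ ≤ (1 + c) * M ^ 2 := by
          gcongr; exact (sum_sq_limitResidual_le S hlam v).trans hv
      _ ≤ ((1 + c) * M) ^ 2 := by
          rw [mul_pow]; gcongr; nlinarith
  have h2 : ‖c • embed S c z (posteriorMean S lam v)‖ ≤ (1 + c) * M := by
    refine abs_le_of_sq_le_sq' ?_ (by positivity) |>.2
    rw [norm_smul, mul_pow, Real.norm_of_nonneg hc.le]
    have h3 := norm_embed_posteriorMean_sq_le hN S hlam v z
    rw [← hcdef] at h3
    calc c ^ 2 * ‖embed S c z (posteriorMean S lam v)‖ ^ 2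
        = c * (c * ‖embed S c z (posteriorMean S lam v)‖ ^ 2) := by ring
      _ ≤ c * ((1 + c) * M ^ 2) :=
          mul_le_mul_of_nonneg_left (h3.trans (mul_le_mul_of_nonneg_left hv (by positivity))) hc.le
      _ ≤ ((1 + c) * M) ^ 2 := by
          rw [mul_pow, ← mul_assoc]; gcongr; nlinarith
  have h3 : embed S c z (perturbation S lam v ν) =
      embed S c z (predict S ν (limitResidual S lam v)) -
        c • embed S c z (posteriorMean S lam v) := by
    ext o
    rcases o with _ | i
    · simp only [embed, perturbation, PiLp.sub_apply, PiLp.smul_apply, smul_eq_mul,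
        Option.elim_none, ← hcdef]
      ring
    · simp only [embed, perturbation, PiLp.sub_apply, PiLp.smul_apply, smul_eq_mul,
        Option.elim_some, ← hcdef]
  rw [h3]
  linarith [norm_sub_le (embed S c z (predict S ν (limitResidual S lam v)))
    (c • embed S c z (posteriorMean S lam v))]

/-- Boosting stays bounded, whatever the trees. -/
lemma norm_embed_boostErr_le (hN : 1 ≤ N) (S : TreeSpec d n N) {ε lam : ℝ} (β : ℝ)
    (hlam : 0 < lam) (hε : 0 < ε) (hsmall : ε * (1 + 2 * (lam / N)) ≤ 1) {Y : Fin N → ℝ} {M : ℝ}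
    (hM : 0 ≤ M) (hY : ∑ i, Y i ^ 2 ≤ M ^ 2) (u : ℕ → ℕ → Split d n → ℝ) (T : ℕ)
    (z : EuclideanSpace ℝ (Fin d)) :
    ‖embed S (lam / N) z (boostErr S ε β lam Y u T)‖ ≤ boostRadius (lam / N) * M := by
  have hc : 0 < lam / N := by positivity
  refine norm_le_of_contraction (c := lam / N) (ε := ε) (X := 2 * (1 + lam / N) * M)
    (e := fun T => embed S (lam / N) z (boostErr S ε β lam Y u T))
    (ξ := fun T => embed S (lam / N) z
        (perturbation S lam Y (sampleTree S β (residual S ε β lam Y u T) (u T))))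
    hc hε (by nlinarith) ?_ ?_ (fun T => embed_boostErr_succ hN S ε β lam Y u T z)
    (fun T => norm_driftOp_sq_le S hc hε hsmall z _ _)
    (fun T => norm_embed_perturbation_le hN S hlam hM hY z _) T
  · apply le_of_eq; unfold boostRadius; field_simp; ring
  · have h0 : embed S (lam / N) z (boostErr S ε β lam Y u 0) =
        -embed S (lam / N) z (posteriorMean S lam Y) := by
      ext o
      rcases o with _ | i <;> simp [embed, boostErr, trainGBDT]
    rw [h0, norm_neg]
    have h3 := norm_embed_posteriorMean_sq_le hN S hlam Y z
    set c := lam / N with hcdef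
    refine abs_le_of_sq_le_sq' ?_ (mul_nonneg (boostRadius_pos hc).le hM) |>.2
    refine le_of_mul_le_mul_left (h3.trans ?_) hc
    calc (1 + c) * ∑ i, Y i ^ 2 ≤ (1 + c) * M ^ 2 := by gcongr
      _ ≤ 16 * (1 + c) ^ 2 / c * M ^ 2 := by
          gcongr
          rw [le_div_iff₀ hc]; nlinarith
      _ = c * (boostRadius c * M) ^ 2 := by unfold boostRadius; field_simp; ring

lemma boostErr_sq_le_norm (S : TreeSpec d n N) {c : ℝ} (hc : 0 < c)
    (f : EuclideanSpace ℝ (Fin d) → ℝ) (z : EuclideanSpace ℝ (Fin d)) :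
    f z ^ 2 ≤ ‖embed S c z f‖ ^ 2 / c := by
  rw [le_div_iff₀ hc, norm_embed_sq S hc.le, mul_comm]
  have : 0 ≤ ∑ i, f (S.input i) ^ 2 := Finset.sum_nonneg fun _ _ => sq_nonneg _
  linarith

/-- A bound of the error by the labels that does not depend on the noise, which serves as an
integrable majorant. -/
lemma boostErr_sq_le (hN : 1 ≤ N) (S : TreeSpec d n N) {ε lam : ℝ} (β : ℝ)
    (hlam : 0 < lam) (hε : 0 < ε) (hsmall : ε * (1 + 2 * (lam / N)) ≤ 1) (Y : Fin N → ℝ)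
    (u : ℕ → ℕ → Split d n → ℝ) (T : ℕ) (z : EuclideanSpace ℝ (Fin d)) :
    boostErr S ε β lam Y u T z ^ 2 ≤
      boostRadius (lam / N) ^ 2 / (lam / N) * ∑ i, Y i ^ 2 := by
  have hc : 0 < lam / N := by positivity
  have hY0 : 0 ≤ ∑ i, Y i ^ 2 := Finset.sum_nonneg fun _ _ => sq_nonneg _
  have h1 := norm_embed_boostErr_le hN S β hlam hε hsmall (Real.sqrt_nonneg _)
    (Real.sq_sqrt hY0).ge u T z
  refine (boostErr_sq_le_norm S hc _ z).trans ?_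
  rw [div_mul_eq_mul_div]
  refine div_le_div_of_nonneg_right ?_ hc.le
  refine (pow_le_pow_left₀ (norm_nonneg _) h1 2).trans (le_of_eq ?_)
  rw [mul_pow, Real.sq_sqrt hY0]

lemma sum_sq_residual_le (hN : 1 ≤ N) (S : TreeSpec d n N) {ε lam : ℝ} (β : ℝ)
    (hlam : 0 < lam) (hε : 0 < ε) (hsmall : ε * (1 + 2 * (lam / N)) ≤ 1) {Y : Fin N → ℝ} {M : ℝ}
    (hM : 0 ≤ M) (hY : ∑ i, Y i ^ 2 ≤ M ^ 2) (u : ℕ → ℕ → Split d n → ℝ) (T : ℕ) :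
    ∑ i, residual S ε β lam Y u T i ^ 2 ≤ 2 * (1 + boostRadius (lam / N) ^ 2) * M ^ 2 := by
  have hc : 0 < lam / N := by positivity
  have h1 := norm_embed_boostErr_le hN S β hlam hε hsmall hM hY u T 0
  have h2 := pow_le_pow_left₀ (norm_nonneg _) h1 2
  rw [norm_embed_sq S hc.le] at h2
  have h3 := sum_sq_limitResidual_le S hlam Y
  have h4 : ∑ i, residual S ε β lam Y u T i ^ 2 ≤ 2 * ∑ i, limitResidual S lam Y i ^ 2 +
      2 * ∑ i, boostErr S ε β lam Y u T (S.input i) ^ 2 := by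
    rw [Finset.mul_sum, Finset.mul_sum, ← Finset.sum_add_distrib, residual_eq]
    refine Finset.sum_le_sum fun i _ => ?_
    simp only [Pi.sub_apply]
    nlinarith [sq_nonneg (limitResidual S lam Y i + boostErr S ε β lam Y u T (S.input i))]
  have h5 : 0 ≤ lam / N * boostErr S ε β lam Y u T 0 ^ 2 := by positivity
  rw [mul_pow] at h2
  linarith

/-- The noise of all iterations of boosting, adapted to a filtration such that the noise of
iteration `τ` is independent of the past at time `τ`. -/
structure IsAdaptedNoise {Ω : Type*} {mΩ : MeasurableSpace Ω} (P : Measure Ω)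
    (past : ℕ → MeasurableSpace Ω) (u : ℕ → ℕ → Split d n → Ω → ℝ) : Prop where
  le : ∀ τ, past τ ≤ mΩ
  mono : Monotone past
  noise : ∀ τ, IsUniformNoise P (u τ)
  adapted : ∀ τ i s, Measurable[past (τ + 1)] (u τ i s)
  indep : ∀ τ, Indep (past τ) (⨆ i, ⨆ s, MeasurableSpace.comap (u τ i s) inferInstance) P

variable {Ω : Type*} {mΩ : MeasurableSpace Ω}

lemma measurable_embed (S : TreeSpec d n N) (c : ℝ) (z : EuclideanSpace ℝ (Fin d))
    {f : Ω → EuclideanSpace ℝ (Fin d) → ℝ} (hf : ∀ w, Measurable fun ω => f ω w) :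
    Measurable fun ω => embed S c z (f ω) := by
  refine (WithLp.measurable_toLp 2 _).comp (measurable_pi_iff.2 fun o => ?_)
  rcases o with _ | i
  · exact (hf z).const_mul _
  · exact hf _

lemma measurable_posteriorMean (S : TreeSpec d n N) (lam : ℝ) {Y : Ω → Fin N → ℝ}
    (hY : ∀ i, Measurable fun ω => Y ω i) (z : EuclideanSpace ℝ (Fin d)) :
    Measurable fun ω => posteriorMean S lam (Y ω) z := by
  simp only [posteriorMean_eq_krigingWeight]
  fun_prop

lemma measurable_boostErr (S : TreeSpec d n N) (ε β lam : ℝ) {Y : Ω → Fin N → ℝ}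
    (hY : ∀ i, Measurable fun ω => Y ω i) {u : Ω → ℕ → ℕ → Split d n → ℝ} {T : ℕ}
    (hu : ∀ τ < T, ∀ i s, Measurable fun ω => u ω τ i s) (z : EuclideanSpace ℝ (Fin d)) :
    Measurable fun ω => boostErr S ε β lam (Y ω) (u ω) T z :=
  (measurable_trainGBDT S ε β lam hY hu z).sub (measurable_posteriorMean S lam hY z)

/-- The constant in the mean-square error bound of boosting. -/
noncomputable def boostConst (c : ℝ) : ℝ :=
  (boostRadius c ^ 2 + 8 * (1 + c) * boostRadius c / c +
    (4 * (1 + 2 * c) * (1 + c) * boostRadius c + 4 * (1 + c) ^ 2) / c) / c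

/-- Quantitative convergence of boosting on bounded labels: the mean-square error is controlled by
the decay of the initial error, the probability that the score influences a tree, and the learning
rate, uniformly in the point `z`. -/
theorem integral_boostErr_sq_le (hN : 1 ≤ N) (S : TreeSpec d n N) {ε β lam : ℝ}
    (hlam : 0 < lam) (hε : 0 < ε) (hsmall : ε * (1 + 2 * (lam / N)) ≤ 1) (hβ : 0 < β)
    {P : Measure Ω} [IsProbabilityMeasure P] {past : ℕ → MeasurableSpace Ω}
    {u : ℕ → ℕ → Split d n → Ω → ℝ} (hu : IsAdaptedNoise P past u) {Y : Ω → Fin N → ℝ} {M : ℝ}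
    (hM : 0 ≤ M) (hYm : ∀ i, Measurable[past 0] fun ω => Y ω i)
    (hY : ∀ ω, ∑ i, Y ω i ^ 2 ≤ M ^ 2) (T : ℕ) (z : EuclideanSpace ℝ (Fin d)) :
    ∫ ω, boostErr S ε β lam (Y ω) (fun τ i s => u τ i s ω) T z ^ 2 ∂P ≤
      boostConst (lam / N) * M ^ 2 * ((1 - lam / N * ε) ^ T +
        gapBound d n S.depth (2 * (1 + boostRadius (lam / N) ^ 2) * M ^ 2 / β) + ε) := by
  have hc : 0 < lam / N := by positivity
  set c := lam / N with hcdef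
  have hcε : c * ε ≤ 1 := by nlinarith
  have hρ := boostRadius_pos hc
  set ρ := boostRadius c with hρdef
  set q := gapBound d n S.depth (2 * (1 + ρ ^ 2) * M ^ 2 / β) with hq
  have hq0 : 0 ≤ q := gapBound_nonneg _ _ _ _
  have huT : ∀ T, ∀ τ < T, ∀ i s, Measurable[past T] fun ω => u τ i s ω := fun T τ hτ i s =>
    (hu.adapted τ i s).mono (hu.mono hτ) le_rfl
  have hYp : ∀ T i, Measurable[past T] fun ω => Y ω i := fun T i =>
    (hYm i).mono (hu.mono (Nat.zero_le T)) le_rfl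
  have hup : ∀ τ i s, Measurable[⨆ i, ⨆ s, MeasurableSpace.comap (u τ i s) inferInstance]
      (u τ i s) := fun τ i s =>
    (comap_measurable (u τ i s)).mono (le_iSup₂_of_le i s le_rfl) le_rfl
  have hle2 : ∀ τ, (⨆ i, ⨆ s, MeasurableSpace.comap (u τ i s) inferInstance) ≤ mΩ := fun τ =>
    iSup₂_le fun i s => ((hu.noise τ).measurable i s).comap_le
  set e : ℕ → Ω → EuclideanSpace ℝ (Option (Fin N)) := fun T ω =>
    embed S c z (boostErr S ε β lam (Y ω) (fun τ i s => u τ i s ω) T) with he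
  have hem : ∀ T, Measurable[past T] (e T) := fun T =>
    measurable_embed S c z fun w => measurable_boostErr S ε β lam (hYp T) (huT T) w
  set ξ : Finset (Split d n) → Ω → EuclideanSpace ℝ (Option (Fin N)) := fun ν ω =>
    embed S c z (perturbation S lam (Y ω) ν) with hξ
  have hξm : ∀ T ν, Measurable[past T] (ξ ν) := fun T ν => by
    refine measurable_embed S c z fun w => ?_
    have h1 : ∀ i, Measurable[past T] fun ω => limitResidual S lam (Y ω) i := fun i =>
      (hYp T i).sub (measurable_posteriorMean S lam (hYp T) _)
    exact (measurable_predict S ν h1 w).sub ((measurable_posteriorMean S lam (hYp T) w).const_mul _)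
  have hR : ∀ T ω, ‖e T ω‖ ≤ ρ * M := fun T ω =>
    norm_embed_boostErr_le hN S β hlam hε hsmall hM (hY ω) _ T z
  have hX : ∀ ν ω, ‖ξ ν ω‖ ≤ 2 * (1 + c) * M := fun ν ω =>
    norm_embed_perturbation_le hN S hlam hM (hY ω) z ν
  -- the tree grown by pure noise has the stationary law and is independent of the past
  have horth : ∀ τ, ∫ ω, inner ℝ (e τ ω) (ξ (sampleTree S 1 0 fun i s => u τ i s ω) ω) ∂P = 0 := by
    intro τ
    refine integral_inner_select_eq_zero (hu.le τ) (hle2 τ) (hu.indep τ)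
      (t := fun ω => sampleTree S 1 0 fun i s => u τ i s ω) (fun ν => ?_)
      (fun ν => measureReal_sampleTree_zero S (hu.noise τ) ν) (hem τ) (hR τ) (hξm τ) hX fun ω => ?_
    · exact measurableSet_sampleTree S 1 (r := fun _ => 0) (fun _ => measurable_const)
        (u := fun ω i s => u τ i s ω) (hup τ) ν
    · have := sum_stationary_mul_perturbation hN S hlam (Y ω)
      ext o
      rcases o with _ | i
      · simp only [hξ, embed, WithLp.ofLp_sum, WithLp.ofLp_smul, Finset.sum_apply, Pi.smul_apply,
          smul_eq_mul, Option.elim_none, mul_left_comm _ (√c), ← Finset.mul_sum, this z]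
        simp
      · simp only [hξ, embed, WithLp.ofLp_sum, WithLp.ofLp_smul, Finset.sum_apply, Pi.smul_apply,
          smul_eq_mul, Option.elim_some, this (S.input i)]
        simp
  have main := integral_norm_sq_le_of_stochastic_approximation (P := P) (c := c) (ε := ε)
    (b := 1 + 2 * c) (X := 2 * (1 + c) * M) (R := ρ * M) (q := q) hc hε hcε (by positivity)
    (A := driftOp S c ε z) (fun ν x => norm_driftOp_sq_le S hc hε hsmall z ν x)
    (fun ν x => norm_driftOp_sub_le S hc hε z ν x) (e := e)
    (fun T => (hem T).mono (hu.le T) le_rfl) hR (ξ := ξ)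
    (fun ν => (hξm 0 ν).mono (hu.le 0) le_rfl) hX
    (t := fun τ ω => sampleTree S β (residual S ε β lam (Y ω) (fun τ i s => u τ i s ω) τ)
      fun i s => u τ i s ω)
    (t' := fun τ ω => sampleTree S 1 0 fun i s => u τ i s ω)
    (fun τ ν => measurableSet_sampleTree S 1 (r := fun _ => 0) (fun _ => measurable_const)
      (u := fun ω i s => u τ i s ω) (hu.noise τ).measurable ν)
    (bad := fun τ => gapEvent (u τ) S.depth (2 * (1 + ρ ^ 2) * M ^ 2 / β))
    (fun τ => measurableSet_gapEvent (hu.noise τ).measurable _ _)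
    (fun τ ω hω => sampleTree_eq_of_notMem_gapEvent S hβ
      (sum_sq_residual_le hN S β hlam hε hsmall hM (hY ω) _ τ) hω)
    (fun τ => measureReal_gapEvent_le (hu.noise τ) _ _)
    (fun τ ω => embed_boostErr_succ hN S ε β lam (Y ω) (fun τ i s => u τ i s ω) τ z) horth T
  have hint : Integrable (fun ω => ‖e T ω‖ ^ 2 / c) P := by
    refine Integrable.div_const ?_ c
    exact Integrable.of_bound
      (((hem T).mono (hu.le T) le_rfl).norm.pow_const 2).aestronglyMeasurable ((ρ * M) ^ 2)
      (Eventually.of_forall fun ω => by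
        rw [Real.norm_of_nonneg (by positivity)]
        exact pow_le_pow_left₀ (norm_nonneg _) (hR T ω) 2)
  have hmono : ∫ ω, boostErr S ε β lam (Y ω) (fun τ i s => u τ i s ω) T z ^ 2 ∂P ≤
      ∫ ω, ‖e T ω‖ ^ 2 / c ∂P :=
    integral_mono_of_nonneg (Eventually.of_forall fun _ => sq_nonneg _) hint
      (Eventually.of_forall fun ω => boostErr_sq_le_norm S hc _ z)
  refine hmono.trans ?_
  rw [integral_div]
  refine (div_le_div_of_nonneg_right main hc.le).trans ?_
  have hθ : 0 ≤ (1 - c * ε) ^ T := pow_nonneg (by linarith) T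
  have e1 : ((1 - c * ε) ^ T * (ρ * M) ^ 2 + (4 * (2 * (1 + c) * M) * (ρ * M) * q +
      ε * (2 * (1 + 2 * c) * (ρ * M) * (2 * (1 + c) * M) + (2 * (1 + c) * M) ^ 2)) / c) / c =
      M ^ 2 * ((ρ ^ 2 / c) * (1 - c * ε) ^ T + (8 * (1 + c) * ρ / c / c) * q +
        ((4 * (1 + 2 * c) * (1 + c) * ρ + 4 * (1 + c) ^ 2) / c / c) * ε) := by
    field_simp; ring
  have e2 : boostConst c = ρ ^ 2 / c + 8 * (1 + c) * ρ / c / c +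
      (4 * (1 + 2 * c) * (1 + c) * ρ + 4 * (1 + c) ^ 2) / c / c := by
    rw [boostConst, ← hρdef]; ring
  set k1 := ρ ^ 2 / c
  set k2 := 8 * (1 + c) * ρ / c / c
  set k3 := (4 * (1 + 2 * c) * (1 + c) * ρ + 4 * (1 + c) ^ 2) / c / c
  have p1 : 0 ≤ k1 := by positivity
  have p2 : 0 ≤ k2 := by positivity
  have p3 : 0 ≤ k3 := by positivity
  rw [e1, e2, mul_comm _ (M ^ 2), mul_assoc]
  refine mul_le_mul_of_nonneg_left ?_ (sq_nonneg M)
  have := mul_nonneg p1 hq0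
  have := mul_nonneg p1 hε.le
  have := mul_nonneg p2 hθ
  have := mul_nonneg p2 hε.le
  have := mul_nonneg p3 hθ
  have := mul_nonneg p3 hq0
  linarith

end BoostingError

/-! ### Independence of the past and the next round of noise -/

section Independence

variable {Ω : Type*} {mΩ : MeasurableSpace Ω} {P : Measure Ω}

/-- If `m₁` is independent of `m₂` and `m₃` jointly, and these are independent, then `m₃` is
independent of `m₁` and `m₂` jointly. -/
lemma indep_sup_left [IsProbabilityMeasure P] {m₁ m₂ m₃ : MeasurableSpace Ω} (h₁ : m₁ ≤ mΩ)
    (h₂ : m₂ ≤ mΩ) (h₃ : m₃ ≤ mΩ)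
    (h : Indep m₁ (m₂ ⊔ m₃) P) (h' : Indep m₂ m₃ P) : Indep (m₁ ⊔ m₂) m₃ P := by
  set p : Set (Set Ω) := {s | ∃ A B, MeasurableSet[m₁] A ∧ MeasurableSet[m₂] B ∧ s = A ∩ B} with hp
  have hgen : m₁ ⊔ m₂ = MeasurableSpace.generateFrom p := by
    refine le_antisymm (sup_le ?_ ?_) (MeasurableSpace.generateFrom_le ?_)
    · intro A hA
      exact MeasurableSpace.measurableSet_generateFrom
        ⟨A, Set.univ, hA, MeasurableSet.univ, (Set.inter_univ A).symm⟩
    · intro B hB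
      exact MeasurableSpace.measurableSet_generateFrom
        ⟨Set.univ, B, MeasurableSet.univ, hB, (Set.univ_inter B).symm⟩
    · rintro s ⟨A, B, hA, hB, rfl⟩
      exact MeasurableSet.inter (le_sup_left (a := m₁) _ hA) (le_sup_right (a := m₁) _ hB)
  have hpi : IsPiSystem p := by
    rintro s ⟨A, B, hA, hB, rfl⟩ t ⟨A', B', hA', hB', rfl⟩ _
    exact ⟨A ∩ A', B ∩ B', hA.inter hA', hB.inter hB', by
      ext; simp only [Set.mem_inter_iff]; tauto⟩
  refine IndepSets.indep (sup_le h₁ h₂) h₃ hpi (@MeasurableSpace.isPiSystem_measurableSet Ω m₃)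
    hgen (@MeasurableSpace.generateFrom_measurableSet Ω m₃).symm ?_
  rw [IndepSets_iff]
  rintro s C ⟨A, B, hA, hB, rfl⟩ hC
  have hC' : MeasurableSet[m₃] C := hC
  have hBC : MeasurableSet[m₂ ⊔ m₃] (B ∩ C) :=
    MeasurableSet.inter (le_sup_left (a := m₂) _ hB) (le_sup_right (a := m₂) _ hC')
  have e1 := (Indep_iff _ _ _).1 h A (B ∩ C) hA hBC
  have e2 := (Indep_iff _ _ _).1 h' B C hB hC'
  have e3 := (Indep_iff _ _ _).1 h A B hA (le_sup_left (a := m₂) _ hB)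
  rw [Set.inter_assoc, e1, e2, e3, mul_assoc]

variable {d n N : ℕ}

/-- The random numbers of TrainGBDT known before iteration `τ`. -/
def pastSeeds (d n N τ : ℕ) : Set (TrainSeed d n N) :=
  {j | ∀ τ' i s, j = .unif τ' i s → τ' < τ}

/-- The information available before iteration `τ` of TrainGBDT, when the labels depend on `Z` and
on the label noise. -/
abbrev pastOf {α : Type*} [MeasurableSpace α] (Z : Ω → α) (b : TrainSeed d n N → Ω → ℝ) (τ : ℕ) :
    MeasurableSpace Ω :=
  MeasurableSpace.comap Z inferInstance ⊔
    ⨆ j ∈ pastSeeds d n N τ, MeasurableSpace.comap (b j) inferInstance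

lemma comap_le_pastOf {α : Type*} [MeasurableSpace α] (Z : Ω → α) (b : TrainSeed d n N → Ω → ℝ)
    {τ : ℕ} {j : TrainSeed d n N} (hj : j ∈ pastSeeds d n N τ) :
    Measurable[pastOf Z b τ] (b j) :=
  (comap_measurable (b j)).mono (le_sup_of_le_right (le_iSup₂_of_le j hj le_rfl)) le_rfl

lemma measurable_pastOf {α : Type*} [MeasurableSpace α] (Z : Ω → α) (b : TrainSeed d n N → Ω → ℝ)
    (τ : ℕ) : Measurable[pastOf Z b τ] Z :=
  (comap_measurable Z).mono le_sup_left le_rfl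

lemma isUniformNoise_train {δ : ℝ} {b : TrainSeed d n N → Ω → ℝ} (hbm : ∀ j, Measurable (b j))
    (hb : iIndepFun b P) (hb_law : ∀ i, HasLaw (b i) (i.law δ) P) (τ : ℕ) :
    IsUniformNoise P fun i s => b (.unif τ i s) where
  measurable i s := hbm _
  law i s := hb_law (.unif τ i s)
  indep := hb.precomp (g := fun p : ℕ × Split d n => TrainSeed.unif τ p.1 p.2) fun p q h => by
    simpa [Prod.ext_iff] using h

lemma isAdaptedNoise_train [IsProbabilityMeasure P] {δ : ℝ} {α : Type*} [MeasurableSpace α]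
    {Z : Ω → α} (hZ : Measurable Z)
    {b : TrainSeed d n N → Ω → ℝ} (hbm : ∀ j, Measurable (b j))
    (hb : iIndepFun b P) (hb_law : ∀ i, HasLaw (b i) (i.law δ) P)
    (hZb : IndepFun Z (fun ω i => b i ω) P) :
    IsAdaptedNoise P (pastOf Z b) fun τ i s => b (.unif τ i s) where
  le τ := sup_le hZ.comap_le (iSup₂_le fun j _ => (hbm j).comap_le)
  mono τ τ' h := sup_le_sup_left (biSup_mono fun j hj τ₀ i s e => (hj τ₀ i s e).trans_le h) _
  noise τ := isUniformNoise_train hbm hb hb_law τ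
  adapted τ i s := comap_le_pastOf Z b fun τ' i' s' e => by
    cases e; exact Nat.lt_succ_self τ
  indep τ := by
    set J : Set (TrainSeed d n N) := {j | ∃ i s, j = .unif τ i s}
    have hdisj : Disjoint (pastSeeds d n N τ) J := by
      rw [Set.disjoint_left]
      rintro j hj ⟨i, s, rfl⟩
      exact lt_irrefl _ (hj τ i s rfl)
    have hle : ∀ j, MeasurableSpace.comap (b j) inferInstance ≤ mΩ := fun j => (hbm j).comap_le
    have h1 := indep_iSup_of_disjoint hle ((iIndepFun_iff_iIndep _ _ _).1 hb) hdisj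
    have hall : ∀ j, MeasurableSpace.comap (b j) inferInstance ≤
        MeasurableSpace.comap (fun ω i => b i ω) inferInstance := fun j =>
      ((measurable_pi_apply j).comp (comap_measurable fun ω i => b i ω)).comap_le
    have h2 : Indep (MeasurableSpace.comap Z inferInstance)
        ((⨆ j ∈ pastSeeds d n N τ, MeasurableSpace.comap (b j) inferInstance) ⊔
          ⨆ j ∈ J, MeasurableSpace.comap (b j) inferInstance) P :=
      indep_of_indep_of_le_right ((IndepFun_iff_Indep _ _ _).1 hZb)
        (sup_le (iSup₂_le fun j _ => hall j) (iSup₂_le fun j _ => hall j))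
    refine indep_of_indep_of_le_right (indep_sup_left hZ.comap_le (iSup₂_le fun j _ => hle j)
      (iSup₂_le fun j _ => hle j) h2 h1) ?_
    exact iSup₂_le fun i s => le_iSup₂_of_le (TrainSeed.unif τ i s) ⟨i, s, rfl⟩ le_rfl

end Independence

/-! ### The boosting limit -/

section BoostingLimit

variable {d n N : ℕ} {Ω : Type*} {mΩ : MeasurableSpace Ω} {P : Measure Ω} [IsProbabilityMeasure P]

lemma BoostingLimit.eventually {ε β : ℕ → ℝ} {T : ℕ → ℕ} (h : BoostingLimit ε β T) {c : ℝ}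
    (hc : 0 < c) : ∀ᶠ k in atTop, 0 < ε k ∧ ε k * (1 + 2 * c) ≤ 1 ∧ 0 < β k := by
  have h1 := tendsto_nhdsWithin_iff.1 h.rate
  have h2 : ∀ᶠ k in atTop, ε k < 1 / (1 + 2 * c) :=
    h1.1.eventually_lt_const (by positivity)
  filter_upwards [h1.2, h2, h.strength.eventually_gt_atTop 0] with k hk hk2 hk3
  exact ⟨hk, by rw [lt_div_iff₀ (by positivity)] at hk2; exact hk2.le, hk3⟩

lemma tendsto_boostBound {ε β : ℕ → ℝ} {T : ℕ → ℕ} (h : BoostingLimit ε β T) {c : ℝ}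
    (hc : 0 < c) (d n m : ℕ) {K : ℝ} (hK : 0 < K) (C : ℝ) :
    Tendsto (fun k => C * ((1 - c * ε k) ^ T k + gapBound d n m (K / β k) + ε k)) atTop (𝓝 0) := by
  have h1 := tendsto_nhdsWithin_iff.1 h.rate
  have hpow : Tendsto (fun k => (1 - c * ε k) ^ T k) atTop (𝓝 0) := by
    have hexp : Tendsto (fun k => Real.exp (-(c * (ε k * T k)))) atTop (𝓝 0) :=
      Real.tendsto_exp_neg_atTop_nhds_zero.comp (h.time.const_mul_atTop hc)
    refine squeeze_zero' ?_ ?_ hexp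
    · filter_upwards [h.eventually hc] with k ⟨hk, hk2, _⟩
      exact pow_nonneg (by nlinarith) _
    · filter_upwards [h.eventually hc] with k ⟨hk, hk2, _⟩
      have : Real.exp (-(c * (ε k * T k))) = Real.exp (-(c * ε k)) ^ T k := by
        rw [← Real.exp_nat_mul]; congr 1; ring
      rw [this]
      refine pow_le_pow_left₀ (by nlinarith) ?_ _
      linarith [Real.add_one_le_exp (-(c * ε k))]
  have hgap : Tendsto (fun k => gapBound d n m (K / β k)) atTop (𝓝 0) := by
    refine (tendsto_gapBound d n m).comp (tendsto_nhdsWithin_iff.2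
      ⟨tendsto_const_nhds.div_atTop h.strength, ?_⟩)
    filter_upwards [h.strength.eventually_gt_atTop 0] with k hk
    exact div_pos hK hk
  simpa using ((hpow.add hgap).add h1.1).const_mul C

/-- On labels bounded by `M`, boosting converges in mean square, uniformly over points and over the
joint distribution of labels and noise. -/
lemma eventually_lintegral_boostErr_le_of_bounded (hN : 1 ≤ N) (S : TreeSpec d n N) {lam : ℝ}
    (hlam : 0 < lam) {ε β : ℕ → ℝ} {T : ℕ → ℕ} (h : BoostingLimit ε β T) {M : ℝ} (hM : 0 < M)
    {η : ℝ≥0∞} (hη : η ≠ 0) :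
    ∀ᶠ k in atTop, ∀ (past : ℕ → MeasurableSpace Ω) (u : ℕ → ℕ → Split d n → Ω → ℝ)
      (_ : IsAdaptedNoise P past u) (Y : Ω → Fin N → ℝ)
      (_ : ∀ i, Measurable[past 0] fun ω => Y ω i) (_ : ∀ ω, ∑ i, Y ω i ^ 2 ≤ M ^ 2)
      (z : EuclideanSpace ℝ (Fin d)),
      ∫⁻ ω, ‖boostErr S (ε k) (β k) lam (Y ω) (fun τ i s => u τ i s ω) (T k) z‖ₑ ^ 2 ∂P ≤ η := by
  have hc : 0 < lam / N := by positivity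
  have hK : 0 < 2 * (1 + boostRadius (lam / N) ^ 2) * M ^ 2 := by positivity
  have hlim := ENNReal.tendsto_ofReal (tendsto_boostBound h hc d n S.depth hK
    (boostConst (lam / N) * M ^ 2))
  rw [ENNReal.ofReal_zero] at hlim
  have hlt := hlim.eventually_le_const (pos_iff_ne_zero.2 hη)
  filter_upwards [hlt, h.eventually hc] with k hk ⟨hε, hsmall, hβ⟩ past u hu Y hYm hY z
  have hm : Measurable fun ω =>
      boostErr S (ε k) (β k) lam (Y ω) (fun τ i s => u τ i s ω) (T k) z :=
    measurable_boostErr S (ε k) (β k) lam (fun i => (hYm i).mono (hu.le 0) le_rfl)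
      (fun τ _ i s => (hu.noise τ).measurable i s) z
  have hbd := fun ω =>
    boostErr_sq_le hN S (β k) hlam hε hsmall (Y ω) (fun τ i s => u τ i s ω) (T k) z
  have hint : Integrable (fun ω =>
      boostErr S (ε k) (β k) lam (Y ω) (fun τ i s => u τ i s ω) (T k) z ^ 2) P :=
    Integrable.of_bound (hm.pow_const 2).aestronglyMeasurable
      (boostRadius (lam / N) ^ 2 / (lam / N) * M ^ 2) (Eventually.of_forall fun ω => by
        rw [Real.norm_of_nonneg (sq_nonneg _)]
        exact (hbd ω).trans (mul_le_mul_of_nonneg_left (hY ω) (by positivity)))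
  refine le_trans ?_ hk
  have heq : ∀ x : ℝ, ‖x‖ₑ ^ 2 = ENNReal.ofReal (x ^ 2) := fun x => by
    rw [Real.enorm_eq_ofReal_abs, ← ENNReal.ofReal_pow (abs_nonneg x), sq_abs]
  simp only [heq]
  rw [← ofReal_integral_eq_lintegral_ofReal hint (Eventually.of_forall fun _ => sq_nonneg _)]
  exact ENNReal.ofReal_le_ofReal (integral_boostErr_sq_le hN S hlam hε hsmall hβ hu hM.le hYm hY
    (T k) z)

/-- Labels of size larger than `M` are replaced by `0`. -/
noncomputable def truncateLabels (M : ℝ) (Y : Fin N → ℝ) : Fin N → ℝ :=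
  open Classical in if ∑ i, Y i ^ 2 ≤ M ^ 2 then Y else 0

lemma sum_sq_truncateLabels_le (M : ℝ) (Y : Fin N → ℝ) :
    ∑ i, truncateLabels M Y i ^ 2 ≤ M ^ 2 := by
  unfold truncateLabels
  split_ifs with h
  · exact h
  · simpa using sq_nonneg M

lemma truncateLabels_eq_self {M : ℝ} {Y : Fin N → ℝ} (h : ∑ i, Y i ^ 2 ≤ M ^ 2) :
    truncateLabels M Y = Y := if_pos h

lemma measurable_truncateLabels {m : MeasurableSpace Ω} (M : ℝ) {Y : Ω → Fin N → ℝ}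
    (hY : ∀ i, Measurable fun ω => Y ω i) (i : Fin N) :
    Measurable fun ω => truncateLabels M (Y ω) i := by
  classical
  have h : MeasurableSet {ω | ∑ i, Y ω i ^ 2 ≤ M ^ 2} :=
    measurableSet_le (by fun_prop) measurable_const
  have : (fun ω => truncateLabels M (Y ω) i) =
      {ω | ∑ i, Y ω i ^ 2 ≤ M ^ 2}.indicator fun ω => Y ω i := by
    funext ω
    by_cases hω : ∑ i, Y ω i ^ 2 ≤ M ^ 2
    · rw [truncateLabels_eq_self hω, Set.indicator_of_mem (by simpa using hω)]
    · rw [truncateLabels, if_neg hω, Set.indicator_of_notMem (by simpa using hω)]; rfl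
  rw [this]
  exact (hY i).indicator h

/-- Convergence of boosting in mean square, uniformly over points, for square integrable labels. -/
lemma eventually_lintegral_boostErr_le (hN : 1 ≤ N) (S : TreeSpec d n N) {lam : ℝ}
    (hlam : 0 < lam) {ε β : ℕ → ℝ} {T : ℕ → ℕ} (h : BoostingLimit ε β T)
    {past : ℕ → MeasurableSpace Ω} {u : ℕ → ℕ → Split d n → Ω → ℝ} (hu : IsAdaptedNoise P past u)
    {Y : Ω → Fin N → ℝ} (hYm : ∀ i, Measurable[past 0] fun ω => Y ω i)
    (hY2 : ∀ i, MemLp (fun ω => Y ω i) 2 P) {η : ℝ≥0∞} (hη : η ≠ 0) :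
    ∀ᶠ k in atTop, ∀ z,
      ∫⁻ ω, ‖boostErr S (ε k) (β k) lam (Y ω) (fun τ i s => u τ i s ω) (T k) z‖ₑ ^ 2 ∂P ≤ η := by
  classical
  have hc : 0 < lam / N := by positivity
  have hYm' : ∀ i, Measurable fun ω => Y ω i := fun i => (hYm i).mono (hu.le 0) le_rfl
  set g : Ω → ℝ≥0∞ := fun ω =>
    ENNReal.ofReal (boostRadius (lam / N) ^ 2 / (lam / N) * ∑ i, Y ω i ^ 2) with hg
  have hgm : Measurable g := by fun_prop
  have hgfin : ∫⁻ ω, g ω ∂P ≠ ∞ := by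
    have : Integrable (fun ω => boostRadius (lam / N) ^ 2 / (lam / N) * ∑ i, Y ω i ^ 2) P :=
      (integrable_finsetSum _ fun i _ => (hY2 i).integrable_sq).const_mul _
    exact this.lintegral_lt_top.ne
  have hset : ∀ M : ℝ, MeasurableSet {ω | M ^ 2 < ∑ i, Y ω i ^ 2} := fun M =>
    measurableSet_lt measurable_const (by fun_prop)
  -- the labels larger than `M` contribute little
  have htail : Tendsto (fun M : ℕ => ∫⁻ ω, {ω | (M : ℝ) ^ 2 < ∑ i, Y ω i ^ 2}.indicator g ω ∂P)
      atTop (𝓝 0) := by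
    have := tendsto_lintegral_of_dominated_convergence (μ := P) g
      (F := fun M : ℕ => {ω | (M : ℝ) ^ 2 < ∑ i, Y ω i ^ 2}.indicator g) (f := fun _ => 0)
      (fun M => hgm.indicator (hset M))
      (fun M => Eventually.of_forall (Set.indicator_le_self _ g)) hgfin
      (Eventually.of_forall fun ω => ?_)
    · simpa using this
    · refine tendsto_const_nhds.congr' ?_
      have h1 : Tendsto (fun M : ℕ => (M : ℝ) ^ 2) atTop atTop :=
        (tendsto_pow_atTop two_ne_zero).comp tendsto_natCast_atTop_atTop
      filter_upwards [h1.eventually_ge_atTop (∑ i, Y ω i ^ 2)] with M hM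
      have hnot : ω ∉ {ω | (M : ℝ) ^ 2 < ∑ i, Y ω i ^ 2} := by simpa using hM
      exact (Set.indicator_of_notMem hnot g).symm
  have hη2 : η / 2 ≠ 0 := (ENNReal.half_pos hη).ne'
  obtain ⟨M, hM1, hM2⟩ := ((eventually_gt_atTop 0).and
    (htail.eventually_le_const (pos_iff_ne_zero.2 hη2))).exists
  have hMpos : (0 : ℝ) < M := by exact_mod_cast hM1
  filter_upwards [eventually_lintegral_boostErr_le_of_bounded (Ω := Ω) (P := P) hN S hlam h
    hMpos hη2, h.eventually hc] with k hk ⟨hε, hsmall, hβ⟩ z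
  have h1 := hk past u hu (fun ω => truncateLabels M (Y ω)) (measurable_truncateLabels M hYm)
    (fun ω => sum_sq_truncateLabels_le M _) z
  calc ∫⁻ ω, ‖boostErr S (ε k) (β k) lam (Y ω) (fun τ i s => u τ i s ω) (T k) z‖ₑ ^ 2 ∂P
      ≤ ∫⁻ ω, (‖boostErr S (ε k) (β k) lam (truncateLabels M (Y ω))
          (fun τ i s => u τ i s ω) (T k) z‖ₑ ^ 2 +
          {ω | (M : ℝ) ^ 2 < ∑ i, Y ω i ^ 2}.indicator g ω) ∂P := by
        refine lintegral_mono fun ω => ?_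
        by_cases hω : ∑ i, Y ω i ^ 2 ≤ (M : ℝ) ^ 2
        · dsimp only
          rw [truncateLabels_eq_self hω]; exact le_self_add
        · dsimp only
          rw [Set.indicator_of_mem (by simpa using hω)]
          refine le_add_left ?_
          rw [Real.enorm_eq_ofReal_abs, ← ENNReal.ofReal_pow (abs_nonneg _), sq_abs]
          exact ENNReal.ofReal_le_ofReal (boostErr_sq_le hN S (β k) hlam hε hsmall _ _ _ z)
    _ = _ := lintegral_add_right _ (hgm.indicator (hset M))
    _ ≤ η / 2 + η / 2 := add_le_add h1 hM2
    _ = η := ENNReal.add_halves η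

end BoostingLimit

/-! ### Limits of boosting with fixed parameters -/

section Limits

variable {d n N : ℕ} {Ω : Type*} {mΩ : MeasurableSpace Ω}

/-- Convergence of integrals to `0` implies almost sure convergence along a subsequence. -/
lemma exists_subseq_ae_tendsto_zero {α : Type*} {mα : MeasurableSpace α} {μ : Measure α}
    {G : ℕ → α → ℝ≥0∞} (hG : ∀ k, AEMeasurable (G k) μ)
    (h : Tendsto (fun k => ∫⁻ x, G k x ∂μ) atTop (𝓝 0)) :
    ∃ ns : ℕ → ℕ, StrictMono ns ∧ ∀ᵐ x ∂μ, Tendsto (fun k => G (ns k) x) atTop (𝓝 0) := by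
  -- along a subsequence the integrals are summable
  obtain ⟨w, hw0, hw⟩ := ENNReal.exists_pos_sum_of_countable' (ε := 1) one_ne_zero ℕ
  obtain ⟨ns, hns, hle⟩ := extraction_forall_of_eventually
    (P := fun j k => ∫⁻ x, G k x ∂μ ≤ w j) fun j => h.eventually_le_const (hw0 j)
  refine ⟨ns, hns, ?_⟩
  have hfin : ∫⁻ x, ∑' j, G (ns j) x ∂μ ≠ ∞ := by
    rw [lintegral_tsum fun j => hG (ns j)]
    exact ((ENNReal.tsum_le_tsum hle).trans_lt (hw.trans ENNReal.one_lt_top)).ne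
  filter_upwards [ae_lt_top' (AEMeasurable.tsum fun j => hG (ns j)) hfin] with x hx
  exact ENNReal.tendsto_atTop_zero_of_tsum_ne_top hx.ne

/-- A point in a given leaf of the full tree, if there is one. -/
noncomputable def leafPoint (S : TreeSpec d n N) (ℓ : Finset (Split d n)) :
    EuclideanSpace ℝ (Fin d) :=
  open Classical in if h : ∃ z, leafOf S Finset.univ z = ℓ then h.choose else 0

lemma leafOf_leafPoint (S : TreeSpec d n N) (z : EuclideanSpace ℝ (Fin d)) :
    leafOf S Finset.univ (leafPoint S (leafOf S Finset.univ z)) = leafOf S Finset.univ z := by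
  have h : ∃ z', leafOf S Finset.univ z' = leafOf S Finset.univ z := ⟨z, rfl⟩
  rw [leafPoint, dif_pos h]
  exact h.choose_spec

/-- A random function that is constant on the leaves of the full tree is jointly measurable. -/
lemma measurable_uncurry_of_leaf (S : TreeSpec d n N) {f : EuclideanSpace ℝ (Fin d) → Ω → ℝ}
    (hf : ∀ z, Measurable (f z))
    (hc : ∀ z z', leafOf S Finset.univ z = leafOf S Finset.univ z' → f z = f z') :
    Measurable (Function.uncurry f) := by
  have : Function.uncurry f = fun p : EuclideanSpace ℝ (Fin d) × Ω =>
      f (leafPoint S (leafOf S Finset.univ p.1)) p.2 := by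
    funext p
    exact congrFun (hc _ _ (leafOf_leafPoint S p.1).symm) p.2
  rw [this]
  exact measurable_select (t := fun p : EuclideanSpace ℝ (Fin d) × Ω => leafOf S Finset.univ p.1)
    (fun ℓ => measurable_fst (measurableSet_leafOf S Finset.univ ℓ))
    (F := fun ℓ p => f (leafPoint S ℓ) p.2) fun ℓ => (hf _).comp measurable_snd

variable {P : Measure Ω} [IsProbabilityMeasure P]

/-- Fixed parameters: wherever boosting converges along a subsequence, its limit is invariant
under fitting any single tree of full size, since each such tree keeps occurring with a
probability bounded from below. -/
lemma ae_predict_eq_of_tendsto (S : TreeSpec d n N) {ε β lam : ℝ} (hε : 0 < ε) (hβ : 0 < β)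
    {past : ℕ → MeasurableSpace Ω} {u : ℕ → ℕ → Split d n → Ω → ℝ} (hu : IsAdaptedNoise P past u)
    {Y : Ω → Fin N → ℝ} (hYm : ∀ i, Measurable[past 0] fun ω => Y ω i)
    {f' : EuclideanSpace ℝ (Fin d) → Ω → ℝ} {ns : ℕ → ℕ} (z : EuclideanSpace ℝ (Fin d))
    (hx : ∀ᵐ ω ∂P, ∀ i, Tendsto (fun k => trainGBDT S ε β lam (Y ω) (fun τ i s => u τ i s ω)
      (ns k) (S.input i)) atTop (𝓝 (f' (S.input i) ω)))
    (hz : ∀ᵐ ω ∂P, Tendsto (fun k => trainGBDT S ε β lam (Y ω) (fun τ i s => u τ i s ω)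
      (ns k) z) atTop (𝓝 (f' z ω)))
    (hz' : ∀ᵐ ω ∂P, Tendsto (fun k => trainGBDT S ε β lam (Y ω) (fun τ i s => u τ i s ω)
      (ns k + 1) z) atTop (𝓝 (f' z ω)))
    {ν : Finset (Split d n)} (hν : ν.card = min S.depth (n * d)) :
    ∀ᵐ ω ∂P, predict S ν (fun i => Y ω i - f' (S.input i) ω) z = lam / N * f' z ω := by
  set f : ℕ → EuclideanSpace ℝ (Fin d) → Ω → ℝ := fun T z ω =>
    trainGBDT S ε β lam (Y ω) (fun τ i s => u τ i s ω) T z with hf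
  set r : ℕ → Ω → Fin N → ℝ := fun T ω =>
    residual S ε β lam (Y ω) (fun τ i s => u τ i s ω) T with hr
  set X : ℕ → Ω → ℝ := fun T ω => predict S ν (r T ω) z - lam / N * f T z ω with hX
  have hfm : ∀ T z, Measurable[past T] (f T z) := fun T z =>
    measurable_trainGBDT S ε β lam (fun i => (hYm i).mono (hu.mono (Nat.zero_le T)) le_rfl)
      (fun τ hτ i s => (hu.adapted τ i s).mono (hu.mono hτ) le_rfl) z
  have hrm : ∀ T i, Measurable[past T] fun ω => r T ω i := fun T i =>
    ((hYm i).mono (hu.mono (Nat.zero_le T)) le_rfl).sub (hfm T _)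
  have hXm : ∀ T, Measurable[past T] (X T) := fun T =>
    (measurable_predict S ν (hrm T) z).sub ((hfm T z).const_mul _)
  set A : ℝ → ℝ → ℕ → Set Ω := fun κ M T => {ω | κ ≤ |X T ω|} ∩ {ω | ∑ i, r T ω i ^ 2 ≤ M} with hA
  have hAm : ∀ κ M T, MeasurableSet[past T] (A κ M T) := fun κ M T => by
    have h1 : Measurable[past T] fun ω => ∑ i, r T ω i ^ 2 :=
      Finset.measurable_sum _ fun i _ => (hrm T i).pow_const 2
    have h2 : Measurable[past T] fun ω => |X T ω| := continuous_abs.measurable.comp (hXm T)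
    exact (measurableSet_le measurable_const h2).inter (measurableSet_le h1 measurable_const)
  -- with positive probability the tree is `ν`, whatever happened before
  have hstep : ∀ M, ∃ p : ℝ, 0 < p ∧ ∀ κ T, P.real (A κ M T) * p ≤
      P.real {ω | ε * κ ≤ ‖f (T + 1) z ω - f T z ω‖} := by
    intro M
    obtain ⟨I, hIm, hI0, hI⟩ := exists_dominant_ranges hβ M ν
    refine ⟨∏ q ∈ Finset.range S.depth ×ˢ (Finset.univ : Finset (Split d n)),
      uniformLaw.real (I q.2),
      Finset.prod_pos fun q _ => ENNReal.toReal_pos (hI0 _).ne' (measure_ne_top _ _), fun κ T => ?_⟩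
    set D : Set Ω := ⋂ q ∈ Finset.range S.depth ×ˢ (Finset.univ : Finset (Split d n)),
      u T q.1 q.2 ⁻¹' I q.2 with hD
    have hDm : MeasurableSet[⨆ i, ⨆ s, MeasurableSpace.comap (u T i s) inferInstance] D :=
      Finset.measurableSet_biInter _ fun q _ =>
        (le_iSup₂_of_le (f := fun i s => MeasurableSpace.comap (u T i s) inferInstance)
          q.1 q.2 le_rfl) _ ⟨I q.2, hIm _, rfl⟩
    have hPD : P.real D = ∏ q ∈ Finset.range S.depth ×ˢ (Finset.univ : Finset (Split d n)),
        uniformLaw.real (I q.2) := by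
      have := (hu.noise T).indep.measure_inter_preimage_eq_mul
        (Finset.range S.depth ×ˢ (Finset.univ : Finset (Split d n)))
        (sets := fun q => I q.2) fun q _ => hIm _
      rw [measureReal_def, hD, this, ENNReal.toReal_prod]
      refine Finset.prod_congr rfl fun q _ => ?_
      exact ((hu.noise T).law q.1 q.2).measureReal_eq (hIm q.2)
    have hPAD : P.real (A κ M T ∩ D) = P.real (A κ M T) * P.real D := by
      rw [measureReal_def, (Indep_iff _ _ _).1 (hu.indep T) _ _ (hAm κ M T) hDm,
        ENNReal.toReal_mul]
      rfl
    rw [← hPD, ← hPAD]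
    refine measureReal_mono fun ω hω => ?_
    obtain ⟨⟨hω1, hω2⟩, hω3⟩ := hω
    have htree : sampleTree S β (r T ω) (fun i s => u T i s ω) = ν := by
      refine growTree_eq_of_dominant S (fun ν => ⟨(score_mem_Icc S ν _).1,
        (score_mem_Icc S ν _).2.trans hω2⟩) hν fun i hi s hs s' hs' => hI s hs s' hs' _ ?_ _ ?_
      · exact Set.mem_iInter₂.1 hω3 (i, s) (by simpa using hi)
      · exact Set.mem_iInter₂.1 hω3 (i, s') (by simpa using hi)
    have hsucc : f (T + 1) z ω - f T z ω = ε * X T ω := by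
      have : f (T + 1) z ω = (1 - lam * ε / N) * f T z ω +
          ε * predict S (sampleTree S β (r T ω) fun i s => u T i s ω) (r T ω) z :=
        trainGBDT_succ S ε β lam (Y ω) _ T z
      rw [this, htree, hX]
      ring
    change ε * κ ≤ ‖f (T + 1) z ω - f T z ω‖
    rw [hsucc, norm_mul, Real.norm_of_nonneg hε.le]
    exact mul_le_mul_of_nonneg_left hω1 hε.le
  have hdiff : ∀ κ > 0, Tendsto (fun k => P.real {ω | κ ≤ ‖f (ns k + 1) z ω - f (ns k) z ω‖}) atTop
      (𝓝 0) := by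
    have h1 : TendstoInMeasure P (fun k ω => f (ns k + 1) z ω - f (ns k) z ω) atTop fun _ => 0 := by
      refine tendstoInMeasure_of_tendsto_ae (fun k =>
        (((hfm _ z).mono (hu.le _) le_rfl).sub
          ((hfm _ z).mono (hu.le _) le_rfl)).aestronglyMeasurable) ?_
      filter_upwards [hz, hz'] with ω h1 h2
      simpa using h2.sub h1
    rw [tendstoInMeasure_iff_measureReal_norm] at h1
    simpa using h1
  have hAlim : ∀ κ > 0, ∀ M, Tendsto (fun k => P.real (A κ M (ns k))) atTop (𝓝 0) := by
    intro κ hκ M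
    obtain ⟨p, hp, hle⟩ := hstep M
    have h1 := (hdiff (ε * κ) (mul_pos hε hκ)).div_const p
    rw [zero_div] at h1
    exact squeeze_zero (fun k => measureReal_nonneg)
      (fun k => (le_div_iff₀ hp).2 (hle κ (ns k))) h1
  set X' : Ω → ℝ := fun ω => predict S ν (fun i => Y ω i - f' (S.input i) ω) z -
    lam / N * f' z ω with hX'
  -- in the limit the increment vanishes on every event of bounded residual
  have key : ∀ κ > 0, ∀ M, ∀ᵐ ω ∂P, |X' ω| ≤ κ ∨ M ≤ ∑ i, (Y ω i - f' (S.input i) ω) ^ 2 := by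
    intro κ hκ M
    have h1 : Tendsto (fun k => ∫⁻ ω, (A κ M (ns k)).indicator (fun _ => (1 : ℝ≥0∞)) ω ∂P) atTop
        (𝓝 0) := by
      have h2 := ENNReal.tendsto_ofReal (hAlim κ hκ M)
      rw [ENNReal.ofReal_zero] at h2
      refine h2.congr fun k => ?_
      rw [lintegral_indicator_const (hu.le _ _ (hAm κ M (ns k))), one_mul, ofReal_measureReal]
    obtain ⟨ms, hms, hae⟩ := exists_subseq_ae_tendsto_zero (fun k =>
      (measurable_const.indicator (hu.le _ _ (hAm κ M (ns k)))).aemeasurable) h1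
    filter_upwards [hae, hx, hz] with ω h3 h4 h5
    by_contra hcon
    push Not at hcon
    obtain ⟨hc1, hc2⟩ := hcon
    have hrl : ∀ i, Tendsto (fun k => r (ns k) ω i) atTop (𝓝 (Y ω i - f' (S.input i) ω)) :=
      fun i => tendsto_const_nhds.sub (h4 i)
    have hQ : Tendsto (fun k => ∑ i, r (ns k) ω i ^ 2) atTop
        (𝓝 (∑ i, (Y ω i - f' (S.input i) ω) ^ 2)) :=
      tendsto_finsetSum _ fun i _ => (hrl i).pow 2
    have hXl : Tendsto (fun k => X (ns k) ω) atTop (𝓝 (X' ω)) := by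
      refine Tendsto.sub ?_ (h5.const_mul _)
      refine tendsto_finsetSum _ fun ℓ _ => Tendsto.const_mul _ ?_
      exact (tendsto_finsetSum _ fun i _ => (hrl i).const_mul _).div_const _
    have hev : ∀ᶠ k in atTop, ω ∈ A κ M (ns k) := by
      filter_upwards [hXl.abs.eventually_const_lt hc1, hQ.eventually_lt_const hc2] with k hk1 hk2
      exact ⟨hk1.le, hk2.le⟩
    have hev2 := h3.eventually_lt_const one_pos
    obtain ⟨k, hk1, hk2⟩ := ((hms.tendsto_atTop.eventually hev).and hev2).exists
    rw [Set.indicator_of_mem hk1] at hk2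
    exact lt_irrefl _ hk2
  have key2 : ∀ᵐ ω ∂P, ∀ (j l : ℕ), |X' ω| ≤ 1 / ((j : ℝ) + 1) ∨
      (l : ℝ) ≤ ∑ i, (Y ω i - f' (S.input i) ω) ^ 2 :=
    ae_all_iff.2 fun j => ae_all_iff.2 fun l => key _ (by positivity) _
  filter_upwards [key2] with ω hω
  obtain ⟨l, hl⟩ := exists_nat_gt (∑ i, (Y ω i - f' (S.input i) ω) ^ 2)
  have h0 : |X' ω| ≤ 0 := ge_of_tendsto' tendsto_one_div_add_atTop_nhds_zero_nat
    fun j => (hω j l).resolve_right (not_le.2 hl)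
  exact sub_eq_zero.1 (abs_nonpos_iff.1 h0)

/-- Fixed parameters: wherever boosting converges along a subsequence, its limit is the regression
function. -/
lemma ae_eq_posteriorMean_of_tendsto (hN : 1 ≤ N) (S : TreeSpec d n N) {ε β lam : ℝ} (hε : 0 < ε)
    (hβ : 0 < β) (hlam : 0 < lam)
    {past : ℕ → MeasurableSpace Ω} {u : ℕ → ℕ → Split d n → Ω → ℝ} (hu : IsAdaptedNoise P past u)
    {Y : Ω → Fin N → ℝ} (hYm : ∀ i, Measurable[past 0] fun ω => Y ω i)
    {f' : EuclideanSpace ℝ (Fin d) → Ω → ℝ} {ns : ℕ → ℕ} (z : EuclideanSpace ℝ (Fin d))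
    (hx : ∀ᵐ ω ∂P, ∀ i, Tendsto (fun k => trainGBDT S ε β lam (Y ω) (fun τ i s => u τ i s ω)
      (ns k) (S.input i)) atTop (𝓝 (f' (S.input i) ω)))
    (hx' : ∀ᵐ ω ∂P, ∀ i, Tendsto (fun k => trainGBDT S ε β lam (Y ω) (fun τ i s => u τ i s ω)
      (ns k + 1) (S.input i)) atTop (𝓝 (f' (S.input i) ω)))
    (hz : ∀ᵐ ω ∂P, Tendsto (fun k => trainGBDT S ε β lam (Y ω) (fun τ i s => u τ i s ω)
      (ns k) z) atTop (𝓝 (f' z ω)))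
    (hz' : ∀ᵐ ω ∂P, Tendsto (fun k => trainGBDT S ε β lam (Y ω) (fun τ i s => u τ i s ω)
      (ns k + 1) z) atTop (𝓝 (f' z ω))) :
    ∀ᵐ ω ∂P, f' z ω = posteriorMean S lam (Y ω) z := by
  have hfix : ∀ w, (∀ᵐ ω ∂P, ∀ ν : Finset (Split d n), ν.card = min S.depth (n * d) →
      predict S ν (fun i => Y ω i - f' (S.input i) ω) w = lam / N * f' w ω) →
      ∀ᵐ ω ∂P, ∑ ν, stationary S ν * predict S ν (Y ω - fun i => f' (S.input i) ω) w =
        lam / N * f' w ω := by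
    intro w h
    filter_upwards [h] with ω hω
    rw [← one_mul (lam / N * f' w ω), ← sum_stationary S, Finset.sum_mul]
    refine Finset.sum_congr rfl fun ν _ => ?_
    by_cases hν : ν.card = min S.depth (n * d)
    · rw [← hω ν hν]; rfl
    · rw [stationary, if_neg hν]; simp
  have h1 := hfix z (ae_all_iff.2 fun ν => eventually_imp_distrib_left.2 fun hν =>
    ae_predict_eq_of_tendsto S hε hβ hu hYm z hx hz hz' hν)
  have h2 : ∀ᵐ ω ∂P, ∀ i, ∑ ν, stationary S ν *
      predict S ν (Y ω - fun i => f' (S.input i) ω) (S.input i) = lam / N * f' (S.input i) ω :=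
    ae_all_iff.2 fun i => hfix _ (ae_all_iff.2 fun ν => eventually_imp_distrib_left.2 fun hν =>
      ae_predict_eq_of_tendsto S hε hβ hu hYm _ hx (hx.mono fun ω h => h i)
        (hx'.mono fun ω h => h i) hν)
  filter_upwards [h1, h2] with ω h3 h4
  exact eq_posteriorMean_of_stationary hN S hlam h4 h3

end Limits

/-! ### Mean square limits of boosting -/

section Modes

variable {d n N : ℕ} {Ω : Type*} {mΩ : MeasurableSpace Ω} {P : Measure Ω} [IsProbabilityMeasure P]

lemma measurable_uncurry_trainGBDT (S : TreeSpec d n N) (ε β lam : ℝ) {Y : Ω → Fin N → ℝ}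
    (hY : ∀ i, Measurable fun ω => Y ω i) {u : ℕ → ℕ → Split d n → Ω → ℝ}
    (hu : ∀ τ i s, Measurable (u τ i s)) (T : ℕ) :
    Measurable (Function.uncurry fun z ω =>
      trainGBDT S ε β lam (Y ω) (fun τ i s => u τ i s ω) T z) :=
  measurable_uncurry_of_leaf S
    (fun z => measurable_trainGBDT S ε β lam hY (fun τ _ i s => hu τ i s) z)
    fun _ _ h => funext fun _ => trainGBDT_congr S _ _ _ _ _ _ h

lemma measurable_uncurry_posteriorMean (S : TreeSpec d n N) (lam : ℝ) {Y : Ω → Fin N → ℝ}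
    (hY : ∀ i, Measurable fun ω => Y ω i) :
    Measurable (Function.uncurry fun z ω => posteriorMean S lam (Y ω) z) :=
  measurable_uncurry_of_leaf S (fun z => measurable_posteriorMean S lam hY z)
    fun _ _ h => funext fun _ => by
      simp only [posteriorMean_eq_krigingWeight, krigingWeight_congr S lam h]

lemma tendstoL2At_trainGBDT (hN : 1 ≤ N) (S : TreeSpec d n N) {lam : ℝ}
    (hlam : 0 < lam) {ε β : ℕ → ℝ} {T : ℕ → ℕ} (h : BoostingLimit ε β T)
    {past : ℕ → MeasurableSpace Ω} {u : ℕ → ℕ → Split d n → Ω → ℝ} (hu : IsAdaptedNoise P past u)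
    {Y : Ω → Fin N → ℝ} (hYm : ∀ i, Measurable[past 0] fun ω => Y ω i)
    (hY2 : ∀ i, MemLp (fun ω => Y ω i) 2 P) (z : EuclideanSpace ℝ (Fin d)) :
    TendstoL2At P (fun k z ω => trainGBDT S (ε k) (β k) lam (Y ω) (fun τ i s => u τ i s ω) (T k) z)
      (fun z ω => posteriorMean S lam (Y ω) z) z := by
  refine ENNReal.tendsto_nhds_zero.2 fun η hη => ?_
  filter_upwards [eventually_lintegral_boostErr_le hN S hlam h hu hYm hY2 hη.ne'] with k hk
  exact hk z

lemma tendstoL2_trainGBDT (hN : 1 ≤ N) (S : TreeSpec d n N)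
    (ρ : Measure (EuclideanSpace ℝ (Fin d))) [IsProbabilityMeasure ρ] {lam : ℝ}
    (hlam : 0 < lam) {ε β : ℕ → ℝ} {T : ℕ → ℕ} (h : BoostingLimit ε β T)
    {past : ℕ → MeasurableSpace Ω} {u : ℕ → ℕ → Split d n → Ω → ℝ} (hu : IsAdaptedNoise P past u)
    {Y : Ω → Fin N → ℝ} (hYm : ∀ i, Measurable[past 0] fun ω => Y ω i)
    (hY2 : ∀ i, MemLp (fun ω => Y ω i) 2 P) :
    TendstoL2 ρ P (fun k z ω => trainGBDT S (ε k) (β k) lam (Y ω) (fun τ i s => u τ i s ω) (T k) z)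
      (fun z ω => posteriorMean S lam (Y ω) z) := by
  refine ENNReal.tendsto_nhds_zero.2 fun η hη => ?_
  have hYm' : ∀ i, Measurable fun ω => Y ω i := fun i => (hYm i).mono (hu.le 0) le_rfl
  filter_upwards [eventually_lintegral_boostErr_le hN S hlam h hu hYm hY2 hη.ne'] with k hk
  have hm : Measurable (Function.uncurry fun ω z =>
      ‖trainGBDT S (ε k) (β k) lam (Y ω) (fun τ i s => u τ i s ω) (T k) z -
        posteriorMean S lam (Y ω) z‖ₑ ^ 2) :=
    (((measurable_uncurry_trainGBDT S (ε k) (β k) lam hYm'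
      (fun τ i s => (hu.noise τ).measurable i s) (T k)).sub
      (measurable_uncurry_posteriorMean S lam hYm')).enorm.pow_const 2).comp measurable_swap
  rw [lintegral_lintegral_swap hm.aemeasurable]
  exact (lintegral_mono hk).trans (by simp)

lemma tendsto_of_enorm_sub_sq_le {x : ℕ → ℝ} {l : ℝ} {g : ℕ → ℝ≥0∞}
    (hg : Tendsto g atTop (𝓝 0)) (hle : ∀ k, ‖x k - l‖ₑ ^ 2 ≤ g k) : Tendsto x atTop (𝓝 l) := by
  have h4 := tendsto_of_tendsto_of_tendsto_of_le_of_le tendsto_const_nhds hg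
    (fun _ => zero_le) hle
  rw [tendsto_iff_edist_tendsto_0]
  have h5 : Tendsto (fun k => (‖x k - l‖ₑ ^ 2) ^ (2⁻¹ : ℝ)) atTop (𝓝 0) := by
    simpa using h4.ennrpow_const (2⁻¹ : ℝ)
  refine h5.congr fun k => ?_
  rw [edist_eq_enorm_sub, ← ENNReal.rpow_natCast, ← ENNReal.rpow_mul]
  simp

/-- Mean square convergence, in `L²(ρ)` and at finitely many points, implies almost sure convergence
of a subsequence; the next terms of the sequence may be taken along. -/
lemma exists_subseq_ae_ae_tendsto {E ι : Type*} [MeasurableSpace E] [Fintype ι]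
    {ρ : Measure E} [IsProbabilityMeasure ρ] {f : ℕ → E → Ω → ℝ} {f' : E → Ω → ℝ} (x : ι → E)
    (hfm : ∀ T, Measurable (Function.uncurry (f T))) (hf' : Measurable (Function.uncurry f'))
    (h : TendstoL2 ρ P f f') (hx : ∀ i, TendstoL2At P f f' (x i)) :
    ∃ ns : ℕ → ℕ, ∀ᵐ z ∂ρ, ∀ᵐ ω ∂P,
      (Tendsto (fun k => f (ns k) z ω) atTop (𝓝 (f' z ω)) ∧
        Tendsto (fun k => f (ns k + 1) z ω) atTop (𝓝 (f' z ω))) ∧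
      ∀ i, Tendsto (fun k => f (ns k) (x i) ω) atTop (𝓝 (f' (x i) ω)) ∧
        Tendsto (fun k => f (ns k + 1) (x i) ω) atTop (𝓝 (f' (x i) ω)) := by
  set e : ℕ → E → Ω → ℝ≥0∞ := fun T z ω => ‖f T z ω - f' z ω‖ₑ ^ 2 with he
  have hem1 : ∀ T, Measurable fun p : E × Ω => e T p.1 p.2 :=
    fun T => ((hfm T).sub hf').enorm.pow_const 2
  have hem2 : ∀ T w, Measurable fun p : E × Ω => e T w p.2 := fun T w =>
    (hem1 T).comp (measurable_const.prodMk measurable_snd)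
  -- the errors at a `ρ`-random point and at the given points
  set g : ℕ → E × Ω → ℝ≥0∞ := fun T p => e T p.1 p.2 + ∑ i, e T (x i) p.2 with hg
  have hgm : ∀ T, Measurable (g T) := fun T =>
    (hem1 T).add (Finset.measurable_sum _ fun i _ => hem2 T _)
  have hlim : Tendsto (fun T => ∫⁻ p, g T p ∂(ρ.prod P)) atTop (𝓝 0) := by
    have h1 : ∀ T, ∫⁻ p, g T p ∂(ρ.prod P) = ∫⁻ ω, ∫⁻ z, e T z ω ∂ρ ∂P +
        ∑ i, ∫⁻ ω, e T (x i) ω ∂P := by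
      intro T
      rw [hg, lintegral_add_left (hem1 T), lintegral_finsetSum _ fun i _ => hem2 T _]
      congr 1
      · rw [lintegral_prod_symm _ (hem1 T).aemeasurable]
      · refine Finset.sum_congr rfl fun i _ => ?_
        rw [lintegral_prod _ (hem2 T _).aemeasurable]
        simp
    have h2 : Tendsto (fun T => ∫⁻ ω, ∫⁻ z, e T z ω ∂ρ ∂P +
        ∑ i, ∫⁻ ω, e T (x i) ω ∂P) atTop (𝓝 (0 + ∑ _i : ι, 0)) :=
      Tendsto.add h (tendsto_finsetSum Finset.univ fun i _ => hx i)
    rw [Finset.sum_const_zero, add_zero] at h2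
    exact h2.congr fun T => (h1 T).symm
  -- consecutive terms are controlled together, since the increment has to vanish in the limit
  obtain ⟨ns, -, hns⟩ := exists_subseq_ae_tendsto_zero (μ := ρ.prod P)
    (G := fun k p => g k p + g (k + 1) p) (fun k => ((hgm k).add (hgm (k + 1))).aemeasurable) (by
      have h3 := hlim.add (hlim.comp (tendsto_add_atTop_nat 1))
      rw [add_zero] at h3
      exact h3.congr fun k => (lintegral_add_left (hgm k) _).symm)
  refine ⟨ns, ?_⟩
  have hz1 : ∀ T z ω, e T z ω ≤ g T (z, ω) := fun T z ω => le_self_add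
  have hx1 : ∀ T z ω i, e T (x i) ω ≤ g T (z, ω) := fun T z ω i =>
    le_add_left (Finset.single_le_sum (f := fun i => e T (x i) ω) (fun _ _ => zero_le)
      (Finset.mem_univ i))
  filter_upwards [Measure.ae_ae_of_ae_prod hns] with z hz
  filter_upwards [hz] with ω hω
  exact ⟨⟨tendsto_of_enorm_sub_sq_le hω fun k => (hz1 (ns k) z ω).trans le_self_add,
    tendsto_of_enorm_sub_sq_le hω fun k => (hz1 (ns k + 1) z ω).trans le_add_self⟩,
    fun i => ⟨tendsto_of_enorm_sub_sq_le hω fun k => (hx1 (ns k) z ω i).trans le_self_add,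
      tendsto_of_enorm_sub_sq_le hω fun k => (hx1 (ns k + 1) z ω i).trans le_add_self⟩⟩

/-- Fixed parameters: the only possible mean square limit of boosting is the regression
function. -/
lemma ae_ae_eq_posteriorMean_of_tendstoL2 (hN : 1 ≤ N) (S : TreeSpec d n N)
    (ρ : Measure (EuclideanSpace ℝ (Fin d))) [IsProbabilityMeasure ρ] {ε β lam : ℝ} (hε : 0 < ε)
    (hβ : 0 < β) (hlam : 0 < lam)
    {past : ℕ → MeasurableSpace Ω} {u : ℕ → ℕ → Split d n → Ω → ℝ} (hu : IsAdaptedNoise P past u)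
    {Y : Ω → Fin N → ℝ} (hYm : ∀ i, Measurable[past 0] fun ω => Y ω i)
    {f' : EuclideanSpace ℝ (Fin d) → Ω → ℝ} (hf' : Measurable (Function.uncurry f'))
    (h : TendstoL2 ρ P (fun T z ω => trainGBDT S ε β lam (Y ω) (fun τ i s => u τ i s ω) T z) f')
    (hx : ∀ i, TendstoL2At P
      (fun T z ω => trainGBDT S ε β lam (Y ω) (fun τ i s => u τ i s ω) T z) f' (S.input i)) :
    ∀ᵐ z ∂ρ, ∀ᵐ ω ∂P, f' z ω = posteriorMean S lam (Y ω) z := by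
  have hYm' : ∀ i, Measurable fun ω => Y ω i := fun i => (hYm i).mono (hu.le 0) le_rfl
  obtain ⟨ns, hns⟩ := exists_subseq_ae_ae_tendsto S.input (fun T =>
    measurable_uncurry_trainGBDT S ε β lam hYm' (fun τ i s => (hu.noise τ).measurable i s) T)
    hf' h hx
  filter_upwards [hns] with z hz
  exact ae_eq_posteriorMean_of_tendsto (ns := ns) hN S hε hβ hlam hu hYm z
    (hz.mono fun ω hω i => (hω.2 i).1) (hz.mono fun ω hω i => (hω.2 i).2)
    (hz.mono fun ω hω => hω.1.1) (hz.mono fun ω hω => hω.1.2)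

end Modes

/-! ### Convergence in distribution -/

section Distribution

variable {Ω Ω' : Type*} {mΩ : MeasurableSpace Ω} {mΩ' : MeasurableSpace Ω'}

lemma charFun_map_toLp {P : Measure Ω} {J : Type*} [Fintype J] {V : Ω → J → ℝ}
    (hV : AEMeasurable V P) (t : EuclideanSpace ℝ J) :
    charFun (P.map fun ω => (WithLp.toLp 2 (V ω) : EuclideanSpace ℝ J)) t =
      charFun (P.map fun ω => ∑ j, t j * V ω j) 1 := by
  have hto : Measurable (WithLp.toLp 2 : (J → ℝ) → EuclideanSpace ℝ J) := by fun_prop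
  have hV' : AEMeasurable (fun ω => (WithLp.toLp 2 (V ω) : EuclideanSpace ℝ J)) P :=
    hto.comp_aemeasurable hV
  have hsum : AEMeasurable (fun ω => ∑ j, t j * V ω j) P := by fun_prop
  rw [charFun_apply, charFun_apply, integral_map hV' (by fun_prop), integral_map hsum (by fun_prop)]
  simp [PiLp.inner_apply]

variable {P : Measure Ω} [IsProbabilityMeasure P] {P' : Measure Ω'} [IsProbabilityMeasure P']

/-- The Cramér–Wold theorem. -/
lemma tendstoInDistribution_of_forall_sum_mul {J : Type*} [Fintype J] {X : ℕ → Ω → J → ℝ}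
    {X' : Ω' → J → ℝ} (hX : ∀ k, AEMeasurable (X k) P) (hX' : AEMeasurable X' P')
    (h : ∀ t : J → ℝ, TendstoInDistribution (fun k ω => ∑ j, t j * X k ω j) atTop
      (fun ω => ∑ j, t j * X' ω j) (fun _ => P) P') :
    TendstoInDistribution X atTop X' (fun _ => P) P' := by
  have hto : Measurable (WithLp.toLp 2 : (J → ℝ) → EuclideanSpace ℝ J) := by fun_prop
  have hE : TendstoInDistribution (fun k ω => (WithLp.toLp 2 (X k ω) : EuclideanSpace ℝ J)) atTop
      (fun ω => (WithLp.toLp 2 (X' ω) : EuclideanSpace ℝ J)) (fun _ => P) P' := by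
    refine ⟨fun k => hto.comp_aemeasurable (hX k), hto.comp_aemeasurable hX', ?_⟩
    refine ProbabilityMeasure.tendsto_iff_tendsto_charFun.2 fun t => ?_
    have h1 := ProbabilityMeasure.tendsto_iff_tendsto_charFun.1 (h t.ofLp).tendsto 1
    simp only [ProbabilityMeasure.coe_mk] at h1 ⊢
    rw [charFun_map_toLp hX']
    exact h1.congr fun k => (charFun_map_toLp (hX k) t).symm
  exact hE.continuous_comp (g := fun v : EuclideanSpace ℝ J => v.ofLp) (by fun_prop)

/-- Convergence in distribution is preserved when an independent variable of fixed law is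
adjoined. -/
lemma tendstoInDistribution_prodMk_of_indepFun {E F : Type*} [TopologicalSpace E]
    [MeasurableSpace E] [SecondCountableTopology E] [TopologicalSpace.PseudoMetrizableSpace E]
    [BorelSpace E] [TopologicalSpace F] [MeasurableSpace F] [SecondCountableTopology F]
    [TopologicalSpace.PseudoMetrizableSpace F] [BorelSpace F]
    {X : ℕ → Ω → E} {X' : Ω → E} {B : Ω → F} (hB : AEMeasurable B P)
    (h : TendstoInDistribution X atTop X' (fun _ => P) P)
    (hind : ∀ k, IndepFun (X k) B P) (hind' : IndepFun X' B P) :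
    TendstoInDistribution (fun k ω => (X k ω, B ω)) atTop (fun ω => (X' ω, B ω))
      (fun _ => P) P := by
  refine ⟨fun k => (h.forall_aemeasurable k).prodMk hB, h.aemeasurable_limit.prodMk hB, ?_⟩
  have hc := (ProbabilityMeasure.continuous_prod (α := E) (β := F)).tendsto
    (⟨P.map X', Measure.isProbabilityMeasure_map h.aemeasurable_limit⟩,
      ⟨P.map B, Measure.isProbabilityMeasure_map hB⟩)
  -- joint laws are product laws, and the product of measures is continuous
  have h2 := hc.comp (h.tendsto.prodMk_nhds tendsto_const_nhds)
  have e1 : ∀ {V : Ω → E} (hV : AEMeasurable V P), IndepFun V B P →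
      (⟨P.map fun ω => (V ω, B ω), Measure.isProbabilityMeasure_map (hV.prodMk hB)⟩ :
        ProbabilityMeasure (E × F)) =
      ProbabilityMeasure.prod ⟨P.map V, Measure.isProbabilityMeasure_map hV⟩
        ⟨P.map B, Measure.isProbabilityMeasure_map hB⟩ := fun hV hi =>
    Subtype.ext ((indepFun_iff_map_prod_eq_prod_map_map hV hB).1 hi)
  rw [e1 h.aemeasurable_limit hind']
  exact h2.congr fun k => (e1 (h.forall_aemeasurable k) (hind k)).symm

/-- A sequence of real random variables that converges in distribution is tight. -/
lemma exists_eventually_measure_le_of_tendstoInDistribution {X : ℕ → Ω → ℝ} {X' : Ω' → ℝ}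
    (h : TendstoInDistribution X atTop X' (fun _ => P) P') {η : ℝ≥0∞} (hη : η ≠ 0) :
    ∃ M : ℝ, 0 < M ∧ ∀ᶠ k in atTop, P {ω | M ^ 2 < X k ω} ≤ η := by
  have h0 : Tendsto (fun M : ℕ => P'.map X' (Set.Ici ((M : ℝ) ^ 2))) atTop (𝓝 0) := by
    have hprob : IsProbabilityMeasure (P'.map X') :=
      Measure.isProbabilityMeasure_map h.aemeasurable_limit
    have hanti : Antitone fun M : ℕ => Set.Ici ((M : ℝ) ^ 2) := fun a b hab =>
      Set.Ici_subset_Ici.2 (by gcongr)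
    have h1 := tendsto_measure_iInter_atTop (μ := P'.map X')
      (s := fun M : ℕ => Set.Ici ((M : ℝ) ^ 2))
      (fun M => measurableSet_Ici.nullMeasurableSet) hanti ⟨0, measure_ne_top _ _⟩
    have h2 : ⋂ M : ℕ, Set.Ici ((M : ℝ) ^ 2) = ∅ := by
      refine Set.eq_empty_of_forall_notMem fun x hx => ?_
      obtain ⟨M, hM⟩ := exists_nat_gt |x|
      have h3 : (M : ℝ) ^ 2 ≤ x := Set.mem_iInter.1 hx M
      have h4 : (1 : ℝ) ≤ M := by
        have : 0 < M := by exact_mod_cast (abs_nonneg x).trans_lt hM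
        exact_mod_cast this
      nlinarith [le_abs_self x]
    rwa [h2, measure_empty] at h1
  obtain ⟨M, hM0, hM⟩ := ((eventually_gt_atTop 0).and
    (h0.eventually_lt_const (pos_iff_ne_zero.2 hη))).exists
  refine ⟨M, by exact_mod_cast hM0, ?_⟩
  have hls := ProbabilityMeasure.limsup_measure_closed_le_of_tendsto h.tendsto
    (isClosed_Ici (a := (M : ℝ) ^ 2))
  filter_upwards [eventually_lt_of_limsup_lt (hls.trans_lt hM)] with k hk
  refine le_trans ?_ hk.le
  have h5 : P.map (X k) (Set.Ici ((M : ℝ) ^ 2)) = P (X k ⁻¹' Set.Ici ((M : ℝ) ^ 2)) :=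
    Measure.map_apply_of_aemeasurable (h.forall_aemeasurable k) measurableSet_Ici
  refine le_trans (measure_mono fun ω hω => ?_) h5.ge
  have h6 : (M : ℝ) ^ 2 < X k ω := by simpa using hω
  exact h6.le

/-- Convergence of the finite-dimensional distributions along an arbitrary finite family of
points, possibly with repetitions. -/
lemma TendstoFDD.comp_family {E ι : Type*} [Fintype ι] {Y : ℕ → E → Ω → ℝ} {Y' : E → Ω' → ℝ}
    (h : TendstoFDD P P' Y Y') (p : ι → E) :
    TendstoInDistribution (fun k ω i => Y k (p i) ω) atTop (fun ω i => Y' (p i) ω)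
      (fun _ => P) P' := by
  classical
  exact (h (Finset.univ.image p)).continuous_comp
    (g := fun v i => v ⟨p i, Finset.mem_image_of_mem p (Finset.mem_univ i)⟩) (by fun_prop)

end Distribution

/-! ### Independent blocks and independent selection -/

section Blocks

variable {Ω : Type*} {mΩ : MeasurableSpace Ω} {P : Measure Ω}

/-- Disjoint blocks of independent variables are independent. -/
lemma iIndepFun_curry {ι κ : Type*} {X : ι → κ → Ω → ℝ} (mX : ∀ i j, Measurable (X i j))
    (h : iIndepFun (fun (p : (_ : ι) × κ) ω => X p.1 p.2 ω) P) :
    iIndepFun (fun i ω j => X i j ω) P := by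
  have := h.isProbabilityMeasure
  have : ∀ i j, IsProbabilityMeasure (P.map (X i j)) :=
    fun i j => Measure.isProbabilityMeasure_map (mX i j).aemeasurable
  have h2 : ∀ i, iIndepFun (X i) P := fun i =>
    h.precomp (g := fun j => (⟨i, j⟩ : (_ : ι) × κ)) fun j j' e => by simpa using e
  rw [iIndepFun_iff_map_fun_eq_infinitePi_map (by fun_prop)]
  have h3 := (iIndepFun_iff_map_fun_eq_infinitePi_map (by fun_prop)).1 h
  have h4 : (fun ω i j => X i j ω) =
      MeasurableEquiv.piCurry (fun (_ : ι) (_ : κ) => ℝ) ∘ fun ω p => X p.1 p.2 ω := by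
    ext; simp [Sigma.curry]
  rw [h4, ← Measure.map_map (by fun_prop) (by fun_prop), h3,
    Measure.infinitePi_map_piCurry (fun i j => P.map (X i j))]
  congr 1
  funext i
  rw [(iIndepFun_iff_map_fun_eq_infinitePi_map (by fun_prop)).1 (h2 i)]

/-- A linear combination of independent standard normals. -/
lemma hasLaw_sum_mul_of_standard [IsProbabilityMeasure P] {ι : Type*} [Fintype ι] {g : ι → Ω → ℝ}
    (hg : iIndepFun g P) (hlaw : ∀ i, HasLaw (g i) (gaussianReal 0 1) P) (c : ι → ℝ) :
    HasLaw (fun ω => ∑ i, c i * g i ω) (gaussianReal 0 (∑ i, c i ^ 2).toNNReal) P := by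
  have hG : HasGaussianLaw (fun ω => ∑ i, c i * g i ω) P :=
    (hg.comp (fun i x => c i * x) (by fun_prop)).hasGaussianLaw_fun_sum fun i =>
      (hlaw i).hasGaussianLaw.fun_smul (c i)
  have hmem : ∀ i, MemLp (g i) 2 P := fun i => (hlaw i).hasGaussianLaw.memLp_two
  have hmean : ∫ ω, ∑ i, c i * g i ω ∂P = 0 := by
    rw [integral_finsetSum _ fun i _ => ((hmem i).integrable (by norm_num)).const_mul _]
    refine Finset.sum_eq_zero fun i _ => ?_
    rw [integral_const_mul, (hlaw i).integral_eq, integral_id_gaussianReal, mul_zero]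
  have hvar : Var[fun ω => ∑ i, c i * g i ω; P] = ∑ i, c i ^ 2 := by
    have h1 : (fun ω => ∑ i, c i * g i ω) = ∑ i, fun ω => c i * g i ω := by
      ext ω; simp
    rw [h1, IndepFun.variance_sum (X := fun i ω => c i * g i ω)
      (fun i _ => (hmem i).const_mul (c i)) fun i _ j _ hij =>
        (hg.indepFun hij).comp (measurable_const_mul _) (measurable_const_mul _)]
    refine Finset.sum_congr rfl fun i _ => ?_
    rw [variance_const_mul, (hlaw i).variance_eq, variance_id_gaussianReal]
    simp
  refine ⟨hG.aemeasurable, ?_⟩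
  rw [hG.map_eq_gaussianReal, hmean, hvar]

end Blocks

/-! ### Limit of the prior samples -/

section Prior

variable {d n N : ℕ}

/-- The random numbers of a single iteration of SamplePrior. -/
abbrev TreeSeed (d n : ℕ) : Type := (ℕ × Split d n) ⊕ Finset (Split d n)

/-- The random number of SamplePrior that serves as a given seed at iteration `τ`. -/
def seedAt (τ : ℕ) : TreeSeed d n → PriorSeed d n
  | .inl p => .unif τ p.1 p.2
  | .inr ℓ => .leaf τ ℓ

/-- The tree structure grown at a single iteration of SamplePrior. -/
noncomputable def priorTree (S : TreeSpec d n N) (v : TreeSeed d n → ℝ) : Finset (Split d n) :=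
  sampleTree S 1 0 fun i s => v (.inl (i, s))

/-- The coefficient of the normal variable of leaf `ℓ` in a linear combination of values of a
random tree with structure `ν`. -/
noncomputable def leafCoef {J : Type*} [Fintype J] (S : TreeSpec d n N) (t : J → ℝ)
    (z : J → EuclideanSpace ℝ (Fin d)) (ν ℓ : Finset (Split d n)) : ℝ :=
  ∑ j, t j * (leafInd S ν ℓ (z j) * √(leafWeight S ν ℓ))

/-- A linear combination of values of the random tree of a single iteration of SamplePrior. -/
noncomputable def treeCombination {J : Type*} [Fintype J] (S : TreeSpec d n N) (t : J → ℝ)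
    (z : J → EuclideanSpace ℝ (Fin d)) (v : TreeSeed d n → ℝ) : ℝ :=
  ∑ ℓ, leafCoef S t z (priorTree S v) ℓ * v (.inr ℓ)

lemma sum_mul_samplePrior {J : Type*} [Fintype J] (S : TreeSpec d n N) (t : J → ℝ)
    (z : J → EuclideanSpace ℝ (Fin d)) (T : ℕ) (a : PriorSeed d n → ℝ) :
    ∑ j, t j * samplePrior S T a (z j) =
      (√(T : ℝ))⁻¹ * ∑ τ ∈ Finset.range T, treeCombination S t z fun q => a (seedAt τ q) := by
  simp only [samplePrior, Finset.mul_sum]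
  rw [Finset.sum_comm]
  refine Finset.sum_congr rfl fun τ _ => ?_
  simp only [treeCombination, leafCoef, Finset.mul_sum, Finset.sum_mul]
  rw [Finset.sum_comm]
  symm
  rw [Finset.sum_comm]
  symm
  rw [Finset.sum_comm]
  refine Finset.sum_congr rfl fun j _ => ?_
  refine (Finset.sum_subset (Finset.subset_univ _) fun ℓ _ h => ?_).trans
    (Finset.sum_congr rfl fun ℓ _ => ?_)
  · rw [leafInd_of_notMem S h]; simp
  · simp only [priorTree, seedAt]; ring

lemma sum_stationary_mul_leafCoef_sq {J : Type*} [Fintype J] (S : TreeSpec d n N) (t : J → ℝ)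
    (z : J → EuclideanSpace ℝ (Fin d)) :
    ∑ ν, stationary S ν * ∑ ℓ, leafCoef S t z ν ℓ ^ 2 =
      ∑ p, (∑ j, t j * feature S p (z j)) ^ 2 := by
  rw [Fintype.sum_prod_type]
  refine Finset.sum_congr rfl fun ν _ => ?_
  rw [Finset.mul_sum]
  refine Finset.sum_congr rfl fun ℓ _ => ?_
  have : ∑ j, t j * feature S (ν, ℓ) (z j) = √(stationary S ν) * leafCoef S t z ν ℓ := by
    simp only [feature, leafCoef, Finset.mul_sum, Real.sqrt_mul (stationary_nonneg S ν)]
    exact Finset.sum_congr rfl fun j _ => by ring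
  rw [this, mul_pow, Real.sq_sqrt (stationary_nonneg S ν)]

lemma measurableSet_priorTree {Ω : Type*} {m : MeasurableSpace Ω} (S : TreeSpec d n N)
    {v : Ω → TreeSeed d n → ℝ} (hv : ∀ p, Measurable fun ω => v ω (.inl p))
    (ν : Finset (Split d n)) : MeasurableSet {ω | priorTree S (v ω) = ν} :=
  measurableSet_sampleTree S 1 (r := fun _ => 0) (fun _ => measurable_const)
    (u := fun ω i s => v ω (.inl (i, s))) (fun _ _ => hv _) ν

lemma measurable_treeCombination {J : Type*} [Fintype J] (S : TreeSpec d n N) (t : J → ℝ)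
    (z : J → EuclideanSpace ℝ (Fin d)) : Measurable (treeCombination S t z) :=
  measurable_select (t := priorTree S) (measurableSet_priorTree S (v := id) fun p => by
      exact measurable_pi_apply _)
    (F := fun ν v => ∑ ℓ, leafCoef S t z ν ℓ * v (.inr ℓ)) fun ν => by fun_prop

variable {Ω : Type*} {mΩ : MeasurableSpace Ω} {P : Measure Ω} [IsProbabilityMeasure P]

/-- Moments of a linear combination of values of a single random tree. -/
lemma treeCombination_moments {J : Type*} [Fintype J] (S : TreeSpec d n N) (t : J → ℝ)
    (z : J → EuclideanSpace ℝ (Fin d)) {v : TreeSeed d n → Ω → ℝ} (hvm : ∀ q, Measurable (v q))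
    (hv : iIndepFun v P) (hu : ∀ p, HasLaw (v (.inl p)) uniformLaw P)
    (hg : ∀ ℓ, HasLaw (v (.inr ℓ)) (gaussianReal 0 1) P) :
    MemLp (fun ω => treeCombination S t z fun q => v q ω) 2 P ∧
      ∫ ω, treeCombination S t z (fun q => v q ω) ∂P = 0 ∧
      Var[fun ω => treeCombination S t z fun q => v q ω; P] =
        ∑ p, (∑ j, t j * feature S p (z j)) ^ 2 := by
  set c := leafCoef S t z with hc
  set F : Finset (Split d n) → Ω → ℝ := fun ν ω => ∑ ℓ, c ν ℓ * v (.inr ℓ) ω with hF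
  set ν : Ω → Finset (Split d n) := fun ω => priorTree S fun q => v q ω with hν
  set m₁ : MeasurableSpace Ω := ⨆ q ∈ Set.range (Sum.inr : _ → TreeSeed d n),
    MeasurableSpace.comap (v q) inferInstance with hm₁
  set m₂ : MeasurableSpace Ω := ⨆ q ∈ Set.range (Sum.inl : _ → TreeSeed d n),
    MeasurableSpace.comap (v q) inferInstance with hm₂
  have hle : ∀ q, MeasurableSpace.comap (v q) inferInstance ≤ mΩ := fun q => (hvm q).comap_le
  have h₁ : m₁ ≤ mΩ := iSup₂_le fun q _ => hle q
  have h₂ : m₂ ≤ mΩ := iSup₂_le fun q _ => hle q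
  have hind : Indep m₁ m₂ P := indep_iSup_of_disjoint hle ((iIndepFun_iff_iIndep _ _ _).1 hv)
    (Set.disjoint_left.2 (by rintro _ ⟨ℓ, rfl⟩ ⟨p, hp⟩; cases hp))
  have hg₁ : ∀ ℓ, Measurable[m₁] (v (.inr ℓ)) := fun ℓ => (comap_measurable _).mono
    (le_iSup₂_of_le (f := fun q _ => MeasurableSpace.comap (v q) inferInstance)
      (Sum.inr ℓ) ⟨ℓ, rfl⟩ le_rfl) le_rfl
  have hu₂ : ∀ p, Measurable[m₂] (v (.inl p)) := fun p => (comap_measurable _).mono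
    (le_iSup₂_of_le (f := fun q _ => MeasurableSpace.comap (v q) inferInstance)
      (Sum.inl p) ⟨p, rfl⟩ le_rfl) le_rfl
  have hνm : ∀ ν', MeasurableSet[m₂] {ω | ν ω = ν'} :=
    measurableSet_priorTree S (v := fun ω q => v q ω) hu₂
  have hFm : ∀ ν', Measurable[m₁] (F ν') := fun ν' =>
    Finset.measurable_sum _ fun ℓ _ => (hg₁ ℓ).const_mul _
  have hgind : iIndepFun (fun ℓ => v (.inr ℓ)) P := hv.precomp Sum.inr_injective
  have hFlaw : ∀ ν', HasLaw (F ν') (gaussianReal 0 (∑ ℓ, c ν' ℓ ^ 2).toNNReal) P := fun ν' =>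
    hasLaw_sum_mul_of_standard hgind hg (c ν')
  have hF2 : ∀ ν', MemLp (F ν') 2 P := fun ν' => (hFlaw ν').hasGaussianLaw.memLp_two
  have hF0 : ∀ ν', ∫ ω, F ν' ω ∂P = 0 := fun ν' => by
    rw [(hFlaw ν').integral_eq, integral_id_gaussianReal]
  have hFsq : ∀ ν', ∫ ω, F ν' ω ^ 2 ∂P = ∑ ℓ, c ν' ℓ ^ 2 := fun ν' => by
    rw [← variance_of_integral_eq_zero (hFlaw ν').aemeasurable (hF0 ν'), (hFlaw ν').variance_eq,
      variance_id_gaussianReal, Real.coe_toNNReal _ (Finset.sum_nonneg fun _ _ => sq_nonneg _)]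
  have hX : (fun ω => treeCombination S t z fun q => v q ω) = fun ω => F (ν ω) ω := rfl
  have hmem : MemLp (fun ω => F (ν ω) ω) 2 P := by
    simp only [select_eq_sum_indicator ν F]
    exact memLp_finsetSum _ fun ν' _ => (hF2 ν').indicator (h₂ _ (hνm ν'))
  have hmean : ∫ ω, F (ν ω) ω ∂P = 0 := by
    rw [integral_select h₁ h₂ hind hνm hFm fun ν' => (hF2 ν').integrable (by norm_num)]
    simp [hF0]
  have hunif : IsUniformNoise P fun i s => v (.inl (i, s)) :=
    ⟨fun i s => hvm _, fun i s => hu _, hv.precomp (g := fun p : ℕ × Split d n =>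
      Sum.inl (p.1, p.2))
      fun p q e => by simpa [Prod.ext_iff] using e⟩
  have hsq : ∫ ω, F (ν ω) ω ^ 2 ∂P = ∑ p, (∑ j, t j * feature S p (z j)) ^ 2 := by
    rw [integral_select (F := fun ν' ω => F ν' ω ^ 2) h₁ h₂ hind hνm
      (fun ν' => (hFm ν').pow_const 2) fun ν' => (hF2 ν').integrable_sq,
      ← sum_stationary_mul_leafCoef_sq S t z]
    refine Finset.sum_congr rfl fun ν' _ => ?_
    rw [hFsq, ← measureReal_sampleTree_zero S hunif ν']
    rfl
  rw [hX]
  exact ⟨hmem, hmean, by rw [variance_of_integral_eq_zero hmem.aemeasurable hmean, hsq]⟩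

/-- The limit of the prior samples, as a linear combination of the features of the kernel whose
coefficients are to be independent standard normals. -/
noncomputable def priorLimit (S : TreeSpec d n N) (z : EuclideanSpace ℝ (Fin d))
    (g : Finset (Split d n) × Finset (Split d n) → ℝ) : ℝ :=
  ∑ p, feature S p z * g p

/-- The law of the coefficients of `priorLimit`. -/
noncomputable abbrev coefLaw (d n : ℕ) :
    Measure (Finset (Split d n) × Finset (Split d n) → ℝ) :=
  Measure.pi fun _ => gaussianReal 0 1

lemma iIndepFun_coefLaw (d n : ℕ) :
    iIndepFun (fun p (g : Finset (Split d n) × Finset (Split d n) → ℝ) => g p) (coefLaw d n) :=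
  iIndepFun_pi (X := fun _ x => x) fun _ => aemeasurable_id

lemma hasLaw_eval_coefLaw (p : Finset (Split d n) × Finset (Split d n)) :
    HasLaw (fun g : Finset (Split d n) × Finset (Split d n) → ℝ => g p) (gaussianReal 0 1)
      (coefLaw d n) :=
  (measurePreserving_eval (fun _ => gaussianReal 0 1) p).hasLaw

lemma hasLaw_sum_mul_priorLimit {J : Type*} [Fintype J] (S : TreeSpec d n N) (t : J → ℝ)
    (z : J → EuclideanSpace ℝ (Fin d)) :
    HasLaw (fun g => ∑ j, t j * priorLimit S (z j) g)
      (gaussianReal 0 (∑ p, (∑ j, t j * feature S p (z j)) ^ 2).toNNReal) (coefLaw d n) := by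
  have h := hasLaw_sum_mul_of_standard (iIndepFun_coefLaw d n) hasLaw_eval_coefLaw
    fun p => ∑ j, t j * feature S p (z j)
  convert h using 1
  funext g
  simp only [priorLimit, Finset.mul_sum, Finset.sum_mul]
  rw [Finset.sum_comm]
  exact Finset.sum_congr rfl fun p _ => Finset.sum_congr rfl fun j _ => by ring

lemma measurable_priorLimit (S : TreeSpec d n N) (z : EuclideanSpace ℝ (Fin d)) :
    Measurable (priorLimit S z) := by
  unfold priorLimit
  fun_prop

/-- The samples of the prior converge to a Gaussian process with covariance `kernel`, by the
central limit theorem applied to linear combinations of their values. -/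
lemma tendstoFDD_samplePrior (S : TreeSpec d n N) {a : PriorSeed d n → Ω → ℝ}
    (ham : ∀ i, Measurable (a i)) (ha : iIndepFun a P) (ha_law : ∀ i, HasLaw (a i) i.law P) :
    TendstoFDD P (coefLaw d n) (fun T z ω => samplePrior S T (fun i => a i ω) z)
      (priorLimit S) := by
  intro J
  refine tendstoInDistribution_of_forall_sum_mul
    (fun T => (measurable_pi_lambda _ fun z : J =>
      measurable_samplePrior S T (a := fun ω i => a i ω) ham z.1).aemeasurable)
    (measurable_pi_lambda _ fun z : J => measurable_priorLimit S z.1).aemeasurable fun t => ?_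
  set z : J → EuclideanSpace ℝ (Fin d) := fun j => j with hz
  set X : ℕ → Ω → ℝ := fun τ ω => treeCombination S t z fun q => a (seedAt τ q) ω with hX
  have hinj : Function.Injective fun p : (_ : ℕ) × TreeSeed d n => seedAt p.1 p.2 := by
    rintro ⟨τ, q | q⟩ ⟨τ', q' | q'⟩ h <;> simp only [seedAt, PriorSeed.unif.injEq,
      PriorSeed.leaf.injEq, reduceCtorEq] at h
    · obtain ⟨rfl, h1, h2⟩ := h
      rw [Prod.ext h1 h2]
    · obtain ⟨rfl, rfl⟩ := h
      rfl
  -- iterations are independent and identically distributed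
  have hblock : iIndepFun (fun τ ω q => a (seedAt τ q) ω) P :=
    iIndepFun_curry (X := fun τ q => a (seedAt τ q)) (fun τ q => ham _) (ha.precomp hinj)
  have hXind : iIndepFun X P :=
    hblock.comp (fun _ => treeCombination S t z) fun _ => measurable_treeCombination S t z
  have hrow : ∀ τ, iIndepFun (fun q => a (seedAt τ q)) P := fun τ =>
    ha.precomp (g := seedAt τ) fun q q' h => by simpa using @hinj ⟨τ, q⟩ ⟨τ, q'⟩ h
  have hlaw : ∀ τ q, P.map (a (seedAt τ q)) = P.map (a (seedAt 0 q)) := by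
    rintro τ (q | q) <;> rw [(ha_law _).map_eq, (ha_law _).map_eq] <;> rfl
  have hident : ∀ τ, IdentDistrib (X τ) (X 0) P P := fun τ => by
    have h1 : IdentDistrib (fun ω q => a (seedAt τ q) ω) (fun ω q => a (seedAt 0 q) ω) P P :=
      ⟨by fun_prop, by fun_prop, by
        rw [(hrow τ).map_fun_eq_infinitePi_map fun q => ham _,
          (hrow 0).map_fun_eq_infinitePi_map fun q => ham _]
        simp only [hlaw τ]⟩
    exact h1.comp (measurable_treeCombination S t z)
  obtain ⟨h2, hmean, hvar⟩ := treeCombination_moments S t z (v := fun q => a (seedAt 0 q))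
    (fun q => ham _) (hrow 0) (fun p => ha_law _) fun ℓ => ha_law _
  have hclt := tendstoInDistribution_inv_sqrt_mul_sum_sub (X := X) (P' := coefLaw d n)
    (Y := fun g => ∑ j, t j * priorLimit S (z j) g) (by
      rw [show Var[X 0; P] = _ from hvar]
      exact hasLaw_sum_mul_priorLimit S t z) h2 hXind hident
  have hmean' : ∫ ω, X 0 ω ∂P = 0 := hmean
  simp only [hmean', mul_zero, sub_zero] at hclt
  refine hclt.congr (fun T => Eventually.of_forall fun ω => ?_) EventuallyEq.rfl
  exact (sum_mul_samplePrior S t z T fun i => a i ω).symm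

end Prior

/-! ### Limit of the posterior samples -/

section Posterior

variable {d n N : ℕ} {Ω : Type*} {mΩ : MeasurableSpace Ω}

lemma tendstoInMeasure_pi {P : Measure Ω} {J : Type*} [Fintype J] {f : ℕ → Ω → J → ℝ}
    (h : ∀ j, TendstoInMeasure P (fun k ω => f k ω j) atTop fun _ => 0) :
    TendstoInMeasure P f atTop 0 := by
  rw [tendstoInMeasure_iff_norm]
  intro κ hκ
  have h1 : Tendsto (fun k => ∑ j, P {ω | κ ≤ ‖f k ω j‖}) atTop (𝓝 0) := by
    have h2 := tendsto_finsetSum Finset.univ fun j _ => tendstoInMeasure_iff_norm.1 (h j) κ hκ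
    simpa using h2
  refine tendsto_of_tendsto_of_tendsto_of_le_of_le tendsto_const_nhds h1 (fun _ => zero_le)
    fun k => ?_
  refine le_trans (measure_mono fun ω hω => ?_) (measure_iUnion_fintype_le P _)
  have h3 : κ ≤ ‖f k ω‖ := by simpa using hω
  by_contra hcon
  refine absurd h3 (not_le.2 ((pi_norm_lt_iff hκ).2 fun j => ?_))
  by_contra hj
  exact hcon (Set.mem_iUnion.2 ⟨j, by simpa using hj⟩)

variable {P : Measure Ω} [IsProbabilityMeasure P]

/-- Uniqueness of the limit of the prior samples. -/
lemma map_eq_map_priorLimit (S : TreeSpec d n N) {a : PriorSeed d n → Ω → ℝ}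
    (ham : ∀ i, Measurable (a i)) (ha : iIndepFun a P) (ha_law : ∀ i, HasLaw (a i) i.law P)
    {h : EuclideanSpace ℝ (Fin d) → Ω → ℝ}
    (hh : TendstoFDD P P (fun T z ω => samplePrior S T (fun i => a i ω) z) h)
    {J : Type*} [Fintype J] (z : J → EuclideanSpace ℝ (Fin d)) :
    P.map (fun ω j => h (z j) ω) = (coefLaw d n).map fun g j => priorLimit S (z j) g :=
  tendstoInDistribution_unique _ (hh.comp_family z)
    ((tendstoFDD_samplePrior S ham ha ha_law).comp_family z)

/-- The labels on which TrainGBDT is run, given a sample of the prior and the label noise. -/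
def residualLabels (S : TreeSpec d n N) (y : Fin N → ℝ) (σ : ℝ)
    (h : EuclideanSpace ℝ (Fin d) → ℝ) (b : TrainSeed d n N → ℝ) (i : Fin N) : ℝ :=
  y i - σ * h (S.input i) + b (.label i)

/-- With the prior sample and the label noise independent, a limit of the prior samples may be
passed through any continuous function of finitely many values and the label noise. -/
lemma tendstoInDistribution_comp_samplePrior (S : TreeSpec d n N) {a : PriorSeed d n → Ω → ℝ}
    {b : TrainSeed d n N → Ω → ℝ}
    (hbm : ∀ i, Measurable (b i))
    (hab : IndepFun (fun ω i => a i ω) (fun ω i => b i ω) P)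
    {h : EuclideanSpace ℝ (Fin d) → Ω → ℝ}
    (hh : TendstoFDD P P (fun T z ω => samplePrior S T (fun i => a i ω) z) h)
    (hhb : IndepFun (fun ω z => h z ω) (fun ω i => b i ω) P)
    {T₀ : ℕ → ℕ} (hT₀ : Tendsto T₀ atTop atTop)
    {J F : Type*} [Fintype J] [TopologicalSpace F] [MeasurableSpace F] [BorelSpace F]
    (z : J → EuclideanSpace ℝ (Fin d)) {G : (J → ℝ) × (Fin N → ℝ) → F} (hG : Continuous G) :
    TendstoInDistribution
      (fun k ω => G (fun j => samplePrior S (T₀ k) (fun i => a i ω) (z j), fun i => b (.label i) ω))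
      atTop (fun ω => G (fun j => h (z j) ω, fun i => b (.label i) ω)) (fun _ => P) P := by
  have h1 : TendstoInDistribution
      (fun k ω j => samplePrior S (T₀ k) (fun i => a i ω) (z j)) atTop (fun ω j => h (z j) ω)
      (fun _ => P) P :=
    ⟨fun k => (hh.comp_family z).forall_aemeasurable (T₀ k), (hh.comp_family z).aemeasurable_limit,
      (hh.comp_family z).tendsto.comp hT₀⟩
  have hφ : ∀ T, Measurable fun (a : PriorSeed d n → ℝ) j => samplePrior S T a (z j) := fun T =>
    measurable_pi_lambda _ fun j => measurable_samplePrior S T (a := id) measurable_pi_apply (z j)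
  have hψ : Measurable fun (b : TrainSeed d n N → ℝ) (i : Fin N) => b (.label i) := by fun_prop
  have hχ : Measurable fun (v : EuclideanSpace ℝ (Fin d) → ℝ) (j : J) => v (z j) := by fun_prop
  exact (tendstoInDistribution_prodMk_of_indepFun (B := fun ω i => b (.label i) ω) (by fun_prop) h1
    (fun k => hab.comp (hφ (T₀ k)) hψ) (hhb.comp hχ hψ)).continuous_comp hG

/-- Along labels of converging distribution, the error of boosting tends to `0` in measure. -/
lemma tendstoInMeasure_boostErr (hN : 1 ≤ N) (S : TreeSpec d n N) {lam : ℝ}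
    (hlam : 0 < lam) {ε β : ℕ → ℝ} {T : ℕ → ℕ} (h : BoostingLimit ε β T)
    {past : ℕ → ℕ → MeasurableSpace Ω} {u : ℕ → ℕ → Split d n → Ω → ℝ}
    (hu : ∀ k, IsAdaptedNoise P (past k) u)
    {Y : ℕ → Ω → Fin N → ℝ} (hYm : ∀ k i, Measurable[past k 0] fun ω => Y k ω i)
    {Y' : Ω → ℝ} (hY : TendstoInDistribution (fun k ω => ∑ i, Y k ω i ^ 2) atTop Y' (fun _ => P) P)
    (z : EuclideanSpace ℝ (Fin d)) :
    TendstoInMeasure P (fun k ω =>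
      boostErr S (ε k) (β k) lam (Y k ω) (fun τ i s => u τ i s ω) (T k) z) atTop fun _ => 0 := by
  rw [tendstoInMeasure_iff_norm]
  intro κ hκ
  refine ENNReal.tendsto_nhds_zero.2 fun η hη => ?_
  have hη2 : η / 2 ≠ 0 := (ENNReal.half_pos hη.ne').ne'
  obtain ⟨M, hM, hev⟩ := exists_eventually_measure_le_of_tendstoInDistribution hY hη2
  have hκ2 : ENNReal.ofReal κ ^ 2 ≠ 0 := by simpa using hκ
  filter_upwards [hev, eventually_lintegral_boostErr_le_of_bounded (Ω := Ω) (P := P) hN S hlam h hM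
    (mul_ne_zero hκ2 hη2)] with k hk1 hk2
  set e : Ω → ℝ := fun ω => boostErr S (ε k) (β k) lam (truncateLabels M (Y k ω))
    (fun τ i s => u τ i s ω) (T k) z with he
  have h2 : ∫⁻ ω, ‖e ω‖ₑ ^ 2 ∂P ≤ ENNReal.ofReal κ ^ 2 * (η / 2) :=
    hk2 (past k) u (hu k) (fun ω => truncateLabels M (Y k ω))
      (measurable_truncateLabels M (hYm k)) (fun ω => sum_sq_truncateLabels_le M _) z
  have hem : Measurable e := measurable_boostErr S (ε k) (β k) lam
    (fun i => (measurable_truncateLabels M (hYm k) i).mono ((hu k).le 0) le_rfl)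
    (fun τ _ i s => ((hu k).noise τ).measurable i s) z
  have h3 : P {ω | ENNReal.ofReal κ ^ 2 ≤ ‖e ω‖ₑ ^ 2} ≤ η / 2 :=
    (ENNReal.mul_le_mul_iff_right hκ2 (by simp)).1
      ((mul_meas_ge_le_lintegral (hem.enorm.pow_const 2) _).trans h2)
  -- either the labels are large, or truncation does not change them
  calc _ ≤ P ({ω | M ^ 2 < ∑ i, Y k ω i ^ 2} ∪ {ω | ENNReal.ofReal κ ^ 2 ≤ ‖e ω‖ₑ ^ 2}) := by
        refine measure_mono fun ω hω => ?_
        by_cases hω2 : ∑ i, Y k ω i ^ 2 ≤ M ^ 2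
        · right
          have h4 : κ ≤ ‖e ω‖ := by
            simpa [he, truncateLabels_eq_self hω2] using hω
          have h5 : ENNReal.ofReal κ ≤ ‖e ω‖ₑ := by
            rw [← ofReal_norm]; exact ENNReal.ofReal_le_ofReal h4
          simpa using pow_le_pow_left' h5 2
        · left
          simpa using hω2
    _ ≤ η / 2 + η / 2 := (measure_union_le _ _).trans (add_le_add hk1 h3)
    _ = η := ENNReal.add_halves η

lemma continuous_posteriorMean (S : TreeSpec d n N) (lam : ℝ) (z : EuclideanSpace ℝ (Fin d)) :
    Continuous fun v : Fin N → ℝ => posteriorMean S lam v z := by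
  simp only [posteriorMean_eq_krigingWeight]
  fun_prop

/-- In the joint limit, the output of SamplePosterior converges to the prior sample corrected by
regression on the residual labels. -/
lemma tendstoFDD_samplePosterior (hN : 1 ≤ N) (S : TreeSpec d n N) (y : Fin N → ℝ) {σ δ : ℝ}
    (hσ : 0 < σ) (hδ : 0 < δ)
    {a : PriorSeed d n → Ω → ℝ} {b : TrainSeed d n N → Ω → ℝ}
    (ham : ∀ i, Measurable (a i)) (hbm : ∀ i, Measurable (b i))
    (hb : iIndepFun b P) (hb_law : ∀ i, HasLaw (b i) (i.law δ) P)
    (hab : IndepFun (fun ω i => a i ω) (fun ω i => b i ω) P)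
    {h : EuclideanSpace ℝ (Fin d) → Ω → ℝ}
    (hh : TendstoFDD P P (fun T z ω => samplePrior S T (fun i => a i ω) z) h)
    (hhb : IndepFun (fun ω z => h z ω) (fun ω i => b i ω) P)
    {ε β : ℕ → ℝ} {T₀ T₁ : ℕ → ℕ} (hT₁ : BoostingLimit ε β T₁) (hT₀ : Tendsto T₀ atTop atTop) :
    TendstoFDD P P (fun k z ω => samplePosterior S y σ δ (ε k) (β k) (T₀ k) (T₁ k)
      (fun i => a i ω) (fun i => b i ω) z)
      (fun z ω => σ * h z ω + posteriorMean S (δ ^ 2 / σ ^ 2)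
        (residualLabels S y σ (fun z => h z ω) fun i => b i ω) z) := by
  intro J
  have hlam : 0 < δ ^ 2 / σ ^ 2 := by positivity
  set p : J ⊕ Fin N → EuclideanSpace ℝ (Fin d) := Sum.elim (fun j => j) S.input with hp
  set Y : ℕ → Ω → Fin N → ℝ := fun k ω => residualLabels S y σ
    (samplePrior S (T₀ k) fun i => a i ω) fun i => b i ω with hY
  -- the labels and the limit, as continuous functions of finitely many values
  set L : (J ⊕ Fin N → ℝ) × (Fin N → ℝ) → Fin N → ℝ := fun v i =>
    y i - σ * v.1 (.inr i) + v.2 i with hL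
  have hLc : Continuous L := by fun_prop
  set G : (J ⊕ Fin N → ℝ) × (Fin N → ℝ) → J → ℝ := fun v j =>
    σ * v.1 (.inl j) + posteriorMean S (δ ^ 2 / σ ^ 2) (L v) j with hG
  have hGc : Continuous G := continuous_pi fun j =>
    (by fun_prop : Continuous fun v : (J ⊕ Fin N → ℝ) × (Fin N → ℝ) => σ * v.1 (.inl j)).add
      ((continuous_posteriorMean S _ j.1).comp hLc)
  have h1 := tendstoInDistribution_comp_samplePrior S hbm hab hh hhb hT₀ p hGc
  have h2 := tendstoInDistribution_comp_samplePrior S hbm hab hh hhb hT₀ p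
    (G := fun v => ∑ i, L v i ^ 2) (by fun_prop)
  have hZm : ∀ k, Measurable fun ω i => samplePrior S (T₀ k) (fun i => a i ω) (S.input i) :=
    fun k => measurable_pi_lambda _ fun i =>
      measurable_samplePrior S (T₀ k) (a := fun ω i => a i ω) ham _
  have hφ : ∀ T, Measurable fun (a : PriorSeed d n → ℝ) i => samplePrior S T a (S.input i) :=
    fun T => measurable_pi_lambda _ fun j =>
      measurable_samplePrior S T (a := id) measurable_pi_apply _
  have hu := fun k => isAdaptedNoise_train (P := P) (hZm k) hbm hb hb_law
    (hab.comp (hφ (T₀ k)) measurable_id)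
  have hYm : ∀ k i, Measurable[pastOf (fun ω i => samplePrior S (T₀ k) (fun i => a i ω) (S.input i))
      b 0] fun ω => Y k ω i := fun k i => by
    have e1 := (measurable_pi_apply i).comp (measurable_pastOf
      (fun ω i => samplePrior S (T₀ k) (fun i => a i ω) (S.input i)) b 0)
    have e2 : Measurable[pastOf (fun ω i => samplePrior S (T₀ k) (fun i => a i ω) (S.input i)) b 0]
        (b (.label i)) := comap_le_pastOf _ b (τ := 0) (fun τ' i' s e => by cases e)
    exact ((e1.const_mul σ).const_sub (y i)).add e2
  refine tendstoInDistribution_of_tendstoInMeasure_sub _ _ h1 (tendstoInMeasure_pi fun j => ?_)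
    fun k => ?_
  · have h3 := tendstoInMeasure_boostErr hN S hlam hT₁ hu (Y := Y) hYm h2 j.1
    refine h3.congr_left fun k => Eventually.of_forall fun ω => ?_
    simp only [boostErr, Pi.sub_apply, samplePosterior, residualFit, hG]
    exact (add_sub_add_left_eq_sub _ _ _).symm
  · refine (measurable_pi_lambda _ fun j : J => ?_).aemeasurable
    exact ((measurable_samplePrior S (T₀ k) (a := fun ω i => a i ω) ham j.1).const_mul σ).add
      (measurable_trainGBDT S (ε k) (β k) _ (Y := Y k)
        (fun i => (hYm k i).mono ((hu k).le 0) le_rfl) (u := fun ω τ i s => b (.unif τ i s) ω)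
        (fun τ _ i s => hbm _) j.1)

end Posterior

/-! ### Gaussian processes driven by finitely many normal variables -/

section GaussianProcess

variable {Ω : Type*} {mΩ : MeasurableSpace Ω} {P : Measure Ω}

lemma hasGaussianLaw_const_add {E : Type*} [NormedAddCommGroup E] [NormedSpace ℝ E]
    [MeasurableSpace E] [BorelSpace E] [CompleteSpace E] [SecondCountableTopology E]
    {X : Ω → E} (hX : HasGaussianLaw X P) (c : E) :
    HasGaussianLaw (fun ω => c + X ω) P := by
  have := hX.isGaussian_map
  refine ⟨?_⟩
  have h : P.map (fun ω => c + X ω) = (P.map X).map (fun x => c + x) := by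
    rw [AEMeasurable.map_map_of_aemeasurable (by fun_prop) hX.aemeasurable]; rfl
  rw [h]
  infer_instance

lemma IsGP.congr {T : Type*} {Y Y' : T → Ω → ℝ} {μ : T → ℝ} {C : T → T → ℝ} (h : IsGP P Y μ C)
    (hY : ∀ t, Y t =ᵐ[P] Y' t) : IsGP P Y' μ C := by
  refine ⟨h.1.congr hY, fun t => ?_, fun t t' => ?_⟩
  · rw [← h.2.1 t]
    exact integral_congr_ae ((hY t).symm)
  · rw [← h.2.2 t t']
    have e : ∀ t, ∫ ω, Y' t ω ∂P = ∫ ω, Y t ω ∂P := fun t => integral_congr_ae (hY t).symm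
    simp only [covariance, e]
    refine integral_congr_ae ?_
    filter_upwards [hY t, hY t'] with ω h1 h2
    rw [h1, h2]

/-- Affine functions of a centered Gaussian vector `U`, plus an independent centered Gaussian
process, form a Gaussian process. -/
lemma isGP_const_add_sum_add [IsProbabilityMeasure P] {T κ : Type*} [Fintype κ] {U : κ → Ω → ℝ}
    {Γ : κ → κ → ℝ} (hU : HasGaussianLaw (fun ω q => U q ω) P) (hU0 : ∀ q, ∫ ω, U q ω ∂P = 0)
    (hUc : ∀ q q', cov[U q, U q'; P] = Γ q q') {W : T → Ω → ℝ} {D : T → T → ℝ}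
    (hW : IsGP P W (fun _ => 0) D) (hUW : IndepFun (fun ω q => U q ω) (fun ω t => W t ω) P)
    (c : T → ℝ) (A : T → κ → ℝ) :
    IsGP P (fun t ω => c t + ∑ q, A t q * U q ω + W t ω) c
      (fun t t' => ∑ q, A t q * ∑ q', A t' q' * Γ q q' + D t t') := by
  have hUm : ∀ q, MemLp (U q) 2 P := fun q => (hU.eval q).memLp_two
  have hWm : ∀ t, MemLp (W t) 2 P := fun t => (hW.1.hasGaussianLaw_eval t).memLp_two
  have hsm : ∀ t, MemLp (fun ω => ∑ q, A t q * U q ω) 2 P := fun t =>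
    memLp_finsetSum _ fun q _ => (hUm q).const_mul _
  have hind : ∀ t t', IndepFun (fun ω => ∑ q, A t q * U q ω) (W t') P := fun t t' =>
    hUW.comp (φ := fun v : κ → ℝ => ∑ q, A t q * v q) (ψ := fun w : T → ℝ => w t') (by fun_prop)
      (by fun_prop)
  refine ⟨⟨fun I => ?_⟩, fun t => ?_, fun t t' => ?_⟩
  · have h1 : HasGaussianLaw (fun ω => ((fun q => U q ω), I.restrict (fun t => W t ω))) P :=
      IndepFun.hasGaussianLaw hU (hW.1.hasGaussianLaw I)
        (hUW.comp (φ := id) (ψ := fun w : T → ℝ => I.restrict w) measurable_id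
          (Finset.measurable_restrict I))
    set L : (κ → ℝ) × (I → ℝ) →L[ℝ] (I → ℝ) := ContinuousLinearMap.pi fun t =>
      ∑ q, A t q • (ContinuousLinearMap.proj q).comp (ContinuousLinearMap.fst ℝ (κ → ℝ) (I → ℝ)) +
        (ContinuousLinearMap.proj t).comp (ContinuousLinearMap.snd ℝ (κ → ℝ) (I → ℝ)) with hL
    have h2 := hasGaussianLaw_const_add (h1.map_fun L) fun t : I => c t
    have h3 : (fun ω => I.restrict fun t => c t + ∑ q, A t q * U q ω + W t ω) =
        fun ω => (fun t : I => c t) + L ((fun q => U q ω), I.restrict fun t => W t ω) := by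
      funext ω t
      simp [hL, add_assoc]
    rw [h3]
    exact h2
  · have i1 := (hsm t).integrable (by norm_num)
    have i2 := (hWm t).integrable (by norm_num)
    have e1 : ∫ ω, ∑ q, A t q * U q ω ∂P = 0 := by
      rw [integral_finsetSum _ fun q _ => ((hUm q).integrable (by norm_num)).const_mul _]
      simp [integral_const_mul, hU0]
    rw [integral_add (by fun_prop) i2, integral_add (by fun_prop) i1, e1, hW.2.1 t]
    simp
  · have e0 : ∀ t, (fun ω => c t + ∑ q, A t q * U q ω + W t ω) =
        fun ω => c t + ((fun ω => ∑ q, A t q * U q ω) + W t) ω := fun t => by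
      funext ω; simp [add_assoc]
    have hadd : ∀ t, MemLp ((fun ω => ∑ q, A t q * U q ω) + W t) 2 P := fun t =>
      (hsm t).add (hWm t)
    change cov[fun ω => c t + ∑ q, A t q * U q ω + W t ω,
      fun ω => c t' + ∑ q, A t' q * U q ω + W t' ω; P] = _
    rw [e0 t, e0 t', covariance_const_add_left ((hadd t).integrable (by norm_num)),
      covariance_const_add_right ((hadd t').integrable (by norm_num)),
      covariance_add_left (hsm t) (hWm t) (hadd t'), covariance_add_right (hsm t) (hsm t') (hWm t'),
      covariance_add_right (hWm t) (hsm t') (hWm t'),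
      (hind t t').covariance_eq_zero (hsm t) (hWm t'),
      (hind t' t).symm.covariance_eq_zero (hWm t) (hsm t'), hW.2.2 t t',
      covariance_fun_sum_fun_sum (fun q => (hUm q).const_mul _) fun q => (hUm q).const_mul _]
    simp only [add_zero, zero_add, covariance_const_mul_left, covariance_const_mul_right, hUc,
      Finset.mul_sum]
    congr 1
    exact Finset.sum_congr rfl fun q _ => Finset.sum_congr rfl fun q' _ => by ring

end GaussianProcess

/-! ### The posterior covariance as a covariance of regression errors -/

section PosteriorLaw

variable {d n N : ℕ}

/-- The normal variables that drive the limit of the posterior samples: the values of the prior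
sample on the leaves of the full tree, and the label noise. -/
noncomputable def posteriorData (S : TreeSpec d n N) (h : EuclideanSpace ℝ (Fin d) → ℝ)
    (b : TrainSeed d n N → ℝ) : Finset (Split d n) ⊕ Fin N → ℝ
  | .inl ℓ => h (leafPoint S ℓ)
  | .inr j => b (.label j)

/-- The covariance of `posteriorData`. -/
noncomputable def dataCov (S : TreeSpec d n N) (δ : ℝ) :
    Finset (Split d n) ⊕ Fin N → Finset (Split d n) ⊕ Fin N → ℝ
  | .inl ℓ, .inl ℓ' => kernel S (leafPoint S ℓ) (leafPoint S ℓ')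
  | .inr i, .inr j => open Classical in if i = j then δ ^ 2 else 0
  | _, _ => 0

/-- The coefficients of the limit of the posterior samples at `z` with respect to
`posteriorData`. -/
noncomputable def posteriorCoef (S : TreeSpec d n N) (σ lam : ℝ) (z : EuclideanSpace ℝ (Fin d)) :
    Finset (Split d n) ⊕ Fin N → ℝ
  | .inl ℓ => σ * (leafInd S Finset.univ ℓ z -
      ∑ j, krigingWeight S lam z j * leafInd S Finset.univ ℓ (S.input j))
  | .inr j => krigingWeight S lam z j

lemma sum_leafInd_univ_mul (S : TreeSpec d n N) (F : Finset (Split d n) → ℝ)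
    (z : EuclideanSpace ℝ (Fin d)) :
    ∑ ℓ, leafInd S Finset.univ ℓ z * F ℓ = F (leafOf S Finset.univ z) := by
  simp [leafInd]

lemma sum_posteriorCoef_inl_mul (S : TreeSpec d n N) (σ lam : ℝ) (F : Finset (Split d n) → ℝ)
    (z : EuclideanSpace ℝ (Fin d)) :
    ∑ ℓ, posteriorCoef S σ lam z (.inl ℓ) * F ℓ = σ * (F (leafOf S Finset.univ z) -
      ∑ j, krigingWeight S lam z j * F (leafOf S Finset.univ (S.input j))) := by
  simp only [posteriorCoef, ← sum_leafInd_univ_mul S F, Finset.mul_sum, mul_assoc, sub_mul,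
    Finset.sum_mul]
  rw [← Finset.mul_sum, Finset.sum_sub_distrib, Finset.sum_comm (s := Finset.univ (α := Fin N))]

/-- The limit of the posterior samples as an affine function of `posteriorData`, for a prior sample
that is constant on leaves. -/
lemma prior_add_correction_eq (S : TreeSpec d n N) (y : Fin N → ℝ) (σ lam : ℝ)
    (h : EuclideanSpace ℝ (Fin d) → ℝ) (b : TrainSeed d n N → ℝ) (z : EuclideanSpace ℝ (Fin d))
    (hz : h z = h (leafPoint S (leafOf S Finset.univ z)))
    (hx : ∀ i, h (S.input i) = h (leafPoint S (leafOf S Finset.univ (S.input i)))) :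
    σ * h z + posteriorMean S lam (residualLabels S y σ h b) z =
      posteriorMean S lam y z + ∑ q, posteriorCoef S σ lam z q * posteriorData S h b q := by
  rw [Fintype.sum_sum_type]
  simp only [posteriorData]
  rw [sum_posteriorCoef_inl_mul S σ lam (fun ℓ => h (leafPoint S ℓ)), ← hz]
  simp only [← hx, posteriorMean_eq_krigingWeight, posteriorCoef, residualLabels, mul_add, mul_sub,
    Finset.sum_add_distrib, Finset.sum_sub_distrib, Finset.mul_sum]
  have : ∀ i, krigingWeight S lam z i * (σ * h (S.input i)) =
    σ * (krigingWeight S lam z i * h (S.input i)) := fun i => by ring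
  simp only [this]
  ring

lemma kernel_leafPoint_left (S : TreeSpec d n N) (z t : EuclideanSpace ℝ (Fin d)) :
    kernel S (leafPoint S (leafOf S Finset.univ z)) t = kernel S z t :=
  kernel_congr_left S (leafOf_leafPoint S z) t

lemma kernel_leafPoint_right (S : TreeSpec d n N) (z t : EuclideanSpace ℝ (Fin d)) :
    kernel S t (leafPoint S (leafOf S Finset.univ z)) = kernel S t z := by
  rw [kernel_comm, kernel_leafPoint_left, kernel_comm]

/-- The covariance of the prior sample corrected by regression on noisy residual labels is the
posterior covariance: this is where the regularization has to equal the noise-to-signal ratio. -/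
lemma sum_posteriorCoef_mul_dataCov (S : TreeSpec d n N) {σ δ lam : ℝ} (hlam : 0 < lam)
    (hδ : δ ^ 2 = σ ^ 2 * lam) (z z' : EuclideanSpace ℝ (Fin d)) :
    ∑ q, posteriorCoef S σ lam z q * ∑ q', posteriorCoef S σ lam z' q' * dataCov S δ q q' =
      posteriorCov S σ lam z z' := by
  classical
  have h1 : ∀ ℓ, ∑ q', posteriorCoef S σ lam z' q' * dataCov S δ (.inl ℓ) q' =
      σ * (kernel S (leafPoint S ℓ) z' -
        ∑ j, krigingWeight S lam z' j * kernel S (leafPoint S ℓ) (S.input j)) := fun ℓ => by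
    rw [Fintype.sum_sum_type]
    simp only [dataCov, mul_zero, Finset.sum_const_zero, add_zero]
    rw [sum_posteriorCoef_inl_mul S σ lam (fun ℓ' => kernel S (leafPoint S ℓ) (leafPoint S ℓ'))]
    simp only [kernel_leafPoint_right]
  have h2 : ∀ i, ∑ q', posteriorCoef S σ lam z' q' * dataCov S δ (.inr i) q' =
      δ ^ 2 * krigingWeight S lam z' i := fun i => by
    rw [Fintype.sum_sum_type]
    simp [dataCov, posteriorCoef, mul_comm]
  -- the normal equations of the kriging weights
  have h3 : ∀ j, ∑ i, krigingWeight S lam z i * kernel S (S.input i) (S.input j) =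
      kernel S z (S.input j) - lam * krigingWeight S lam z j := fun j => by
    rw [← sum_krigingWeight_mul_regGram S hlam z j]
    simp [regGram_apply, mul_add, Finset.sum_add_distrib, mul_comm]
  rw [Fintype.sum_sum_type]
  simp only [h1, h2]
  rw [sum_posteriorCoef_inl_mul S σ lam (fun ℓ => σ * (kernel S (leafPoint S ℓ) z' -
        ∑ j, krigingWeight S lam z' j * kernel S (leafPoint S ℓ) (S.input j)))]
  simp only [kernel_leafPoint_left, posteriorCov_eq]
  have h4 : ∑ i, krigingWeight S lam z i * (σ * (kernel S (S.input i) z' -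
      ∑ j, krigingWeight S lam z' j * kernel S (S.input i) (S.input j))) =
      σ * (∑ i, krigingWeight S lam z i * kernel S (S.input i) z' -
        ∑ j, krigingWeight S lam z' j *
          (kernel S z (S.input j) - lam * krigingWeight S lam z j)) := by
    simp only [← h3, Finset.mul_sum, mul_sub, Finset.sum_sub_distrib]
    congr 1
    · exact Finset.sum_congr rfl fun i _ => by ring
    · rw [Finset.sum_comm]
      exact Finset.sum_congr rfl fun i _ => Finset.sum_congr rfl fun j _ => by ring
  rw [h4]
  have h5 : ∑ i, posteriorCoef S σ lam z (.inr i) * (δ ^ 2 * krigingWeight S lam z' i) =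
      σ ^ 2 * ∑ j, krigingWeight S lam z' j * (lam * krigingWeight S lam z j) := by
    simp only [posteriorCoef, hδ, Finset.mul_sum]
    exact Finset.sum_congr rfl fun j _ => by ring
  rw [h5]
  simp only [mul_sub, Finset.sum_sub_distrib]
  ring

end PosteriorLaw

/-! ### Moments of the limit of the prior samples -/

section PosteriorProcess

variable {d n N : ℕ} {Ω : Type*} {mΩ : MeasurableSpace Ω} {P : Measure Ω} [IsProbabilityMeasure P]

/-- The law of a limit of the prior samples at finitely many points. -/
lemma priorLimit_moments (S : TreeSpec d n N) {a : PriorSeed d n → Ω → ℝ}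
    (ham : ∀ i, Measurable (a i)) (ha : iIndepFun a P) (ha_law : ∀ i, HasLaw (a i) i.law P)
    {h : EuclideanSpace ℝ (Fin d) → Ω → ℝ} (hhm : ∀ z, Measurable (h z))
    (hh : TendstoFDD P P (fun T z ω => samplePrior S T (fun i => a i ω) z) h)
    {J : Type*} [Fintype J] (z : J → EuclideanSpace ℝ (Fin d)) :
    HasGaussianLaw (fun ω j => h (z j) ω) P ∧ (∀ j, ∫ ω, h (z j) ω ∂P = 0) ∧
      ∀ j j', cov[h (z j), h (z j'); P] = kernel S (z j) (z j') := by
  classical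
  have hmap := map_eq_map_priorLimit S ham ha ha_law hh z
  have hX : AEMeasurable (fun ω j => h (z j) ω) P := by fun_prop
  have hev : ∀ (μ : Measure (J → ℝ)) j, AEStronglyMeasurable (fun v : J → ℝ => v j) μ := fun μ j =>
    (measurable_pi_apply j).aestronglyMeasurable
  have hpm : ∀ t, Measurable (priorLimit S t) := measurable_priorLimit S
  have hX' : AEMeasurable (fun g j => priorLimit S (z j) g) (coefLaw d n) :=
    (measurable_pi_lambda _ fun j => hpm (z j)).aemeasurable
  have hg2 : ∀ p, MemLp (fun g : Finset (Split d n) × Finset (Split d n) → ℝ => g p) 2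
      (coefLaw d n) := fun p => (hasLaw_eval_coefLaw p).hasGaussianLaw.memLp_two
  have hg : HasGaussianLaw (fun (g : Finset (Split d n) × Finset (Split d n) → ℝ) p => g p)
      (coefLaw d n) :=
    (iIndepFun_coefLaw d n).hasGaussianLaw fun p => (hasLaw_eval_coefLaw p).hasGaussianLaw
  refine ⟨⟨?_⟩, fun j => ?_, fun j j' => ?_⟩
  · rw [hmap]
    set L : (Finset (Split d n) × Finset (Split d n) → ℝ) →L[ℝ] (J → ℝ) :=
      ContinuousLinearMap.pi fun j => ∑ p, feature S p (z j) • ContinuousLinearMap.proj p with hL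
    have h2 : (fun g j => priorLimit S (z j) g) = fun g => L fun p => g p := by
      funext g j
      simp [hL, priorLimit]
    rw [h2]
    exact (hg.map_fun L).isGaussian_map
  · have e1 : ∫ ω, h (z j) ω ∂P = ∫ v, v j ∂(P.map fun ω j => h (z j) ω) := by
      rw [integral_map hX (hev _ j)]
    rw [e1, hmap, integral_map hX' (hev _ j)]
    simp only [priorLimit]
    rw [integral_finsetSum _ fun p _ => ((hg2 p).integrable (by norm_num)).const_mul _]
    refine Finset.sum_eq_zero fun p _ => ?_
    rw [integral_const_mul, (hasLaw_eval_coefLaw p).integral_eq, integral_id_gaussianReal, mul_zero]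
  · have e1 : cov[h (z j), h (z j'); P] =
        cov[fun v => v j, fun v => v j'; P.map fun ω j => h (z j) ω] := by
      rw [covariance_map_fun (hev _ j) (hev _ j') hX]
    rw [e1, hmap, covariance_map_fun (hev _ j) (hev _ j') hX', kernel_eq_sum_feature]
    simp only [priorLimit]
    rw [covariance_fun_sum_fun_sum (fun p => (hg2 p).const_mul _) fun p => (hg2 p).const_mul _]
    refine Finset.sum_congr rfl fun p _ => ?_
    rw [Finset.sum_eq_single p]
    · rw [covariance_const_mul_left, covariance_const_mul_right,
        covariance_self (hg2 p).aemeasurable, (hasLaw_eval_coefLaw p).variance_eq,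
        variance_id_gaussianReal]
      simp
    · intro p' _ hp
      rw [covariance_const_mul_left, covariance_const_mul_right,
        ((iIndepFun_coefLaw d n).indepFun hp.symm).covariance_eq_zero (hg2 p) (hg2 p')]
      simp
    · simp

/-- A limit of the prior samples is almost surely constant on each leaf of the full tree, at given
points. -/
lemma ae_eq_leafPoint (S : TreeSpec d n N) {a : PriorSeed d n → Ω → ℝ}
    (ham : ∀ i, Measurable (a i)) (ha : iIndepFun a P) (ha_law : ∀ i, HasLaw (a i) i.law P)
    {h : EuclideanSpace ℝ (Fin d) → Ω → ℝ} (hhm : ∀ z, Measurable (h z))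
    (hh : TendstoFDD P P (fun T z ω => samplePrior S T (fun i => a i ω) z) h)
    (z : EuclideanSpace ℝ (Fin d)) :
    ∀ᵐ ω ∂P, h z ω = h (leafPoint S (leafOf S Finset.univ z)) ω := by
  set p : Bool → EuclideanSpace ℝ (Fin d) :=
    fun j => if j then z else leafPoint S (leafOf S Finset.univ z) with hp
  have hmap := map_eq_map_priorLimit S ham ha ha_law hh p
  have hX : AEMeasurable (fun ω j => h (p j) ω) P := by fun_prop
  have hX' : AEMeasurable (fun g j => priorLimit S (p j) g) (coefLaw d n) :=
    (measurable_pi_lambda _ fun j => measurable_priorLimit S (p j)).aemeasurable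
  have hset : MeasurableSet {v : Bool → ℝ | v true = v false} :=
    measurableSet_eq_fun (by fun_prop) (by fun_prop)
  have h1 : ∀ᵐ v ∂((coefLaw d n).map fun g j => priorLimit S (p j) g), v true = v false := by
    rw [ae_map_iff hX' hset]
    refine Eventually.of_forall fun g => ?_
    exact Finset.sum_congr rfl fun q _ => by
      simp only [hp, feature, if_true, Bool.false_eq_true, if_false,
        leafInd_congr S (leafOf_leafPoint S z)]
  rw [← hmap, ae_map_iff hX hset] at h1
  simpa [hp] using h1

/-- The law of the variables that drive the limit of the posterior samples. -/
lemma posteriorData_moments (S : TreeSpec d n N) {δ : ℝ} {a : PriorSeed d n → Ω → ℝ}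
    {b : TrainSeed d n N → Ω → ℝ} (ham : ∀ i, Measurable (a i))
    (ha : iIndepFun a P) (ha_law : ∀ i, HasLaw (a i) i.law P)
    (hb : iIndepFun b P) (hb_law : ∀ i, HasLaw (b i) (i.law δ) P)
    {h : EuclideanSpace ℝ (Fin d) → Ω → ℝ} (hhm : ∀ z, Measurable (h z))
    (hh : TendstoFDD P P (fun T z ω => samplePrior S T (fun i => a i ω) z) h)
    (hhb : IndepFun (fun ω z => h z ω) (fun ω i => b i ω) P) :
    HasGaussianLaw (fun ω q => posteriorData S (fun z => h z ω) (fun i => b i ω) q) P ∧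
      (∀ q, ∫ ω, posteriorData S (fun z => h z ω) (fun i => b i ω) q ∂P = 0) ∧
      ∀ q q', cov[fun ω => posteriorData S (fun z => h z ω) (fun i => b i ω) q,
        fun ω => posteriorData S (fun z => h z ω) (fun i => b i ω) q'; P] = dataCov S δ q q' := by
  classical
  obtain ⟨hG, h0, hc⟩ := priorLimit_moments S ham ha ha_law hhm hh (leafPoint S)
  have hlabel : ∀ j : Fin N, HasLaw (b (.label j)) (gaussianReal 0 (Real.toNNReal (δ ^ 2))) P :=
    fun j => hb_law (.label j)
  have hbi : iIndepFun (fun j : Fin N => b (.label j)) P :=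
    hb.precomp (g := TrainSeed.label) fun i j e => by simpa using e
  have hB : HasGaussianLaw (fun ω (j : Fin N) => b (.label j) ω) P :=
    hbi.hasGaussianLaw fun j => (hlabel j).hasGaussianLaw
  have hind : IndepFun (fun ω ℓ => h (leafPoint S ℓ) ω) (fun ω (j : Fin N) => b (.label j) ω) P :=
    hhb.comp (φ := fun (v : EuclideanSpace ℝ (Fin d) → ℝ) ℓ => v (leafPoint S ℓ))
      (ψ := fun (w : TrainSeed d n N → ℝ) (j : Fin N) => w (.label j)) (by fun_prop) (by fun_prop)
  have hb2 : ∀ j : Fin N, MemLp (b (.label j)) 2 P := fun j => (hlabel j).hasGaussianLaw.memLp_two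
  have hh2 : ∀ ℓ, MemLp (h (leafPoint S ℓ)) 2 P := fun ℓ => (hG.eval ℓ).memLp_two
  have hcross : ∀ ℓ j, cov[h (leafPoint S ℓ), b (.label j); P] = 0 := fun ℓ j =>
    IndepFun.covariance_eq_zero (hind.comp (φ := fun v : Finset (Split d n) → ℝ => v ℓ)
      (ψ := fun w : Fin N → ℝ => w j) (by fun_prop) (by fun_prop)) (hh2 ℓ) (hb2 j)
  refine ⟨?_, ?_, ?_⟩
  · set L : (Finset (Split d n) → ℝ) × (Fin N → ℝ) →L[ℝ] (Finset (Split d n) ⊕ Fin N → ℝ) :=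
      ContinuousLinearMap.pi (Sum.rec
        (fun ℓ => (ContinuousLinearMap.proj ℓ).comp (ContinuousLinearMap.fst ℝ _ _))
        (fun j => (ContinuousLinearMap.proj j).comp (ContinuousLinearMap.snd ℝ _ _))) with hL
    have h1 := (IndepFun.hasGaussianLaw hG hB hind).map_fun L
    have h2 : (fun ω q => posteriorData S (fun z => h z ω) (fun i => b i ω) q) =
        fun ω => L ((fun ℓ => h (leafPoint S ℓ) ω), fun j => b (.label j) ω) := by
      funext ω q
      rcases q with ℓ | j <;> rfl
    rw [h2]
    exact h1
  · rintro (ℓ | j)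
    · exact h0 ℓ
    · exact (hlabel j).integral_eq.trans integral_id_gaussianReal
  · rintro (ℓ | i) (ℓ' | j)
    · exact hc ℓ ℓ'
    · exact hcross ℓ j
    · exact (covariance_comm _ _).trans (hcross ℓ' i)
    · change cov[b (.label i), b (.label j); P] = if i = j then δ ^ 2 else 0
      split_ifs with hij
      · subst hij
        rw [covariance_self (hb2 i).aemeasurable, (hlabel i).variance_eq, variance_id_gaussianReal,
          Real.coe_toNNReal _ (sq_nonneg δ)]
      · exact (hbi.indepFun hij).covariance_eq_zero (hb2 i) (hb2 j)

lemma measurable_posteriorData (S : TreeSpec d n N) :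
    Measurable fun p : (EuclideanSpace ℝ (Fin d) → ℝ) × (TrainSeed d n N → ℝ) =>
      posteriorData S p.1 p.2 :=
  measurable_pi_lambda _ fun q => by
    rcases q with ℓ | j
    · exact (measurable_pi_apply (leafPoint S ℓ)).comp measurable_fst
    · exact (measurable_pi_apply (TrainSeed.label j)).comp measurable_snd

lemma posteriorCoef_leafPoint (S : TreeSpec d n N) (σ lam : ℝ) (z : EuclideanSpace ℝ (Fin d))
    (q : Finset (Split d n) ⊕ Fin N) :
    posteriorCoef S σ lam z q =
      posteriorCoef S σ lam (leafPoint S (leafOf S Finset.univ z)) q := by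
  have h := (leafOf_leafPoint S z).symm
  rcases q with ℓ | j
  · simp only [posteriorCoef, leafInd_congr S h, krigingWeight_congr S lam h]
  · exact krigingWeight_congr S lam h j

lemma posteriorMean_leafPoint (S : TreeSpec d n N) (lam : ℝ) (v : Fin N → ℝ)
    (z : EuclideanSpace ℝ (Fin d)) :
    posteriorMean S lam v z = posteriorMean S lam v (leafPoint S (leafOf S Finset.univ z)) := by
  simp only [posteriorMean_eq_krigingWeight, krigingWeight_congr S lam (leafOf_leafPoint S z).symm]

lemma measurable_of_leafPoint (S : TreeSpec d n N) {φ : EuclideanSpace ℝ (Fin d) → ℝ}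
    (hφ : ∀ z, φ z = φ (leafPoint S (leafOf S Finset.univ z))) : Measurable φ := by
  have h := measurable_select (t := leafOf S Finset.univ)
    (fun ℓ => measurableSet_leafOf S Finset.univ ℓ)
    (F := fun ℓ _ => φ (leafPoint S ℓ)) fun ℓ => measurable_const
  simpa only [← hφ] using h

lemma norm_le_of_leafPoint (S : TreeSpec d n N) {φ : EuclideanSpace ℝ (Fin d) → ℝ}
    (hφ : ∀ z, φ z = φ (leafPoint S (leafOf S Finset.univ z))) (z : EuclideanSpace ℝ (Fin d)) :
    ‖φ z‖ ≤ ∑ ℓ, ‖φ (leafPoint S ℓ)‖ := by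
  rw [hφ]
  exact Finset.single_le_sum (f := fun ℓ => ‖φ (leafPoint S ℓ)‖)
    (fun _ _ => norm_nonneg _) (Finset.mem_univ _)

lemma integrable_mul_of_leafPoint (S : TreeSpec d n N) {φ : EuclideanSpace ℝ (Fin d) → ℝ}
    (hφ : ∀ z, φ z = φ (leafPoint S (leafOf S Finset.univ z)))
    {ρ : Measure (EuclideanSpace ℝ (Fin d))} {g : EuclideanSpace ℝ (Fin d) → ℝ}
    (hg : Integrable g ρ) : Integrable (fun z => φ z * g z) ρ :=
  hg.bdd_mul (measurable_of_leafPoint S hφ).aestronglyMeasurable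
    (Eventually.of_forall (norm_le_of_leafPoint S hφ))

end PosteriorProcess

/-! ### Law of the posterior -/

section PosteriorNoise

variable {d n N : ℕ} {Ω : Type*} {mΩ : MeasurableSpace Ω} {P : Measure Ω} [IsProbabilityMeasure P]

lemma ae_prior_add_correction_eq (S : TreeSpec d n N) (y : Fin N → ℝ) (σ lam : ℝ)
    {a : PriorSeed d n → Ω → ℝ} {b : TrainSeed d n N → Ω → ℝ}
    (ham : ∀ i, Measurable (a i)) (ha : iIndepFun a P) (ha_law : ∀ i, HasLaw (a i) i.law P)
    {h : EuclideanSpace ℝ (Fin d) → Ω → ℝ} (hhm : ∀ z, Measurable (h z))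
    (hh : TendstoFDD P P (fun T z ω => samplePrior S T (fun i => a i ω) z) h)
    (z : EuclideanSpace ℝ (Fin d)) :
    ∀ᵐ ω ∂P, σ * h z ω +
        posteriorMean S lam (residualLabels S y σ (fun z => h z ω) fun i => b i ω) z =
      posteriorMean S lam y z + ∑ q, posteriorCoef S σ lam z q *
        posteriorData S (fun z => h z ω) (fun i => b i ω) q := by
  filter_upwards [ae_eq_leafPoint S ham ha ha_law hhm hh z,
    ae_all_iff.2 fun i => ae_eq_leafPoint S ham ha ha_law hhm hh (S.input i)] with ω h1 h2
  exact prior_add_correction_eq S y σ lam (fun z => h z ω) (fun i => b i ω) z h1 h2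

/-- With observation noise that is independent across points, the limit of the posterior samples
is the Gaussian process posterior. -/
lemma isGP_posterior (S : TreeSpec d n N) (y : Fin N → ℝ) {σ δ : ℝ} (hσ : 0 < σ) (hδ : 0 < δ)
    {a : PriorSeed d n → Ω → ℝ} {b : TrainSeed d n N → Ω → ℝ}
    (ham : ∀ i, Measurable (a i)) (ha : iIndepFun a P) (ha_law : ∀ i, HasLaw (a i) i.law P)
    (hb : iIndepFun b P) (hb_law : ∀ i, HasLaw (b i) (i.law δ) P)
    {h : EuclideanSpace ℝ (Fin d) → Ω → ℝ} (hhm : ∀ z, Measurable (h z))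
    (hh : TendstoFDD P P (fun T z ω => samplePrior S T (fun i => a i ω) z) h)
    (hhb : IndepFun (fun ω z => h z ω) (fun ω i => b i ω) P)
    {η : EuclideanSpace ℝ (Fin d) → Ω → ℝ}
    {D : EuclideanSpace ℝ (Fin d) → EuclideanSpace ℝ (Fin d) → ℝ} (hη : IsGP P η (fun _ => 0) D)
    (hηi : IndepFun (fun ω => (fun z => h z ω, fun i => b i ω)) (fun ω z => η z ω) P) :
    IsGP P (fun z ω => σ * h z ω + posteriorMean S (δ ^ 2 / σ ^ 2)
        (residualLabels S y σ (fun z => h z ω) fun i => b i ω) z + η z ω)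
      (posteriorMean S (δ ^ 2 / σ ^ 2) y)
      fun z z' => posteriorCov S σ (δ ^ 2 / σ ^ 2) z z' + D z z' := by
  have hlam : 0 < δ ^ 2 / σ ^ 2 := by positivity
  have hδ2 : δ ^ 2 = σ ^ 2 * (δ ^ 2 / σ ^ 2) := by field_simp
  obtain ⟨hU, hU0, hUc⟩ := posteriorData_moments S ham ha ha_law hb hb_law hhm hh hhb
  have h1 := isGP_const_add_sum_add
    (U := fun q ω => posteriorData S (fun z => h z ω) (fun i => b i ω) q) hU hU0 hUc hη
    (hηi.comp (measurable_posteriorData S) measurable_id) (posteriorMean S (δ ^ 2 / σ ^ 2) y)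
    (posteriorCoef S σ (δ ^ 2 / σ ^ 2))
  simp only [sum_posteriorCoef_mul_dataCov S hlam hδ2] at h1
  refine h1.congr fun z => ?_
  filter_upwards [ae_prior_add_correction_eq S y σ (δ ^ 2 / σ ^ 2) (b := b) ham ha ha_law hhm hh z]
    with ω hω
  rw [hω]

lemma integrable_mul_posteriorCov_mul (S : TreeSpec d n N) {σ δ lam : ℝ} (hlam : 0 < lam)
    (hδ : δ ^ 2 = σ ^ 2 * lam) {ρ : Measure (EuclideanSpace ℝ (Fin d))} [SFinite ρ]
    {g g' : EuclideanSpace ℝ (Fin d) → ℝ} (hg : Integrable g ρ) (hg' : Integrable g' ρ) :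
    Integrable (fun p : EuclideanSpace ℝ (Fin d) × EuclideanSpace ℝ (Fin d) =>
        g p.1 * posteriorCov S σ lam p.1 p.2 * g' p.2) (ρ.prod ρ) ∧
      ∫ p, g p.1 * posteriorCov S σ lam p.1 p.2 * g' p.2 ∂(ρ.prod ρ) =
        ∑ q, (∫ z, posteriorCoef S σ lam z q * g z ∂ρ) *
          ∑ q', (∫ z, posteriorCoef S σ lam z q' * g' z ∂ρ) * dataCov S δ q q' := by
  have hexp : (fun p : EuclideanSpace ℝ (Fin d) × EuclideanSpace ℝ (Fin d) =>
      g p.1 * posteriorCov S σ lam p.1 p.2 * g' p.2) = fun p => ∑ q, ∑ q', dataCov S δ q q' *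
        ((posteriorCoef S σ lam p.1 q * g p.1) * (posteriorCoef S σ lam p.2 q' * g' p.2)) := by
    funext p
    rw [← sum_posteriorCoef_mul_dataCov S hlam hδ]
    simp only [Finset.mul_sum, Finset.sum_mul]
    exact Finset.sum_congr rfl fun q _ => Finset.sum_congr rfl fun q' _ => by ring
  have hi : ∀ q q', Integrable (fun p : EuclideanSpace ℝ (Fin d) × EuclideanSpace ℝ (Fin d) =>
      dataCov S δ q q' * ((posteriorCoef S σ lam p.1 q * g p.1) *
        (posteriorCoef S σ lam p.2 q' * g' p.2))) (ρ.prod ρ) := fun q q' =>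
    ((integrable_mul_of_leafPoint S (fun z => posteriorCoef_leafPoint S σ lam z q) hg).mul_prod
      (integrable_mul_of_leafPoint S (fun z => posteriorCoef_leafPoint S σ lam z q') hg')).const_mul
        _
  rw [hexp]
  refine ⟨integrable_finsetSum _ fun q _ => integrable_finsetSum _ fun q' _ => hi q q', ?_⟩
  rw [integral_finsetSum _ fun q _ => integrable_finsetSum _ fun q' _ => hi q q']
  refine Finset.sum_congr rfl fun q _ => ?_
  rw [integral_finsetSum _ fun q' _ => hi q q', Finset.mul_sum]
  refine Finset.sum_congr rfl fun q' _ => ?_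
  rw [integral_const_mul, integral_prod_mul (μ := ρ) (ν := ρ)
    (fun z => posteriorCoef S σ lam z q * g z) (fun z => posteriorCoef S σ lam z q' * g' z)]
  ring

lemma ae_ae_eq_comm {E : Type*} [MeasurableSpace E] {ρ : Measure E} [SFinite ρ] {F G : E → Ω → ℝ}
    (hF : Measurable fun p : E × Ω => F p.1 p.2) (hG : Measurable fun p : E × Ω => G p.1 p.2)
    (h : ∀ z, ∀ᵐ ω ∂P, F z ω = G z ω) : ∀ᵐ ω ∂P, ∀ᵐ z ∂ρ, F z ω = G z ω :=
  (Measure.ae_ae_comm (p := fun z ω => F z ω = G z ω) (measurableSet_eq_fun hF hG)).1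
    (Eventually.of_forall h)

/-- Almost surely, the expansion in `posteriorData` holds at almost every point. -/
lemma ae_ae_prior_add_correction_eq (S : TreeSpec d n N)
    (ρ : Measure (EuclideanSpace ℝ (Fin d))) [IsProbabilityMeasure ρ] (y : Fin N → ℝ) (σ lam : ℝ)
    {a : PriorSeed d n → Ω → ℝ} {b : TrainSeed d n N → Ω → ℝ}
    (ham : ∀ i, Measurable (a i)) (hbm : ∀ i, Measurable (b i))
    (ha : iIndepFun a P) (ha_law : ∀ i, HasLaw (a i) i.law P)
    {h : EuclideanSpace ℝ (Fin d) → Ω → ℝ} (hhm : Measurable (Function.uncurry h))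
    (hh : TendstoFDD P P (fun T z ω => samplePrior S T (fun i => a i ω) z) h) :
    ∀ᵐ ω ∂P, ∀ᵐ z ∂ρ, σ * h z ω +
        posteriorMean S lam (residualLabels S y σ (fun z => h z ω) fun i => b i ω) z =
      posteriorMean S lam y z + ∑ q, posteriorCoef S σ lam z q *
        posteriorData S (fun z => h z ω) (fun i => b i ω) q := by
  have hhz : ∀ z, Measurable (h z) := fun z => hhm.comp measurable_prodMk_left
  have hYm : ∀ i, Measurable fun ω => residualLabels S y σ (fun z => h z ω) (fun i => b i ω) i :=
    fun i => (((hhz (S.input i)).const_mul σ).const_sub (y i)).add (hbm (.label i))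
  have hUm : ∀ q, Measurable fun ω => posteriorData S (fun z => h z ω) (fun i => b i ω) q := by
    rintro (ℓ | j)
    · exact hhz _
    · exact hbm _
  have hm : Measurable fun p : EuclideanSpace ℝ (Fin d) × Ω => posteriorMean S lam y p.1 :=
    (measurable_of_leafPoint S (posteriorMean_leafPoint S lam y)).comp measurable_fst
  have hq : ∀ q, Measurable fun p : EuclideanSpace ℝ (Fin d) × Ω => posteriorCoef S σ lam p.1 q *
      posteriorData S (fun z => h z p.2) (fun i => b i p.2) q := fun q =>
    ((measurable_of_leafPoint S fun z => posteriorCoef_leafPoint S σ lam z q).comp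
      measurable_fst).mul ((hUm q).comp measurable_snd)
  have hh' : Measurable fun p : EuclideanSpace ℝ (Fin d) × Ω => h p.1 p.2 := hhm
  have hf : Measurable fun p : EuclideanSpace ℝ (Fin d) × Ω => posteriorMean S lam
      (residualLabels S y σ (fun z => h z p.2) fun i => b i p.2) p.1 :=
    measurable_uncurry_posteriorMean S lam
      (Y := fun ω => residualLabels S y σ (fun z => h z ω) fun i => b i ω) hYm
  have h1 := (hh'.const_mul σ).add hf
  have h2 := hm.add (Finset.measurable_sum Finset.univ fun q _ => hq q)
  have h3 := ae_prior_add_correction_eq S y σ lam (b := b) ham ha ha_law hhz hh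
  exact ae_ae_eq_comm (ρ := ρ) (P := P) h1 h2 h3

/-- With white observation noise, the limit of the posterior samples is the Gaussian process
posterior in the weak sense. -/
lemma isWeakGP_posterior (S : TreeSpec d n N) (ρ : Measure (EuclideanSpace ℝ (Fin d)))
    [IsProbabilityMeasure ρ] (y : Fin N → ℝ) {σ δ : ℝ} (hσ : 0 < σ) (hδ : 0 < δ)
    {a : PriorSeed d n → Ω → ℝ} {b : TrainSeed d n N → Ω → ℝ}
    (ham : ∀ i, Measurable (a i)) (hbm : ∀ i, Measurable (b i))
    (ha : iIndepFun a P) (ha_law : ∀ i, HasLaw (a i) i.law P)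
    (hb : iIndepFun b P) (hb_law : ∀ i, HasLaw (b i) (i.law δ) P)
    {h : EuclideanSpace ℝ (Fin d) → Ω → ℝ} (hhm : Measurable (Function.uncurry h))
    (hh : TendstoFDD P P (fun T z ω => samplePrior S T (fun i => a i ω) z) h)
    (hhb : IndepFun (fun ω z => h z ω) (fun ω i => b i ω) P)
    {W : Lp ℝ 2 ρ → Ω → ℝ} (hW : IsWeakGP ρ P W (fun _ => 0) (fun _ _ => 0) δ)
    (hWi : IndepFun (fun ω => (fun z => h z ω, fun i => b i ω)) (fun ω g => W g ω) P) :
    IsWeakGP ρ P (fun g ω => ∫ z, (σ * h z ω + posteriorMean S (δ ^ 2 / σ ^ 2)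
        (residualLabels S y σ (fun z => h z ω) fun i => b i ω) z) * g z ∂ρ + W g ω)
      (posteriorMean S (δ ^ 2 / σ ^ 2) y) (posteriorCov S σ (δ ^ 2 / σ ^ 2)) δ := by
  set lam := δ ^ 2 / σ ^ 2 with hlam_def
  have hlam : 0 < lam := by positivity
  have hδ2 : δ ^ 2 = σ ^ 2 * lam := by rw [hlam_def]; field_simp
  have hm := posteriorMean_leafPoint S lam y
  have hmm : Measurable (posteriorMean S lam y) := measurable_of_leafPoint S hm
  have hcl := fun q z => posteriorCoef_leafPoint S σ lam z q
  have hgi : ∀ g : Lp ℝ 2 ρ, Integrable g ρ := fun g => (Lp.memLp g).integrable (by norm_num)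
  have hhz : ∀ z, Measurable (h z) := fun z => hhm.comp measurable_prodMk_left
  obtain ⟨hU, hU0, hUc⟩ := posteriorData_moments S ham ha ha_law hb hb_law hhz hh hhb
  have hW2 : IsGP P W (fun _ => 0) fun g g' => δ ^ 2 * inner ℝ g g' := by
    have h1 := hW.2.2
    simpa using h1
  have h1 := isGP_const_add_sum_add
    (U := fun q ω => posteriorData S (fun z => h z ω) (fun i => b i ω) q) hU hU0 hUc hW2
    (hWi.comp (measurable_posteriorData S) measurable_id)
    (fun g => ∫ z, posteriorMean S lam y z * g z ∂ρ)
    (fun g q => ∫ z, posteriorCoef S σ lam z q * g z ∂ρ)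
  have hcov := fun g g' : Lp ℝ 2 ρ => integrable_mul_posteriorCov_mul S hlam hδ2 (hgi g) (hgi g')
  simp only [← (hcov _ _).2] at h1
  refine ⟨MemLp.of_bound hmm.aestronglyMeasurable _
    (Eventually.of_forall (norm_le_of_leafPoint S hm)), fun g g' => (hcov g g').1, h1.congr ?_⟩
  have hae := ae_ae_prior_add_correction_eq S ρ y σ lam ham hbm ha ha_law hhm hh
  intro g
  filter_upwards [hae] with ω hω
  have e1 : ∫ z, (σ * h z ω + posteriorMean S lam
      (residualLabels S y σ (fun z => h z ω) fun i => b i ω) z) * g z ∂ρ =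
      ∫ z, (posteriorMean S lam y z * g z + ∑ q, posteriorCoef S σ lam z q * g z *
        posteriorData S (fun z => h z ω) (fun i => b i ω) q) ∂ρ := by
    refine integral_congr_ae ?_
    filter_upwards [hω] with z hz
    rw [hz, add_mul, Finset.sum_mul]
    congr 1
    exact Finset.sum_congr rfl fun q _ => by ring
  have hi := fun q => integrable_mul_of_leafPoint S (hcl q) (hgi g)
  rw [e1, integral_add (integrable_mul_of_leafPoint S hm (hgi g))
    (integrable_finsetSum _ fun q _ => (hi q).mul_const _),
    integral_finsetSum _ fun q _ => (hi q).mul_const _]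
  simp only [integral_mul_const]

end PosteriorNoise

/-! ### Modification on null sets -/

section Modification

variable {d n N : ℕ} {Ω : Type*} {mΩ : MeasurableSpace Ω} {P : Measure Ω}

instance : Countable (PriorSeed d n) := by
  refine Function.Injective.countable
    (β := (ℕ × ℕ × Split d n) ⊕ (ℕ × Finset (Split d n)))
    (f := fun | .unif τ i s => .inl (τ, i, s) | .leaf τ ℓ => .inr (τ, ℓ)) ?_
  rintro (⟨τ, i, s⟩ | ⟨τ, ℓ⟩) (⟨τ', i', s'⟩ | ⟨τ', ℓ'⟩) h <;> simp_all

instance : Countable (TrainSeed d n N) := by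
  refine Function.Injective.countable (β := Fin N ⊕ (ℕ × ℕ × Split d n))
    (f := fun | .label i => .inl i | .unif τ i s => .inr (τ, i, s)) ?_
  rintro (i | ⟨τ, i, s⟩) (i' | ⟨τ', i', s'⟩) h <;> simp_all

lemma TendstoFDD.congr {Ω' E : Type*} [MeasurableSpace Ω'] [IsProbabilityMeasure P]
    {P' : Measure Ω'} [IsProbabilityMeasure P'] {Y₁ Y₂ : ℕ → E → Ω → ℝ} {Y' : E → Ω' → ℝ}
    (h : TendstoFDD P P' Y₁ Y') (hY : ∀ᵐ ω ∂P, ∀ k z, Y₁ k z ω = Y₂ k z ω) :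
    TendstoFDD P P' Y₂ Y' := fun J =>
  (h J).congr (fun k => hY.mono fun _ hω => funext fun z => hω k z) EventuallyEq.rfl

lemma TendstoL2.congr {E : Type*} [MeasurableSpace E] {ρ : Measure E} {Y₁ Y₂ : ℕ → E → Ω → ℝ}
    {Y' : E → Ω → ℝ} (h : TendstoL2 ρ P Y₁ Y') (hY : ∀ᵐ ω ∂P, ∀ k z, Y₁ k z ω = Y₂ k z ω) :
    TendstoL2 ρ P Y₂ Y' :=
  Tendsto.congr (fun k => lintegral_congr_ae (hY.mono fun _ hω => by simp only [hω])) h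

lemma TendstoL2At.congr {E : Type*} {Y₁ Y₂ : ℕ → E → Ω → ℝ}
    {Y' : E → Ω → ℝ} {z : E} (h : TendstoL2At P Y₁ Y' z)
    (hY : ∀ᵐ ω ∂P, ∀ k z, Y₁ k z ω = Y₂ k z ω) : TendstoL2At P Y₂ Y' z :=
  Tendsto.congr (fun k => lintegral_congr_ae (hY.mono fun _ hω => by simp only [hω])) h

end Modification

/-! ### The residual labels -/

section Labels

variable {d n N : ℕ} {Ω : Type*} {mΩ : MeasurableSpace Ω} {P : Measure Ω} [IsProbabilityMeasure P]

lemma memLp_residualLabels (S : TreeSpec d n N) (y : Fin N → ℝ) {σ δ : ℝ}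
    {a : PriorSeed d n → Ω → ℝ} {b : TrainSeed d n N → Ω → ℝ}
    (ham : ∀ i, Measurable (a i)) (ha : iIndepFun a P) (ha_law : ∀ i, HasLaw (a i) i.law P)
    (hb_law : ∀ i, HasLaw (b i) (i.law δ) P)
    {h : EuclideanSpace ℝ (Fin d) → Ω → ℝ} (hhm : ∀ z, Measurable (h z))
    (hh : TendstoFDD P P (fun T z ω => samplePrior S T (fun i => a i ω) z) h) (i : Fin N) :
    MemLp (fun ω => residualLabels S y σ (fun z => h z ω) (fun i => b i ω) i) 2 P := by
  have h1 : MemLp (h (S.input i)) 2 P :=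
    ((priorLimit_moments S ham ha ha_law hhm hh S.input).1.eval i).memLp_two
  have hl : HasLaw (b (.label i)) (gaussianReal 0 (Real.toNNReal (δ ^ 2))) P := hb_law (.label i)
  exact ((memLp_const (y i)).sub (h1.const_mul σ)).add hl.hasGaussianLaw.memLp_two

lemma measurable_residualLabels (S : TreeSpec d n N) (y : Fin N → ℝ) (σ : ℝ)
    {b : TrainSeed d n N → Ω → ℝ} (h : EuclideanSpace ℝ (Fin d) → Ω → ℝ) (i : Fin N) :
    Measurable[pastOf (fun ω i => h (S.input i) ω) b 0]
      fun ω => residualLabels S y σ (fun z => h z ω) (fun i => b i ω) i :=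
  ((((measurable_pi_apply i).comp
    (measurable_pastOf (fun ω i => h (S.input i) ω) b 0)).const_mul σ).const_sub (y i)).add
    (comap_le_pastOf _ b (τ := 0) fun τ' i' s e => by cases e)

end Labels

end KGB

open Classical in
theorem mainTheorem4 {d n N : ℕ} (hN : 1 ≤ N) (S : TreeSpec d n N) (hm : 1 ≤ S.depth)
    (ρ : Measure (EuclideanSpace ℝ (Fin d))) [IsProbabilityMeasure ρ]
    (y : Fin N → ℝ) (σ δ : ℝ) (hσ : 0 < σ) (hδ : 0 < δ)
    {Ω : Type*} [MeasurableSpace Ω] (P : Measure Ω) [IsProbabilityMeasure P]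
    -- the independent random numbers consumed by the algorithm
    (a : PriorSeed d n → Ω → ℝ) (b : TrainSeed d n N → Ω → ℝ)
    (ha : iIndepFun a P) (ha_law : ∀ i, HasLaw (a i) i.law P)
    (hb : iIndepFun b P) (hb_law : ∀ i, HasLaw (b i) (i.law δ) P)
    (hab : IndepFun (fun ω i => a i ω) (fun ω i => b i ω) P) :
    -- `stationary` is the limit of the distribution of trees as `β → ∞`
    (∀ (r : Fin N → ℝ) (τ : ℕ) (ν : Finset (Split d n)),
      Tendsto (fun β => P.real {ω | sampleTree S β r (fun i s => b (.unif τ i s) ω) = ν}) atTop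
        (𝓝 (stationary S ν))) ∧
    -- a limit `h_∞` of `h_{T₀}` exists
    (∃ (Ω' : Type) (_ : MeasurableSpace Ω') (P' : Measure Ω') (_ : IsProbabilityMeasure P')
      (h : EuclideanSpace ℝ (Fin d) → Ω' → ℝ), Measurable (Function.uncurry h) ∧
        TendstoFDD P P' (fun T z ω => samplePrior S T (fun i => a i ω) z) h) ∧
    -- let `h_∞` be such a limit, independent of the randomness of the second half
    (∀ h : EuclideanSpace ℝ (Fin d) → Ω → ℝ, Measurable (Function.uncurry h) →
      TendstoFDD P P (fun T z ω => samplePrior S T (fun i => a i ω) z) h →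
      IndepFun (fun ω z => h z ω) (fun ω i => b i ω) P →
      ∃ f : EuclideanSpace ℝ (Fin d) → Ω → ℝ, Measurable (Function.uncurry f) ∧
        -- `f_∞` is the limit of `f_{T₁}`
        (∀ (ε β : ℕ → ℝ) (T₁ : ℕ → ℕ), BoostingLimit ε β T₁ →
          let Y : ℕ → EuclideanSpace ℝ (Fin d) → Ω → ℝ := fun k z ω =>
            residualFit S y σ δ (ε k) (β k) (T₁ k) (fun z => h z ω) (fun i => b i ω) z
          TendstoL2 ρ P Y f ∧ ∀ z, TendstoL2At P Y f z) ∧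
        -- it is also the only possible limit as `T₁ → ∞` with `ε` and `β` fixed
        (∀ ε β : ℝ, 0 < ε → 0 < β →
          ∀ f' : EuclideanSpace ℝ (Fin d) → Ω → ℝ, Measurable (Function.uncurry f') →
          let Y : ℕ → EuclideanSpace ℝ (Fin d) → Ω → ℝ := fun T z ω =>
            residualFit S y σ δ ε β T (fun z => h z ω) (fun i => b i ω) z
          TendstoL2 ρ P Y f' → (∀ i, TendstoL2At P Y f' (S.input i)) →
          ∀ᵐ z ∂ρ, ∀ᵐ ω ∂P, f' z ω = f z ω) ∧
        -- the output of the algorithm converges to `σ h_∞ + f_∞`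
        (∀ (ε β : ℕ → ℝ) (T₀ T₁ : ℕ → ℕ), BoostingLimit ε β T₁ → Tendsto T₀ atTop atTop →
          TendstoFDD P P (fun k z ω => samplePosterior S y σ δ (ε k) (β k) (T₀ k) (T₁ k)
            (fun i => a i ω) (fun i => b i ω) z) (fun z ω => σ * h z ω + f z ω)) ∧
        -- `σ h_∞ + f_∞ + N(0, δ²)` is the posterior, with the noise independent across points
        (∀ η : EuclideanSpace ℝ (Fin d) → Ω → ℝ,
          IsGP P η (fun _ => 0) (fun z z' => if z = z' then δ ^ 2 else 0) →
          IndepFun (fun ω => (fun z => h z ω, fun i => b i ω)) (fun ω z => η z ω) P →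
          IsGP P (fun z ω => σ * h z ω + f z ω + η z ω) (posteriorMean S (δ ^ 2 / σ ^ 2) y)
            (fun z z' => posteriorCov S σ (δ ^ 2 / σ ^ 2) z z' + if z = z' then δ ^ 2 else 0)) ∧
        -- the same in the weak sense, with the noise `GP(0, δ² Id)` on `L²(ρ)`
        (∀ W : Lp ℝ 2 ρ → Ω → ℝ, IsWeakGP ρ P W (fun _ => 0) (fun _ _ => 0) δ →
          IndepFun (fun ω => (fun z => h z ω, fun i => b i ω)) (fun ω g => W g ω) P →
          IsWeakGP ρ P (fun g ω => ∫ z, (σ * h z ω + f z ω) * g z ∂ρ + W g ω)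
            (posteriorMean S (δ ^ 2 / σ ^ 2) y) (posteriorCov S σ (δ ^ 2 / σ ^ 2)) δ)) := by
  have hlam : 0 < δ ^ 2 / σ ^ 2 := by positivity
  -- measurable versions of the random numbers
  set a' : PriorSeed d n → Ω → ℝ := fun i => (ha_law i).aemeasurable.mk (a i) with ha'_def
  set b' : TrainSeed d n N → Ω → ℝ := fun i => (hb_law i).aemeasurable.mk (b i) with hb'_def
  have haa : ∀ i, a i =ᵐ[P] a' i := fun i => (ha_law i).aemeasurable.ae_eq_mk
  have hbb : ∀ i, b i =ᵐ[P] b' i := fun i => (hb_law i).aemeasurable.ae_eq_mk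
  have ham : ∀ i, Measurable (a' i) := fun i => (ha_law i).aemeasurable.measurable_mk
  have hbm : ∀ i, Measurable (b' i) := fun i => (hb_law i).aemeasurable.measurable_mk
  have hae_a : ∀ᵐ ω ∂P, (fun i => a i ω) = fun i => a' i ω :=
    (ae_all_iff.2 haa).mono fun _ hω => funext hω
  have hae_b : ∀ᵐ ω ∂P, (fun i => b i ω) = fun i => b' i ω :=
    (ae_all_iff.2 hbb).mono fun _ hω => funext hω
  have ha' : iIndepFun a' P := ha.congr haa
  have hb' : iIndepFun b' P := hb.congr hbb
  have ha'_law : ∀ i, HasLaw (a' i) i.law P := fun i => (ha_law i).congr (haa i).symm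
  have hb'_law : ∀ i, HasLaw (b' i) (i.law δ) P := fun i => (hb_law i).congr (hbb i).symm
  have hab' : IndepFun (fun ω i => a' i ω) (fun ω i => b' i ω) P := hab.congr hae_a hae_b
  refine ⟨fun r τ ν => ?_, ?_, fun h hhm hh hhb => ?_⟩
  · refine (tendsto_measureReal_sampleTree S (isUniformNoise_train hbm hb' hb'_law τ) r ν).congr
      fun β => measureReal_congr (eventuallyEq_set.2 ?_)
    filter_upwards [hae_b] with ω hω
    have e : ∀ i, b' i ω = b i ω := fun i => (congrFun hω i).symm
    simp only [e]
  · refine ⟨_, _, coefLaw d n, inferInstance, priorLimit S,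
      measurable_uncurry_of_leaf S (measurable_priorLimit S) fun z z' hz => funext fun g => ?_, ?_⟩
    · simp only [priorLimit, feature, leafInd_congr S hz]
    · exact (tendstoFDD_samplePrior S ham ha' ha'_law).congr
        (hae_a.mono fun ω hω k z => by simp only [hω])
  have hh' : TendstoFDD P P (fun T z ω => samplePrior S T (fun i => a' i ω) z) h :=
    hh.congr (hae_a.mono fun ω hω k z => by simp only [hω])
  have hhb' : IndepFun (fun ω z => h z ω) (fun ω i => b' i ω) P := hhb.congr EventuallyEq.rfl hae_b
  have hpair : (fun ω => ((fun z => h z ω), fun i => b i ω)) =ᵐ[P]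
      fun ω => ((fun z => h z ω), fun i => b' i ω) := hae_b.mono fun ω hω => by simp only [hω]
  have hhz : ∀ z, Measurable (h z) := fun z => hhm.comp measurable_prodMk_left
  set L : Ω → Fin N → ℝ := fun ω => residualLabels S y σ (fun z => h z ω) fun i => b' i ω with hL
  have hZ : Measurable fun ω i => h (S.input i) ω := measurable_pi_lambda _ fun i => hhz _
  have hu := isAdaptedNoise_train (P := P) hZ hbm hb' hb'_law
    (hhb'.comp (φ := fun (v : EuclideanSpace ℝ (Fin d) → ℝ) i => v (S.input i)) (ψ := id)
      (by fun_prop) measurable_id)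
  have hLp : ∀ i, Measurable[pastOf (fun ω i => h (S.input i) ω) b' 0] fun ω => L ω i :=
    measurable_residualLabels S y σ h
  have hLm : ∀ i, Measurable fun ω => L ω i := fun i => (hLp i).mono (hu.le 0) le_rfl
  have hL2 : ∀ i, MemLp (fun ω => L ω i) 2 P :=
    memLp_residualLabels S y ham ha' ha'_law hb'_law hhz hh'
  have hfit : ∀ (ε β : ℕ → ℝ) (T : ℕ → ℕ), ∀ᵐ ω ∂P, ∀ k z,
      trainGBDT S (ε k) (β k) (δ ^ 2 / σ ^ 2) (L ω) (fun τ i s => b' (.unif τ i s) ω) (T k) z =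
      residualFit S y σ δ (ε k) (β k) (T k) (fun z => h z ω) (fun i => b i ω) z := fun ε β T =>
    hae_b.mono fun ω hω k z => by rw [hω]; rfl
  refine ⟨fun z ω => posteriorMean S (δ ^ 2 / σ ^ 2) (L ω) z,
    measurable_uncurry_posteriorMean S _ hLm, fun ε β T₁ hT => ⟨?_, fun z => ?_⟩,
    fun ε β hε hβ f' hf' hY hYx => ?_, fun ε β T₀ T₁ hT₁ hT₀ => ?_, fun η hη hηi => ?_,
    fun W hW hWi => ?_⟩
  · exact (tendstoL2_trainGBDT hN S ρ hlam hT hu hLp hL2).congr (hfit ε β T₁)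
  · exact (tendstoL2At_trainGBDT hN S hlam hT hu hLp hL2 z).congr (hfit ε β T₁)
  · have hsymm := (hfit (fun _ => ε) (fun _ => β) id).mono fun ω hω k z => (hω k z).symm
    exact ae_ae_eq_posteriorMean_of_tendstoL2 hN S ρ hε hβ hlam hu hLp hf' (hY.congr hsymm)
      fun i => (hYx i).congr hsymm
  · refine (tendstoFDD_samplePosterior hN S y hσ hδ ham hbm hb' hb'_law hab' hh' hhb' hT₁
      hT₀).congr ?_
    filter_upwards [hae_a, hae_b] with ω h1 h2 k z
    rw [h1, h2]
  · exact isGP_posterior S y hσ hδ ham ha' ha'_law hb' hb'_law hhz hh' hhb' hη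
      (hηi.congr hpair EventuallyEq.rfl)
  · exact isWeakGP_posterior S ρ y hσ hδ ham hbm ha' ha'_law hb' hb'_law hhm hh' hhb' hW
      (hWi.congr hpair EventuallyEq.rfl)
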